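/- Setting. A common subsequence of strings $X,Y$ is a string that is a (not necessarily contiguous) subsequence of both; it is a maximal common subsequence (MCS) if inserting any character at any position yields no common subsequence. The model of computation is the unit-cost RAM. An algorithm solves the MCS enumeration problem as an $(f_p,f_s,f_d)$-algorithm if, for all strings $X,Y$ of length $O(n)$ ($n\ge 1$) over $\{1,\dots,\sigma\}$, it performs an $O(f_p(n,\sigma))$-time preprocessing, uses $O(f_s(n,\sigma))$ memory cells (each holding a number of $O(\log(n+\sigma))$ bits), and then outputs all MCSs of $X$ and $Y$, each exactly once, with at most $O(f_d(n,\sigma))$ time between the end of the preprocessing and the first output, between consecutive outputs, and between the last output and termination. The all-MCS graph. Normalize $X,Y$: rename the characters that occur in them to $2,\dots,\tau-1$, where $\tau=|X|+|Y|+2$ (the new name of a character is $2$ plus the number of characters before its first occurrence in the concatenation of $X$ and $Y$), prepend the character $1$ and append the character $\tau$ to each string. Let $\hat X,\hat Y$ be the resulting strings and, for a string $Z$ of characters that occur in $X$ or $Y$, let $\hat Z$ be obtained from $Z$ in the same way. A match is a pair $w=(i_w,j_w)$ with $1\le i_w\le|\hat X|$, $1\le j_w\le|\hat Y|$ and $\hat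 X[i_w]=\hat Y[j_w]=:c_w$. Write $u<v$ if $i_u<i_v$ and $j_u<j_v$, and $u\prec v$ if $u,v$ are matches with $u<v$ and no match $w$ satisfies $u<w<v$. For a character $c$, let $\mathrm{next}(c,w)$ (resp. $\mathrm{prev}(c,w)$) be the pair of the least indices greater than $i_w$ in $\hat X$ and greater than $j_w$ in $\hat Y$ (resp. the greatest indices less than these) at which $c$ occurs. Let $G$ be the directed graph with an edge from $(\mathrm{prev}(c_u,v),u)$ to $(v,\mathrm{next}(c_v,u))$ for all matches $u\prec v$. The all-MCS graph consists of the edges of $G$ that lie on a path of $G$ from the source $((1,1),(1,1))$ to the sink $((|\hat X|,|\hat Y|),(|\hat X|,|\hat Y|))$. A path through the vertices $(v_0,u_1),(v_1,u_2),\dots,(v_{\ell-1},u_\ell)$ represents the string $c_{u_1}c_{u_2}\cdots c_{u_\ell}$. Algorithm Enum331 works as follows. It normalizes the strings and tabulates the next and previous occurrences of every character after and before every position. For every match $u$ it lists all matches $v$ with $u\prec v$ by starting with $(i,j)=(|\hat X|,j_u+1)$ and, while $j\le|\hat Y|$, listing $(i,j)$ if $\hat X[i]=\hat Y[j]$, and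 then replacing $i$ by the greatest $i'<i$ with $\hat X[i']=\hat Y[j]$ if there is such an $i'>i_u$, and $j$ by $j+1$ otherwise. It stores the graph $G$ so obtained, restricts it by a breadth-first search from the source and then by a backward breadth-first search from the sink to the all-MCS graph, and stores the latter as an array $G''$ of sequences, indexed by $(i,j,d)$ with $1\le i\le|\hat X|$, $1\le j\le|\hat Y|$, $1-|\hat X|\le d\le|\hat Y|-1$: the sequence $G''[i,j,d]$ lists, without repetition, the heads of all edges of the all-MCS graph that leave the vertex $(v',u)$ with $u=(i,j)$ and $j_{v'}-i_{v'}=d$, and it is empty if there is no such vertex. This is the preprocessing. Then it enumerates the source-to-sink paths of the all-MCS graph by depth-first traversal of $G''$ and outputs, for each of them, the represented string with its sentinels $1$ and $\tau$ removed and its original characters restored. Theorem. Algorithm Enum331 is an $(n^3,n^3,n)$-algorithm that solves the MCS enumeration problem. Moreover, for all strings $X,Y$ of length $O(n)$, after its $O(n^3)$-time preprocessing the array $G''$ is in memory, correctly represents the all-MCS graph in the sense just described, and has total size $O(n^3)$; and the strings $Z$ that are output by the enumeration are, in order, those for which $\hat Z$ is represented by the source-to-sink paths $P$ of the all-MCS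 graph, for an enumeration of all these paths without repetition. -/

import Mathlib

namespace MCS

/-! ### Maximal common subsequences -/

/-- `Z` is a common subsequence of `X` and `Y`. -/
def IsCommonSubseq {α : Type*} (X Y Z : List α) : Prop :=
  Z.Sublist X ∧ Z.Sublist Y

/-- `Z` is a maximal common subsequence of `X` and `Y`: a common subsequence such that inserting
any character at any position no longer gives a common subsequence. -/
def IsMCS {α : Type*} (X Y Z : List α) : Prop :=
  IsCommonSubseq X Y Z ∧
    ∀ (P Q : List α) (c : α), Z = P ++ Q → ¬ IsCommonSubseq X Y (P ++ c :: Q)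

/-! ### Matches and the all-MCS graph (indices start at 1) -/

/-- The `i`th character `W[i]`, for `1 ≤ i ≤ |W|`. -/
def charAt (W : List ℕ) (i : ℕ) : ℕ := W.getD (i - 1) 0

/-- The least index `h'` with `h < h' ≤ |W|` and `W[h'] = c`, if any, or `|W| + 1`, otherwise. -/
def nextIdx (W : List ℕ) (c h : ℕ) : ℕ :=
  ((List.range' (h + 1) (W.length - h)).find? (fun h' => charAt W h' == c)).getD (W.length + 1)

/-- The greatest index `h'` with `1 ≤ h' < h` and `W[h'] = c`, if any, or `0`, otherwise. -/
def prevIdx (W : List ℕ) (c h : ℕ) : ℕ :=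
  ((List.range' 1 (h - 1)).reverse.find? (fun h' => charAt W h' == c)).getD 0

/-- `(i, j)` is a match of `X` and `Y`. -/
def IsMatch (X Y : List ℕ) (w : ℕ × ℕ) : Prop :=
  1 ≤ w.1 ∧ w.1 ≤ X.length ∧ 1 ≤ w.2 ∧ w.2 ≤ Y.length ∧ charAt X w.1 = charAt Y w.2

/-- The character `c_w` of a match `w`. -/
def matchChar (X : List ℕ) (w : ℕ × ℕ) : ℕ := charAt X w.1

/-- `u < v`: both coordinates increase strictly. -/
def Below (u v : ℕ × ℕ) : Prop := u.1 < v.1 ∧ u.2 < v.2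

/-- `u ≺ v`: `u` and `v` are matches with `u < v` and no match is strictly between them. -/
def Prec (X Y : List ℕ) (u v : ℕ × ℕ) : Prop :=
  IsMatch X Y u ∧ IsMatch X Y v ∧ Below u v ∧ ¬ ∃ w, IsMatch X Y w ∧ Below u w ∧ Below w v

/-- `next(c, w)`. -/
def nextMatch (X Y : List ℕ) (c : ℕ) (w : ℕ × ℕ) : ℕ × ℕ := (nextIdx X c w.1, nextIdx Y c w.2)

/-- `prev(c, w)`. -/
def prevMatch (X Y : List ℕ) (c : ℕ) (w : ℕ × ℕ) : ℕ × ℕ := (prevIdx X c w.1, prevIdx Y c w.2)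

/-- A vertex `(w, w')` is a pair of matches. -/
abbrev Vertex := (ℕ × ℕ) × (ℕ × ℕ)

/-- The edges of the graph `G`: one from `(prev(c_u, v), u)` to `(v, next(c_v, u))` for all
matches `u ≺ v`. -/
def EdgeG (X Y : List ℕ) (p q : Vertex) : Prop :=
  ∃ u v : ℕ × ℕ, Prec X Y u v ∧
    p = (prevMatch X Y (matchChar X u) v, u) ∧ q = (v, nextMatch X Y (matchChar X v) u)

/-- The source vertex `((1, 1), (1, 1))`. -/
def source : Vertex := ((1, 1), (1, 1))

/-- The sink vertex `((|X|, |Y|), (|X|, |Y|))`. -/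
def sink (X Y : List ℕ) : Vertex := ((X.length, Y.length), (X.length, Y.length))

/-- The edges of the all-MCS graph: the edges of `G` that lie on a path of `G` from the source to
the sink. -/
def AllMCSEdge (X Y : List ℕ) (p q : Vertex) : Prop :=
  EdgeG X Y p q ∧ Relation.ReflTransGen (EdgeG X Y) source p ∧
    Relation.ReflTransGen (EdgeG X Y) q (sink X Y)

/-- `P` is (the list of the vertices of) a path of the all-MCS graph from source to sink. -/
def IsSourceSinkPath (X Y : List ℕ) (P : List Vertex) : Prop :=
  P.head? = some source ∧ P.getLast? = some (sink X Y) ∧ P.IsChain (AllMCSEdge X Y)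

/-- The string `c_{u_1} ∘ c_{u_2} ∘ ⋯` represented by the path `(v_0, u_1), (v_1, u_2), …`. -/
def pathString (X : List ℕ) (P : List Vertex) : List ℕ := P.map fun w => matchChar X w.2

/-- The strings are normalized by renaming the characters that occur in `X` or `Y` to
`2, 3, …, |X| + |Y| + 1` (by first occurrence in `X ∘ Y`) and by adding the sentinel
`1` in front and the sentinel `|X| + |Y| + 2` at the end. -/
def normalize (X Y W : List ℕ) : List ℕ :=
  1 :: (W.map fun c => (X ++ Y).idxOf c + 2) ++ [X.length + Y.length + 2]

/-! ### Unit-cost random access machine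

Programs over finitely many registers (named by `V`) and arrays (named by `A`), holding natural
numbers. Every arithmetic operation, memory access, comparison and control step costs one unit. -/

/-- Arithmetic expressions; `sub` is truncated subtraction, `get a e` reads cell `e` of array `a`. -/
inductive Expr (V A : Type) : Type
  | const (k : ℕ)
  | reg (x : V)
  | get (a : A) (e : Expr V A)
  | add (e f : Expr V A)
  | sub (e f : Expr V A)
  | mul (e f : Expr V A)

/-- Tests. -/
inductive Test (V A : Type) : Type
  | lt (e f : Expr V A)
  | eq (e f : Expr V A)
  | not (t : Test V A)
  | and (t u : Test V A)

/-- Commands. `loop t c` repeats `c` while `t` holds, `emit e` appends the character `e` to the string that is being output, and `finish`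
completes that string. -/
inductive Cmd (V A : Type) : Type
  | skip
  | assign (x : V) (e : Expr V A)
  | store (a : A) (i e : Expr V A)
  | seq (c d : Cmd V A)
  | ite (t : Test V A) (c d : Cmd V A)
  | loop (t : Test V A) (c : Cmd V A)
  | emit (e : Expr V A)
  | finish

/-- Machine states: registers, arrays, elapsed time, the string being output, and the completed
output strings, in order, each with the time of its completion. -/
structure State (V A : Type) : Type where
  reg : V → ℕ
  mem : A → ℕ → ℕ
  clock : ℕ
  buf : List ℕ
  out : List (List ℕ × ℕ)

section Semantics

variable {V A : Type}

/-- The value of an expression. -/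
def Expr.eval (s : State V A) : Expr V A → ℕ
  | .const k => k
  | .reg x => s.reg x
  | .get a e => s.mem a (e.eval s)
  | .add e f => e.eval s + f.eval s
  | .sub e f => e.eval s - f.eval s
  | .mul e f => e.eval s * f.eval s

/-- The cost of an expression: one unit per node. -/
def Expr.cost : Expr V A → ℕ
  | .const _ => 1
  | .reg _ => 1
  | .get _ e => e.cost + 1
  | .add e f => e.cost + f.cost + 1
  | .sub e f => e.cost + f.cost + 1
  | .mul e f => e.cost + f.cost + 1

/-- All array cells read by the expression have an address less than `M`. -/
def Expr.InBounds (M : ℕ) (s : State V A) : Expr V A → Prop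
  | .const _ => True
  | .reg _ => True
  | .get _ e => e.InBounds M s ∧ e.eval s < M
  | .add e f => e.InBounds M s ∧ f.InBounds M s
  | .sub e f => e.InBounds M s ∧ f.InBounds M s
  | .mul e f => e.InBounds M s ∧ f.InBounds M s

/-- The test succeeds. -/
def Test.Holds (s : State V A) : Test V A → Prop
  | .lt e f => e.eval s < f.eval s
  | .eq e f => e.eval s = f.eval s
  | .not t => ¬ t.Holds s
  | .and t u => t.Holds s ∧ u.Holds s

/-- The cost of a test. -/
def Test.cost : Test V A → ℕ
  | .lt e f => e.cost + f.cost + 1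
  | .eq e f => e.cost + f.cost + 1
  | .not t => t.cost + 1
  | .and t u => t.cost + u.cost + 1

/-- All array cells read by the test have an address less than `M`. -/
def Test.InBounds (M : ℕ) (s : State V A) : Test V A → Prop
  | .lt e f => e.InBounds M s ∧ f.InBounds M s
  | .eq e f => e.InBounds M s ∧ f.InBounds M s
  | .not t => t.InBounds M s
  | .and t u => t.InBounds M s ∧ u.InBounds M s

/-- Let `k` units of time pass. -/
def State.tick (k : ℕ) (s : State V A) : State V A := { s with clock := s.clock + k }

/-- Write a register. -/
def State.setReg [DecidableEq V] (x : V) (v : ℕ) (s : State V A) : State V A :=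
  { s with reg := Function.update s.reg x v }

/-- Write an array cell. -/
def State.setMem [DecidableEq A] (a : A) (i v : ℕ) (s : State V A) : State V A :=
  { s with mem := Function.update s.mem a (Function.update (s.mem a) i v) }

/-- `Exec M W c s s'`: on a machine whose arrays have `M` cells each and whose registers and cells
hold the numbers at most `W`, command `c` started in state `s` terminates in state `s'`. Reading
or writing outside the arrays, or writing a number greater than `W`, is impossible. -/
inductive Exec [DecidableEq V] [DecidableEq A] (M W : ℕ) :
    Cmd V A → State V A → State V A → Prop
  | skip (s : State V A) : Exec M W .skip s (s.tick 1)
  | assign (s : State V A) (x : V) (e : Expr V A) (he : e.InBounds M s) (hW : e.eval s ≤ W) :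
      Exec M W (.assign x e) s ((s.setReg x (e.eval s)).tick (e.cost + 1))
  | store (s : State V A) (a : A) (i e : Expr V A) (hi : i.InBounds M s) (he : e.InBounds M s)
      (hM : i.eval s < M) (hW : e.eval s ≤ W) :
      Exec M W (.store a i e) s
        ((s.setMem a (i.eval s) (e.eval s)).tick (i.cost + e.cost + 1))
  | seq (s s' s'' : State V A) (c d : Cmd V A) (hc : Exec M W c s s') (hd : Exec M W d s' s'') :
      Exec M W (.seq c d) s s''
  | ite_pos (s s' : State V A) (t : Test V A) (c d : Cmd V A) (hb : t.InBounds M s)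
      (ht : t.Holds s) (hc : Exec M W c (s.tick (t.cost + 1)) s') :
      Exec M W (.ite t c d) s s'
  | ite_neg (s s' : State V A) (t : Test V A) (c d : Cmd V A) (hb : t.InBounds M s)
      (ht : ¬ t.Holds s) (hd : Exec M W d (s.tick (t.cost + 1)) s') :
      Exec M W (.ite t c d) s s'
  | loop_pos (s s' s'' : State V A) (t : Test V A) (c : Cmd V A) (hb : t.InBounds M s)
      (ht : t.Holds s) (hc : Exec M W c (s.tick (t.cost + 1)) s')
      (hw : Exec M W (.loop t c) s' s'') :
      Exec M W (.loop t c) s s''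
  | loop_neg (s : State V A) (t : Test V A) (c : Cmd V A) (hb : t.InBounds M s)
      (ht : ¬ t.Holds s) :
      Exec M W (.loop t c) s (s.tick (t.cost + 1))
  | emit (s : State V A) (e : Expr V A) (he : e.InBounds M s) (hW : e.eval s ≤ W) :
      Exec M W (.emit e) s ({ s with buf := s.buf ++ [e.eval s] }.tick (e.cost + 1))
  | finish (s : State V A) :
      Exec M W .finish s
        ({ s with buf := [], out := s.out ++ [(s.buf, s.clock + 1)] }.tick 1)

end Semantics

/-! ### Enumeration algorithms -/

/-- An algorithm that takes two strings: a program in two phases, and the registers and arrays in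
which the input is given. -/
structure Algorithm : Type 1 where
  V : Type
  A : Type
  [decV : DecidableEq V]
  [decA : DecidableEq A]
  [finV : Fintype V]
  [finA : Fintype A]
  lenX : V
  lenY : V
  arrX : A
  arrY : A
  lenX_ne_lenY : lenX ≠ lenY
  arrX_ne_arrY : arrX ≠ arrY
  preprocessing : Cmd V A
  enumeration : Cmd V A

attribute [instance] Algorithm.decV Algorithm.decA Algorithm.finV Algorithm.finA

/-- The initial state: two registers hold the lengths of the strings `X` and `Y`, two arrays hold
their characters, everything else is `0`. -/
def Algorithm.init (P : Algorithm) (X Y : List ℕ) : State P.V P.A where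
  reg x := if x = P.lenX then X.length else if x = P.lenY then Y.length else 0
  mem a i := if a = P.arrX then X.getD i 0 else if a = P.arrY then Y.getD i 0 else 0
  clock := 0
  buf := []
  out := []

/-- With `M` cells per array and numbers up to `W`, the preprocessing for `X` and `Y` ends in state
`s`, and the enumeration ends in state `s'`. -/
def Algorithm.Runs (P : Algorithm) (M W : ℕ) (X Y : List ℕ) (s s' : State P.V P.A) : Prop :=
  Exec M W P.preprocessing (P.init X Y) s ∧ Exec M W P.enumeration s s'

/-- The number of memory cells (registers and array cells) if every array has `M` cells. -/
def Algorithm.space (P : Algorithm) (M : ℕ) : ℕ := Fintype.card P.V + Fintype.card P.A * M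

/-- `P` is an `(f_p(n, σ), f_s(n, σ), f_d(n, σ))`-algorithm that solves the MCS enumeration
problem: for any strings `X` and `Y` of length `O(n)` over `{1, 2, …, σ}` it performs an
`O(f_p)`-time preprocessing, uses `O(f_s)` memory cells (for numbers of `O(log (n + σ))` bits), and
outputs all distinct MCSs of `X` and `Y`, each exactly once and each within `O(f_d)` time after the
preceding output (the first one after the preprocessing), and it halts within `O(f_d)` time after
the last output. -/
def SolvesMCSEnumeration (P : Algorithm) (fp fs fd : ℕ → ℕ → ℕ) : Prop :=
  ∀ L : ℕ, ∃ C : ℕ, ∀ (n σ : ℕ) (X Y : List ℕ), 1 ≤ n →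
    X.length ≤ L * n → Y.length ≤ L * n →
    (∀ c ∈ X, 1 ≤ c ∧ c ≤ σ) → (∀ c ∈ Y, 1 ≤ c ∧ c ≤ σ) →
    ∃ (M W : ℕ) (s s' : State P.V P.A),
      P.Runs M W X Y s s' ∧
      W ≤ C * (n + σ) ^ C ∧
      s.clock ≤ C * fp n σ ∧
      P.space M ≤ C * fs n σ ∧
      s.out = [] ∧ s.buf = [] ∧ s'.buf = [] ∧
      (s'.out.map Prod.fst).Nodup ∧
      (∀ Z : List ℕ, Z ∈ s'.out.map Prod.fst ↔ IsMCS X Y Z) ∧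
      (s.clock :: s'.out.map Prod.snd ++ [s'.clock]).IsChain (fun t t' => t' ≤ t + C * fd n σ)

/-! ### Algorithm Enum331 -/

section Notation

variable {V A : Type}

instance : Add (Expr V A) := ⟨Expr.add⟩
instance : Sub (Expr V A) := ⟨Expr.sub⟩
instance : Mul (Expr V A) := ⟨Expr.mul⟩
instance (k : ℕ) : OfNat (Expr V A) k := ⟨Expr.const k⟩

/-- `for x := a, …, b - 1 do c`. -/
def forRange (x : V) (a b : Expr V A) (c : Cmd V A) : Cmd V A :=
  .seq (.assign x a) (.loop (.lt (.reg x) b) (.seq c (.assign x (.reg x + 1))))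

/-- `if t then c`. -/
def ifThen (t : Test V A) (c : Cmd V A) : Cmd V A := .ite t c .skip

end Notation

namespace Enum331

/-- Register names. -/
inductive Var
  | nx | ny -- the lengths of the input strings
  | lx | ly -- the lengths of the normalized strings `X` and `Y`
  | sg -- the size of the alphabet of the normalized strings
  | K -- the number of indices of the arrays of sequences
  | p | q | r | c | h | t | k | w | e -- auxiliary registers and loop counters
  | ui | uj | vi | vj -- the coordinates of the matches `u` and `v`
  | ai | aj | bi | bj -- the coordinates of `prev(c_u, v)` and of `next(c_v, u)`
  | d -- a diagonal coordinate, shifted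
  | E -- the number of edges
  | qh | qt -- head and tail of the queue
  | len -- the number of edges of the current path
  | run -- whether a path remains to be output
  deriving DecidableEq

instance : Fintype Var :=
  Fintype.ofList
    [.nx, .ny, .lx, .ly, .sg, .K, .p, .q, .r, .c, .h, .t, .k, .w, .e, .ui, .uj, .vi, .vj,
     .ai, .aj, .bi, .bj, .d, .E, .qh, .qt, .len, .run]
    (by intro x; cases x <;> simp)

/-- Array names. -/
inductive Arr
  | inX | inY -- the input strings
  | cat -- the concatenation of the input strings
  | lab -- the new names of its characters
  | X | Y -- the normalized strings, from index 1 on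
  | nextX | nextY | prevX | prevY -- the tables for next/prev-queries
  | row -- the index `i` of each index `(i, j, d)` of the arrays of sequences
  | src | dst -- the list of edges
  | G | seqG -- the array `G` of sequences: offsets and elements
  | G1 | seqG1 -- the array `G'` of sequences: offsets and elements
  | G2 | seqG2 -- the array `G''` of sequences: offsets and elements
  | cur -- current ends of the sequences under construction
  | mark | queue -- for breadth-first search
  | vert | ptr -- the vertices and the edges of the current path
  deriving DecidableEq

instance : Fintype Arr :=
  Fintype.ofList
    [.inX, .inY, .cat, .lab, .X, .Y, .nextX, .nextY, .prevX, .prevY, .row, .src, .dst, .G,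
     .seqG, .G1, .seqG1, .G2, .seqG2, .cur, .mark, .queue, .vert, .ptr]
    (by intro x; cases x <;> simp)

open Var Arr

instance : Coe Var (Expr Var Arr) := ⟨Expr.reg⟩

/-- `a e` is the content of cell `e` of array `a`. -/
instance : CoeFun Arr (fun _ => Expr Var Arr → Expr Var Arr) := ⟨Expr.get⟩

/-- Sequential composition. -/
infixr:60 " ;; " => Cmd.seq

/-- Assignment to a register. -/
infix:61 " ::= " => Cmd.assign

/-- Adds sentinels to an input string and renames its characters; the new names of the characters
of this string start at index `o` of the array `lab`. -/
def addSentinels (o : Expr Var Arr) (l : Var) (strOut : Arr) : Cmd Var Arr :=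
  Cmd.store strOut 1 1 ;;
  forRange p 0 (l - 2) (Cmd.store strOut (p + 2) (lab (o + p))) ;;
  Cmd.store strOut l sg

/-- Normalizes the input strings. The new name of a character is `2` plus the index of its first
occurrence in the concatenation of the input strings. -/
def normalizeInput : Cmd Var Arr :=
  lx ::= nx + 2 ;;
  ly ::= ny + 2 ;;
  sg ::= nx + ny + 2 ;;
  forRange p 0 nx (Cmd.store cat p (inX p)) ;;
  forRange p 0 ny (Cmd.store cat (nx + p) (inY p)) ;;
  forRange p 0 (nx + ny)
    (q ::= 0 ;;
      Cmd.loop (.not (.eq (cat q) (cat p))) (q ::= q + 1) ;;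
      Cmd.store lab p (q + 2)) ;;
  addSentinels 0 lx X ;;
  addSentinels nx ly Y

/-- The cell of the table of a string of length `l` for character `c` and index `h`. -/
def tableAt (l : Var) (c h : Expr Var Arr) : Expr Var Arr := c * (l + 1) + h

/-- Constructs the tables for the next/prev-queries to a string. -/
def buildTable (str : Arr) (l : Var) (nextT prevT : Arr) : Cmd Var Arr :=
  forRange c 1 (sg + 1)
    (t ::= 0 ;;
      forRange h 1 (l + 1)
        (Cmd.store prevT (tableAt l c h) t ;;
          ifThen (.eq (str h) c) (t ::= h)) ;;
      t ::= l + 1 ;;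
      forRange p 0 l
        (h ::= l - p ;;
          Cmd.store nextT (tableAt l c h) t ;;
          ifThen (.eq (str h) c) (t ::= h)))

/-- The number of the index `(i, j, d)`, where `d` is given as `d + |X|`. -/
def indexOf (i j d : Expr Var Arr) : Expr Var Arr := (i * (ly + 1) + j) * (lx + ly) + d

/-- The number of the index `(i_b, j_b, d_a)` of a vertex `(a, b)`, where `d_a = j_a - i_a`. -/
def keyOf (ia ja ib jb : Expr Var Arr) : Expr Var Arr := indexOf ib jb (ja + lx - ia)

/-- Computes the number of indices of the arrays of sequences, and the component `i` of each. -/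
def initIndices : Cmd Var Arr :=
  K ::= (lx + 1) * (ly + 1) * (lx + ly) ;;
  forRange ui 0 (lx + 1) (forRange uj 0 (ly + 1) (forRange d 0 (lx + ly)
    (Cmd.store row (indexOf ui uj d) ui)))

/-- For the match `v = (vi, vj)`, which has been found to satisfy `u ≺ v`, lists the edge from
`(prev(c_u, v), u)` to `(v, next(c_v, u))`. -/
def listEdge : Cmd Var Arr :=
  ai ::= prevX (tableAt lx (X ui) vi) ;;
  aj ::= prevY (tableAt ly (X ui) vj) ;;
  bi ::= nextX (tableAt lx (X vi) ui) ;;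
  bj ::= nextY (tableAt ly (X vi) uj) ;;
  Cmd.store src E (keyOf ai aj ui uj) ;;
  Cmd.store dst E (keyOf vi vj bi bj) ;;
  E ::= E + 1

/-- Procedure FindEdges(u) for the match `u = (ui, uj)`. -/
def findEdges : Cmd Var Arr :=
  vi ::= lx ;;
  vj ::= uj + 1 ;;
  Cmd.loop (.lt vj (ly + 1))
    (ifThen (.eq (X vi) (Y vj)) listEdge ;;
      t ::= prevX (tableAt lx (Y vj) vi) ;;
      Cmd.ite (.lt ui t) (vi ::= t) (vj ::= vj + 1))

/-- Lists all edges of `G`. -/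
def listEdges : Cmd Var Arr :=
  E ::= 0 ;;
  forRange ui 1 (lx + 1) (forRange uj 1 (ly + 1)
    (ifThen (.eq (X ui) (Y uj)) findEdges))

/-- Constructs an array of sequences from the list of edges: for each edge, in the order of the
list, its entry in `val` is appended to the sequence with the index given by its entry in `key`.
The sequence with index `k` consists of the cells of the array `seqs` from `offs[k]` on and
before `offs[k + 1]`. -/
def buildSeqs (key val offs seqs : Arr) : Cmd Var Arr :=
  forRange k 0 (K + 1) (Cmd.store offs k 0) ;;
  forRange e 0 E (Cmd.store offs (key e + 1) (offs (key e + 1) + 1)) ;;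
  forRange k 0 K (Cmd.store offs (k + 1) (offs (k + 1) + offs k)) ;;
  forRange k 0 K (Cmd.store cur k (offs k)) ;;
  forRange e 0 E
    (Cmd.store seqs (cur (key e)) (val e) ;;
      Cmd.store cur (key e) (cur (key e) + 1))

/-- Breadth-first search: marks every vertex that is reachable from the vertex `start` in the graph
given by an array of sequences. -/
def bfs (offs seqs : Arr) (start : Expr Var Arr) : Cmd Var Arr :=
  forRange k 0 K (Cmd.store mark k 0) ;;
  Cmd.store mark start 1 ;;
  Cmd.store queue 0 start ;;
  qh ::= 0 ;;
  qt ::= 1 ;;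
  Cmd.loop (.lt qh qt)
    (k ::= queue qh ;;
      qh ::= qh + 1 ;;
      forRange p (offs k) (offs (k + 1))
        (w ::= seqs p ;;
          ifThen (.eq (mark w) 0)
            (Cmd.store mark w 1 ;;
              Cmd.store queue qt w ;;
              qt ::= qt + 1)))

/-- Keeps only the edges whose entry in `endpoint` is marked. -/
def filterEdges (endpoint : Arr) : Cmd Var Arr :=
  r ::= 0 ;;
  forRange e 0 E
    (ifThen (.eq (mark (endpoint e)) 1)
      (Cmd.store src r (src e) ;;
        Cmd.store dst r (dst e) ;;
        r ::= r + 1)) ;;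
  E ::= r

/-- The number of the source vertex. -/
def sourceKey : Expr Var Arr := keyOf 1 1 1 1

/-- The number of the sink vertex. -/
def sinkKey : Expr Var Arr := keyOf lx ly lx ly

/-- Constructs `G`, then `G'` (the edges of `G` reachable from the source, stored by their heads),
then `G''` (the edges of `G'` from which the sink is reachable, stored by their tails). -/
def preprocessing : Cmd Var Arr :=
  normalizeInput ;;
  buildTable X lx nextX prevX ;;
  buildTable Y ly nextY prevY ;;
  initIndices ;;
  listEdges ;;
  buildSeqs src dst G seqG ;;
  bfs G seqG sourceKey ;;
  filterEdges src ;;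
  buildSeqs dst src G1 seqG1 ;;
  bfs G1 seqG1 sinkKey ;;
  filterEdges dst ;;
  buildSeqs src dst G2 seqG2

/-- Extends the current path to the sink, always along the first edge. -/
def extendPath : Cmd Var Arr :=
  Cmd.loop (.not (.eq (vert len) sinkKey))
    (Cmd.store ptr len (G2 (vert len)) ;;
      Cmd.store vert (len + 1) (seqG2 (ptr len)) ;;
      len ::= len + 1)

/-- Outputs the string of the current path, with the original characters and without sentinels. -/
def outputPath : Cmd Var Arr :=
  forRange k 1 len (Cmd.emit (cat (X (row (vert k)) - 2))) ;;
  Cmd.finish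

/-- Shortens the current path until its last edge is not the last one in its sequence; then
replaces this edge by the next one in its sequence. If there is no such edge, then all paths have
been output. -/
def advancePath : Cmd Var Arr :=
  Cmd.loop (.and (.lt 0 len) (.eq (ptr (len - 1) + 1) (G2 (vert (len - 1) + 1))))
    (len ::= len - 1) ;;
  Cmd.ite (.eq len 0) (run ::= 0)
    (Cmd.store ptr (len - 1) (ptr (len - 1) + 1) ;;
      Cmd.store vert len (seqG2 (ptr (len - 1))))

/-- Enumerates the paths from the source to the sink, in the lexicographic order of the positions
of their edges in the sequences of `G''`. -/
def enumeration : Cmd Var Arr :=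
  len ::= 0 ;;
  Cmd.store vert 0 sourceKey ;;
  run ::= 1 ;;
  Cmd.loop (.lt 0 run) (extendPath ;; outputPath ;; advancePath)

end Enum331

/-- Algorithm Enum331. -/
def enum331 : Algorithm where
  V := Enum331.Var
  A := Enum331.Arr
  lenX := .nx
  lenY := .ny
  arrX := .inX
  arrY := .inY
  lenX_ne_lenY := by decide
  arrX_ne_arrY := by decide
  preprocessing := Enum331.preprocessing
  enumeration := Enum331.enumeration

namespace Enum331

/-- The number of the index `(i_b, j_b, d_a)` of the vertex `(a, b)` for strings of lengths
`lx` and `ly`. -/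
def key (lx ly : ℕ) (w : Vertex) : ℕ :=
  (w.2.1 * (ly + 1) + w.2.2) * (lx + ly) + (w.1.2 + lx - w.1.1)

/-- The number of indices of the array of sequences. -/
def numKeys (lx ly : ℕ) : ℕ := (lx + 1) * (ly + 1) * (lx + ly)

/-- The sequence with index `k` in the array `G''`. -/
def storedSeq (s : State Var Arr) (k : ℕ) : List ℕ :=
  (List.range' (s.mem .G2 k) (s.mem .G2 (k + 1) - s.mem .G2 k)).map (s.mem .seqG2)

/-- In state `s`, the array `G''` is an implementation of the all-MCS graph of the strings `X` and
`Y`: for all `1 ≤ i ≤ |X|`, `1 ≤ j ≤ |Y|` and `1 - |X| ≤ d ≤ |Y| - 1`, the sequence with index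
`(i, j, d)` lists, without repetition, the heads of all edges from the vertex `(v', u)` with
`u = (i, j)` and `d_{v'} = d`, and it is empty if there is no such vertex. -/
def StoresAllMCSGraph (X Y : List ℕ) (s : State Var Arr) : Prop :=
  ∀ i j : ℕ, ∀ d : ℤ, 1 ≤ i → i ≤ X.length → 1 ≤ j → j ≤ Y.length →
    1 - (X.length : ℤ) ≤ d → d ≤ (Y.length : ℤ) - 1 →
    ∃ S : List Vertex, S.Nodup ∧
      (∀ q : Vertex, q ∈ S ↔ ∃ v' : ℕ × ℕ, (v'.2 : ℤ) - v'.1 = d ∧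
        AllMCSEdge X Y (v', (i, j)) q) ∧
      storedSeq s ((i * (Y.length + 1) + j) * (X.length + Y.length) + (d + X.length).toNat) =
        S.map (key X.length Y.length)

/-- The size of the array `G''` in state `s`: the number of cells for the offsets and the number of
cells for the elements of the sequences. -/
def arraySize (X Y : List ℕ) (s : State Var Arr) : ℕ :=
  numKeys X.length Y.length + 1 + s.mem .G2 (numKeys X.length Y.length)

end Enum331

end MCS

/-! Let A and B be the normalized strings. For a split Z = P ++ Q let u be the pair of ends of the
leftmost embeddings of P into A and B, and v the pair of starts of the rightmost embeddings of Q. A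
character can be inserted at this split exactly if it labels a match strictly between u and v
(`insert_sublist_iff`). Hence a common subsequence is maximal iff no split leaves a match in its gap
(`isMCS_iff_no_match`). If both parts of the split are nonempty, then u and v are matches and the
condition says u ≺ v. So an MCS yields a walk in G whose k-th vertex pairs the start of the
rightmost embedding of the suffix from the k-th character on with the end of the leftmost embedding
of the prefix up to that character (`embedPath`, `isChain_embedPath_iff`). Conversely, the prev and
next entries of the edges force every walk to the sink to be of this form for its own string
(`eq_embedPath_of_chain`). The sentinels rule out insertions at the splits with an empty part and
tie the walk to the source and the sink. Source-to-sink paths and MCSs are therefore in bijection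
(`exists_eq_normalize_of_path`, `exists_path_of_isMCS`, `pathString_injOn`).

Cubic preprocessing: for fixed u, the v with u ≺ v lie on a staircase that is scanned in O(|A| +
|B|) steps, each of which goes left or up (`findEdges_spec`); so G has O(n³) edges. A vertex (a, b)
satisfies b ≤ a with equality in at least one coordinate (`isNode_of_edgeG`), so b and the diagonal
of a determine it (`key_injOn`). This numbers the vertices by O(n³) keys, and counting sort
(`buildSeqs_spec`) and breadth-first search (`bfs_spec`) are linear in the numbers of keys and
edges.

Linear delay: along an edge the second match of the vertex increases strictly (`EdgeG.below`), so
paths have O(n) vertices. Every vertex that is met lies on a source-to-sink walk, so depth-first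
traversal has no dead ends (`exists_succs_of_onPath`). Between two outputs the path is shortened,
extended and output once, each in linear time. Correctness rests on the list `remainingPaths` of the
paths still to come: every step of the program is an identity for this list.

The statements about programs are total-correctness triples with an explicit clock. Since executions
are unique whatever the memory limits (`Exec.deterministic`), the one run that is constructed speaks
for all runs. -/

namespace MCS

/-! ### A weakest-precondition calculus for the machine. -/

section Framework

variable {V A : Type}

@[simp] theorem Expr.add_def (e f : Expr V A) : e + f = Expr.add e f := rfl
@[simp] theorem Expr.sub_def (e f : Expr V A) : e - f = Expr.sub e f := rfl
@[simp] theorem Expr.mul_def (e f : Expr V A) : e * f = Expr.mul e f := rfl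
@[simp] theorem Expr.ofNat_def (k : ℕ) : (OfNat.ofNat k : Expr V A) = Expr.const (OfNat.ofNat k) := rfl

attribute [simp] Expr.eval Expr.cost Expr.InBounds Test.Holds Test.cost Test.InBounds

namespace State

variable (s : State V A)

@[simp] theorem tick_reg (k : ℕ) : (s.tick k).reg = s.reg := rfl
@[simp] theorem tick_mem (k : ℕ) : (s.tick k).mem = s.mem := rfl
@[simp] theorem tick_buf (k : ℕ) : (s.tick k).buf = s.buf := rfl
@[simp] theorem tick_out (k : ℕ) : (s.tick k).out = s.out := rfl
@[simp] theorem tick_clock (k : ℕ) : (s.tick k).clock = s.clock + k := rfl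

@[simp] theorem setReg_reg [DecidableEq V] (x : V) (v : ℕ) (y : V) :
    (s.setReg x v).reg y = if y = x then v else s.reg y := by
  simp [setReg, Function.update_apply]
@[simp] theorem setReg_mem [DecidableEq V] (x : V) (v : ℕ) : (s.setReg x v).mem = s.mem := rfl
@[simp] theorem setReg_buf [DecidableEq V] (x : V) (v : ℕ) : (s.setReg x v).buf = s.buf := rfl
@[simp] theorem setReg_out [DecidableEq V] (x : V) (v : ℕ) : (s.setReg x v).out = s.out := rfl
@[simp] theorem setReg_clock [DecidableEq V] (x : V) (v : ℕ) :
    (s.setReg x v).clock = s.clock := rfl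

@[simp] theorem setMem_mem [DecidableEq A] (a : A) (i v : ℕ) (b : A) (j : ℕ) :
    (s.setMem a i v).mem b j = if b = a then (if j = i then v else s.mem a j) else s.mem b j := by
  by_cases h : b = a
  · subst h; simp [setMem, Function.update_apply]
  · simp [setMem, h]
@[simp] theorem setMem_reg [DecidableEq A] (a : A) (i v : ℕ) : (s.setMem a i v).reg = s.reg := rfl
@[simp] theorem setMem_buf [DecidableEq A] (a : A) (i v : ℕ) : (s.setMem a i v).buf = s.buf := rfl
@[simp] theorem setMem_out [DecidableEq A] (a : A) (i v : ℕ) : (s.setMem a i v).out = s.out := rfl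
@[simp] theorem setMem_clock [DecidableEq A] (a : A) (i v : ℕ) :
    (s.setMem a i v).clock = s.clock := rfl

end State

/-- The registers that a command may write. -/
def Cmd.regs : Cmd V A → List V
  | .skip => []
  | .assign x _ => [x]
  | .store _ _ _ => []
  | .seq c d => c.regs ++ d.regs
  | .ite _ c d => c.regs ++ d.regs
  | .loop _ c => c.regs
  | .emit _ => []
  | .finish => []

/-- The arrays that a command may write. -/
def Cmd.arrs : Cmd V A → List A
  | .skip => []
  | .assign _ _ => []
  | .store a _ _ => [a]
  | .seq c d => c.arrs ++ d.arrs
  | .ite _ c d => c.arrs ++ d.arrs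
  | .loop _ c => c.arrs
  | .emit _ => []
  | .finish => []

/-- The command produces no output. -/
def Cmd.Silent : Cmd V A → Prop
  | .skip => True
  | .assign _ _ => True
  | .store _ _ _ => True
  | .seq c d => c.Silent ∧ d.Silent
  | .ite _ c d => c.Silent ∧ d.Silent
  | .loop _ c => c.Silent
  | .emit _ => False
  | .finish => False

attribute [simp] Cmd.regs Cmd.arrs Cmd.Silent

@[simp] theorem regs_forRange (x : V) (a b : Expr V A) (c : Cmd V A) :
    (forRange x a b c).regs = x :: (c.regs ++ [x]) := rfl
@[simp] theorem arrs_forRange (x : V) (a b : Expr V A) (c : Cmd V A) :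
    (forRange x a b c).arrs = c.arrs := by simp [forRange]
@[simp] theorem silent_forRange (x : V) (a b : Expr V A) (c : Cmd V A) :
    (forRange x a b c).Silent ↔ c.Silent := by simp [forRange]
@[simp] theorem regs_ifThen (t : Test V A) (c : Cmd V A) : (ifThen t c).regs = c.regs := by
  simp [ifThen]
@[simp] theorem arrs_ifThen (t : Test V A) (c : Cmd V A) : (ifThen t c).arrs = c.arrs := by
  simp [ifThen]
@[simp] theorem silent_ifThen (t : Test V A) (c : Cmd V A) : (ifThen t c).Silent ↔ c.Silent := by
  simp [ifThen]

/-- What a command cannot change when it takes the state `s` to `s'`. -/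
structure Frame (c : Cmd V A) (s s' : State V A) : Prop where
  reg : ∀ x, x ∉ c.regs → s'.reg x = s.reg x
  mem : ∀ a, a ∉ c.arrs → s'.mem a = s.mem a
  out : c.Silent → s'.out = s.out ∧ s'.buf = s.buf

variable [DecidableEq V] [DecidableEq A] {M W : ℕ}

theorem Exec.frame {c : Cmd V A} {s s' : State V A} (h : Exec M W c s s') : Frame c s s' := by
  induction h with
  | skip s => exact ⟨fun _ _ => rfl, fun _ _ => rfl, fun _ => ⟨rfl, rfl⟩⟩
  | assign s x e he hW =>
    refine ⟨fun y hy => ?_, fun _ _ => rfl, fun _ => ⟨rfl, rfl⟩⟩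
    simp at hy
    simp [hy]
  | store s a i e hi he hM hW =>
    refine ⟨fun _ _ => rfl, fun b hb => ?_, fun _ => ⟨rfl, rfl⟩⟩
    simp at hb
    ext j
    simp [hb]
  | seq s s' s'' c d _ _ h1 h2 =>
    refine ⟨fun x hx => ?_, fun a ha => ?_, fun hs => ?_⟩
    · simp at hx; rw [h2.reg x hx.2, h1.reg x hx.1]
    · simp at ha; rw [h2.mem a ha.2, h1.mem a ha.1]
    · exact ⟨(h2.out hs.2).1.trans (h1.out hs.1).1, (h2.out hs.2).2.trans (h1.out hs.1).2⟩
  | ite_pos s s' t c d _ _ _ h =>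
    refine ⟨fun x hx => ?_, fun a ha => ?_, fun hs => h.out hs.1⟩
    · simp at hx; exact h.reg x hx.1
    · simp at ha; exact h.mem a ha.1
  | ite_neg s s' t c d _ _ _ h =>
    refine ⟨fun x hx => ?_, fun a ha => ?_, fun hs => h.out hs.2⟩
    · simp at hx; exact h.reg x hx.2
    · simp at ha; exact h.mem a ha.2
  | loop_pos s s' s'' t c _ _ _ _ h1 h2 =>
    refine ⟨fun x hx => ?_, fun a ha => ?_, fun hs => ?_⟩
    · rw [h2.reg x hx, h1.reg x hx]; rfl
    · rw [h2.mem a ha, h1.mem a ha]; rfl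
    · exact ⟨(h2.out hs).1.trans (h1.out hs).1, (h2.out hs).2.trans (h1.out hs).2⟩
  | loop_neg => exact ⟨fun _ _ => rfl, fun _ _ => rfl, fun _ => ⟨rfl, rfl⟩⟩
  | emit => exact ⟨fun _ _ => rfl, fun _ _ => rfl, fun h => h.elim⟩
  | finish => exact ⟨fun _ _ => rfl, fun _ _ => rfl, fun h => h.elim⟩

/-- Execution is deterministic, whatever the memory limits. -/
theorem Exec.deterministic {M' W' : ℕ} {c : Cmd V A} {s s₁ s₂ : State V A}
    (h₁ : Exec M W c s s₁) (h₂ : Exec M' W' c s s₂) : s₁ = s₂ := by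
  induction h₁ generalizing s₂ with
  | skip s => cases h₂; rfl
  | assign s x e he hW => cases h₂; rfl
  | store s a i e hi he hM hW => cases h₂; rfl
  | seq s s' s'' c d _ _ h1 h2 =>
    cases h₂ with
    | seq _ t _ _ _ k1 k2 => obtain rfl := h1 k1; exact h2 k2
  | ite_pos s s' t c d _ ht _ h =>
    cases h₂ with
    | ite_pos _ _ _ _ _ _ _ k => exact h k
    | ite_neg _ _ _ _ _ _ hn => exact absurd ht hn
  | ite_neg s s' t c d _ ht _ h =>
    cases h₂ with
    | ite_pos _ _ _ _ _ _ hn => exact absurd hn ht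
    | ite_neg _ _ _ _ _ _ _ k => exact h k
  | loop_pos s s' s'' t c _ ht _ _ h1 h2 =>
    cases h₂ with
    | loop_pos _ _ _ _ _ _ _ k1 k2 => obtain rfl := h1 k1; exact h2 k2
    | loop_neg _ _ _ _ hn => exact absurd ht hn
  | loop_neg s t c _ ht =>
    cases h₂ with
    | loop_pos _ _ _ _ _ _ hn => exact absurd hn ht
    | loop_neg => rfl
  | emit => cases h₂; rfl
  | finish => cases h₂; rfl

/-- Weakest precondition (total correctness). -/
def WP (M W : ℕ) (c : Cmd V A) (Q : State V A → Prop) (s : State V A) : Prop :=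
  ∃ s', Exec M W c s s' ∧ Q s'

namespace WP

variable {c d : Cmd V A} {Q R : State V A → Prop} {s : State V A}

theorem mono (h : WP M W c Q s) (hQ : ∀ s', Q s' → R s') : WP M W c R s :=
  let ⟨s', h1, h2⟩ := h; ⟨s', h1, hQ s' h2⟩

/-- Strengthens a postcondition by the frame condition. -/
theorem mono_frame (h : WP M W c Q s) (hQ : ∀ s', Frame c s s' → Q s' → R s') : WP M W c R s :=
  let ⟨s', h1, h2⟩ := h; ⟨s', h1, hQ s' h1.frame h2⟩

/-- In contrast to `seq_iff`, the continuation learns what the first command left untouched, so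
postconditions need not repeat it. -/
theorem seq_mono (h : WP M W c Q s) (hQ : ∀ s', Frame c s s' → Q s' → WP M W d R s') :
    WP M W (.seq c d) R s :=
  let ⟨_, h1, h2⟩ := h
  let ⟨s'', h3, h4⟩ := hQ _ h1.frame h2
  ⟨s'', .seq _ _ _ _ _ h1 h3, h4⟩

@[simp] theorem seq_iff : WP M W (.seq c d) Q s ↔ WP M W c (WP M W d Q) s := by
  constructor
  · rintro ⟨s', h, hQ⟩
    cases h with
    | seq _ t _ _ _ h1 h2 => exact ⟨t, h1, s', h2, hQ⟩
  · rintro ⟨t, h1, s', h2, hQ⟩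
    exact ⟨s', .seq _ _ _ _ _ h1 h2, hQ⟩

@[simp] theorem skip_iff : WP M W .skip Q s ↔ Q (s.tick 1) := by
  constructor
  · rintro ⟨s', h, hQ⟩; cases h; exact hQ
  · exact fun h => ⟨_, .skip s, h⟩

@[simp] theorem assign_iff {x : V} {e : Expr V A} :
    WP M W (.assign x e) Q s ↔
      e.InBounds M s ∧ e.eval s ≤ W ∧ Q ((s.setReg x (e.eval s)).tick (e.cost + 1)) := by
  constructor
  · rintro ⟨s', h, hQ⟩; cases h with | assign _ _ _ h1 h2 => exact ⟨h1, h2, hQ⟩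
  · exact fun ⟨h1, h2, h3⟩ => ⟨_, .assign s x e h1 h2, h3⟩

@[simp] theorem store_iff {a : A} {i e : Expr V A} :
    WP M W (.store a i e) Q s ↔
      i.InBounds M s ∧ e.InBounds M s ∧ i.eval s < M ∧ e.eval s ≤ W ∧
        Q ((s.setMem a (i.eval s) (e.eval s)).tick (i.cost + e.cost + 1)) := by
  constructor
  · rintro ⟨s', h, hQ⟩
    cases h with | store _ _ _ _ h1 h2 h3 h4 => exact ⟨h1, h2, h3, h4, hQ⟩
  · exact fun ⟨h1, h2, h3, h4, h5⟩ => ⟨_, .store s a i e h1 h2 h3 h4, h5⟩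

@[simp] theorem ite_iff {t : Test V A} :
    WP M W (.ite t c d) Q s ↔ t.InBounds M s ∧
      (t.Holds s → WP M W c Q (s.tick (t.cost + 1))) ∧
      (¬ t.Holds s → WP M W d Q (s.tick (t.cost + 1))) := by
  constructor
  · rintro ⟨s', h, hQ⟩
    cases h with
    | ite_pos _ _ _ _ _ h1 h2 h3 => exact ⟨h1, fun _ => ⟨s', h3, hQ⟩, fun h => absurd h2 h⟩
    | ite_neg _ _ _ _ _ h1 h2 h3 => exact ⟨h1, fun h => absurd h h2, fun _ => ⟨s', h3, hQ⟩⟩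
  · rintro ⟨h1, h2, h3⟩
    by_cases h : t.Holds s
    · obtain ⟨s', h4, h5⟩ := h2 h; exact ⟨s', .ite_pos _ _ _ _ _ h1 h h4, h5⟩
    · obtain ⟨s', h4, h5⟩ := h3 h; exact ⟨s', .ite_neg _ _ _ _ _ h1 h h4, h5⟩

@[simp] theorem ifThen_iff {t : Test V A} :
    WP M W (ifThen t c) Q s ↔ t.InBounds M s ∧
      (t.Holds s → WP M W c Q (s.tick (t.cost + 1))) ∧
      (¬ t.Holds s → Q (s.tick (t.cost + 2))) := by
  rw [ifThen, ite_iff, skip_iff]; rfl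

@[simp] theorem emit_iff {e : Expr V A} :
    WP M W (.emit e) Q s ↔ e.InBounds M s ∧ e.eval s ≤ W ∧
      Q ({ s with buf := s.buf ++ [e.eval s] }.tick (e.cost + 1)) := by
  constructor
  · rintro ⟨s', h, hQ⟩; cases h with | emit _ _ h1 h2 => exact ⟨h1, h2, hQ⟩
  · exact fun ⟨h1, h2, h3⟩ => ⟨_, .emit s e h1 h2, h3⟩

@[simp] theorem finish_iff :
    WP M W .finish Q s ↔
      Q ({ s with buf := [], out := s.out ++ [(s.buf, s.clock + 1)] }.tick 1) := by
  constructor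
  · rintro ⟨s', h, hQ⟩; cases h; exact hQ
  · exact fun h => ⟨_, .finish s, h⟩

/-- The rule for loops, with an invariant `I` and a variant `μ`. -/
theorem loop {t : Test V A} (I : State V A → Prop) (μ : State V A → ℕ) (h0 : I s)
    (hb : ∀ s', I s' → t.InBounds M s')
    (hstep : ∀ s', I s' → t.Holds s' →
      WP M W c (fun s'' => I s'' ∧ μ s'' < μ s') (s'.tick (t.cost + 1)))
    (hend : ∀ s', I s' → ¬ t.Holds s' → Q (s'.tick (t.cost + 1))) :
    WP M W (.loop t c) Q s := by
  induction hn : μ s using Nat.strong_induction_on generalizing s with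
  | _ n ih =>
    by_cases h : t.Holds s
    · obtain ⟨s', h1, h2, h3⟩ := hstep s h0 h
      obtain ⟨s'', h4, h5⟩ := ih (μ s') (hn ▸ h3) h2 rfl
      exact ⟨s'', .loop_pos _ _ _ _ _ (hb s h0) h h1 h4, h5⟩
    · exact ⟨_, .loop_neg _ _ _ (hb s h0) h, hend s h0 h⟩

/-- The rule for counting loops; the invariant may depend on the clock. -/
theorem forRange {x : V} {a b : Expr V A} (m n : ℕ) (I : ℕ → State V A → Prop)
    (ha : a.InBounds M s) (ham : a.eval s = m) (hmn : m ≤ n) (hW : n ≤ W)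
    (h0 : I m ((s.setReg x m).tick (a.cost + 1)))
    (hb : ∀ i s', Frame (MCS.forRange x a b c) s s' → s'.reg x = i → m ≤ i → i ≤ n → I i s' →
      b.InBounds M s' ∧ b.eval s' = n)
    (hstep : ∀ i s', Frame (MCS.forRange x a b c) s s' → s'.reg x = i → m ≤ i → i < n → I i s' →
      WP M W c (fun s'' => s''.reg x = i ∧ I (i + 1) ((s''.setReg x (i + 1)).tick 4))
        (s'.tick (b.cost + 3)))
    (hend : ∀ s', Frame (MCS.forRange x a b c) s s' → s'.reg x = n → I n s' →
      Q (s'.tick (b.cost + 3))) :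
    WP M W (MCS.forRange x a b c) Q s := by
  have hcost : (Test.lt (Expr.reg x) b).cost + 1 = b.cost + 3 := by simp; omega
  unfold MCS.forRange
  rw [seq_iff, assign_iff]
  refine ⟨ha, by omega, ?_⟩
  rw [ham]
  have hF0 : Frame (MCS.forRange x a b c) s ((s.setReg x m).tick (a.cost + 1)) :=
    ⟨fun y hy => by simp at hy; simp [hy], fun _ _ => rfl, fun _ => ⟨rfl, rfl⟩⟩
  refine loop (fun s' => ∃ i, Frame (MCS.forRange x a b c) s s' ∧ s'.reg x = i ∧ m ≤ i ∧ i ≤ n ∧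
    I i s') (fun s' => n - s'.reg x) ⟨m, hF0, by simp, le_rfl, hmn, h0⟩ ?_ ?_ ?_
  · rintro s' ⟨i, hF, hx, h1, h2, hI⟩
    simpa using (hb i s' hF hx h1 h2 hI).1
  · rintro s' ⟨i, hF, hx, h1, h2, hI⟩ ht
    have hlt : i < n := by
      have := (hb i s' hF hx h1 h2 hI).2
      simp only [Test.Holds, Expr.eval] at ht
      omega
    rw [seq_iff, hcost]
    refine (hstep i s' hF hx h1 hlt hI).mono_frame ?_
    rintro s'' hF' ⟨hx', hI'⟩
    rw [assign_iff]
    refine ⟨by simp, by simp [hx']; omega, ⟨i + 1, ?_, ?_, by omega, by omega, ?_⟩, ?_⟩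
    · refine ⟨fun y hy => ?_, fun z hz => ?_, fun hs => ?_⟩
      · have := hF.reg y hy
        simp at hy
        have h3 := hF'.reg y hy.2.1
        simp [hy.1, h3, this]
      · have := hF.mem z hz
        simp at hz
        have h3 := hF'.mem z hz
        simp [h3, this]
      · have := hF.out hs
        simp at hs
        have h3 := hF'.out hs
        simpa [h3] using this
    · simp [hx']
    · simpa [hx'] using hI'
    · simp [hx', hx]; omega
  · rintro s' ⟨i, hF, hx, h1, h2, hI⟩ ht
    have hin : i = n := by
      have := (hb i s' hF hx h1 h2 hI).2
      simp only [Test.Holds, Expr.eval] at ht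
      omega
    subst hin
    rw [hcost]
    exact hend s' hF hx hI

/-- The rule for counting loops whose body takes time at most `T`; the invariant does not depend on
the clock. -/
theorem forRange_uniform {x : V} {a b : Expr V A} (m n T : ℕ)
    (I : ℕ → (V → ℕ) → (A → ℕ → ℕ) → Prop)
    (ha : a.InBounds M s) (ham : a.eval s = m) (hmn : m ≤ n) (hW : n ≤ W)
    (h0 : I m (s.setReg x m).reg s.mem)
    (hb : ∀ i s', Frame (MCS.forRange x a b c) s s' → s'.reg x = i → m ≤ i → i ≤ n →
      I i s'.reg s'.mem → b.InBounds M s' ∧ b.eval s' = n)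
    (hstep : ∀ i s', Frame (MCS.forRange x a b c) s s' → s'.reg x = i → m ≤ i → i < n →
      I i s'.reg s'.mem →
      WP M W c (fun s'' => s''.reg x = i ∧ s''.clock ≤ s'.clock + T ∧
        I (i + 1) (s''.setReg x (i + 1)).reg s''.mem) s')
    (hend : ∀ s', Frame (MCS.forRange x a b c) s s' → s'.reg x = n →
      s'.clock ≤ s.clock + (n - m) * (T + b.cost + 7) + a.cost + b.cost + 4 → I n s'.reg s'.mem →
      Q s') :
    WP M W (MCS.forRange x a b c) Q s := by
  -- One iteration costs `T` for the body, `b.cost + 3` for the test and 4 for the increment;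
  -- `a.cost + 1` pays for the initial assignment.
  refine forRange m n (fun i s' => s'.clock ≤ s.clock + (i - m) * (T + b.cost + 7) + a.cost + 1 ∧
    I i s'.reg s'.mem) ha ham hmn hW ⟨by simp; omega, h0⟩ (fun i s' hF hx h1 h2 hI =>
      hb i s' hF hx h1 h2 hI.2) ?_ ?_
  · intro i s' hF hx h1 h2 ⟨hc, hI⟩
    refine (hstep i (s'.tick (b.cost + 3)) ⟨hF.reg, hF.mem, hF.out⟩ hx h1 h2 hI).mono ?_
    rintro s'' ⟨h3, h4, h5⟩
    refine ⟨h3, ?_, h5⟩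
    have : i + 1 - m = (i - m) + 1 := by omega
    simp only [State.tick_clock, State.setReg_clock] at h4 ⊢
    rw [this, add_mul]
    omega
  · intro s' hF hx ⟨hc, hI⟩
    refine hend (s'.tick (b.cost + 3)) ⟨hF.reg, hF.mem, hF.out⟩ hx ?_ hI
    simp only [State.tick_clock]
    omega

end WP

end Framework

end MCS

namespace MCS

/-! ### Next and previous occurrences of a character. -/

section Occurrences

variable {W : List ℕ} {c h : ℕ}

/-- This recursion, like its counterpart `prevIdx_succ`, drives both the inductions on occurrences
and the filling of the tables. -/
theorem nextIdx_of_lt (hh : h < W.length) :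
    nextIdx W c h = if charAt W (h + 1) = c then h + 1 else nextIdx W c (h + 1) := by
  have : W.length - h = (W.length - (h + 1)) + 1 := by omega
  unfold nextIdx
  rw [this, List.range'_succ, List.find?_cons]
  by_cases hc : charAt W (h + 1) = c
  · simp [hc]
  · rw [beq_false_of_ne hc, if_neg hc]

theorem nextIdx_of_le (hh : W.length ≤ h) : nextIdx W c h = W.length + 1 := by
  simp [nextIdx, Nat.sub_eq_zero_of_le hh]

theorem prevIdx_succ (hh : 1 ≤ h) :
    prevIdx W c (h + 1) = if charAt W h = c then h else prevIdx W c h := by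
  have : h + 1 - 1 = (h - 1) + 1 := by omega
  unfold prevIdx
  rw [this, List.range'_concat]
  have h1 : 1 + 1 * (h - 1) = h := by omega
  rw [h1, List.reverse_append, List.reverse_singleton, List.singleton_append, List.find?_cons]
  by_cases hc : charAt W h = c
  · simp [hc]
  · rw [beq_false_of_ne hc, if_neg hc]

theorem prevIdx_of_le_one (hh : h ≤ 1) : prevIdx W c h = 0 := by
  simp [prevIdx, Nat.sub_eq_zero_of_le hh]

/-- The bound on `k` keeps out the default value `W.length + 1`, which is not an occurrence. -/
theorem nextIdx_le_iff {k : ℕ} (hk : k ≤ W.length) :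
    nextIdx W c h ≤ k ↔ ∃ i, h < i ∧ i ≤ k ∧ charAt W i = c := by
  induction hn : W.length - h generalizing h with
  | zero =>
    rw [nextIdx_of_le (by omega)]
    exact ⟨fun h => by omega, fun ⟨i, h1, h2, _⟩ => by omega⟩
  | succ n ih =>
    rw [nextIdx_of_lt (by omega)]
    split_ifs with hc
    · exact ⟨fun hk => ⟨h + 1, by omega, hk, hc⟩, fun ⟨i, h1, h2, _⟩ => by omega⟩
    · rw [ih (by omega)]
      constructor
      · rintro ⟨i, h1, h2, h3⟩; exact ⟨i, by omega, h2, h3⟩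
      · rintro ⟨i, h1, h2, h3⟩
        refine ⟨i, ?_, h2, h3⟩
        rcases Nat.lt_or_ge (h + 1) i with h4 | h4
        · exact h4
        · obtain rfl : i = h + 1 := by omega
          exact absurd h3 hc

/-- No bound on `a` is needed here: the default value 0 exceeds nothing. -/
theorem lt_prevIdx_iff {a : ℕ} : a < prevIdx W c h ↔ ∃ i, a < i ∧ i < h ∧ charAt W i = c := by
  induction h with
  | zero => rw [prevIdx_of_le_one (by omega)]; simp
  | succ h ih =>
    rcases Nat.eq_zero_or_pos h with rfl | hh
    · rw [prevIdx_of_le_one (by omega)]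
      exact ⟨fun h => by omega, fun ⟨i, h1, h2, _⟩ => by omega⟩
    · rw [prevIdx_succ hh]
      split_ifs with hc
      · exact ⟨fun ha => ⟨h, ha, by omega, hc⟩, fun ⟨i, h1, h2, _⟩ => by omega⟩
      · rw [ih]
        constructor
        · rintro ⟨i, h1, h2, h3⟩; exact ⟨i, h1, by omega, h3⟩
        · rintro ⟨i, h1, h2, h3⟩
          refine ⟨i, h1, ?_, h3⟩
          rcases Nat.lt_or_ge i h with h4 | h4
          · exact h4
          · obtain rfl : i = h := by omega
            exact absurd h3 hc

theorem nextIdx_le_of_occ {i : ℕ} (h1 : h < i) (h2 : i ≤ W.length) (h3 : charAt W i = c) :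
    nextIdx W c h ≤ i := (nextIdx_le_iff h2).2 ⟨i, h1, le_rfl, h3⟩

theorem le_prevIdx_of_occ {i : ℕ} (h0 : 1 ≤ i) (h1 : i < h) (h3 : charAt W i = c) :
    i ≤ prevIdx W c h := by
  have : i - 1 < prevIdx W c h := lt_prevIdx_iff.2 ⟨i, by omega, h1, h3⟩
  omega

theorem lt_nextIdx (hh : h ≤ W.length) : h < nextIdx W c h := by
  by_contra hc
  obtain ⟨i, h1, h2, _⟩ := (nextIdx_le_iff hh).1 (not_lt.1 hc)
  omega

theorem nextIdx_le_succ_length : nextIdx W c h ≤ W.length + 1 := by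
  by_contra hc
  rcases Nat.lt_or_ge h W.length with hh | hh
  · unfold nextIdx at hc
    cases hf : (List.range' (h + 1) (W.length - h)).find? (fun h' => charAt W h' == c) with
    | none => simp [hf] at hc
    | some i =>
      have := List.mem_of_find?_eq_some hf
      rw [hf] at hc
      simp at this hc
      omega
  · rw [nextIdx_of_le hh] at hc; omega

theorem charAt_nextIdx (hn : nextIdx W c h ≤ W.length) : charAt W (nextIdx W c h) = c := by
  obtain ⟨i, h1, h2, h3⟩ := (nextIdx_le_iff hn).1 le_rfl
  rwa [le_antisymm (nextIdx_le_of_occ h1 (h2.trans hn) h3) h2]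

theorem prevIdx_lt (hh : 1 ≤ h) : prevIdx W c h < h := by
  by_contra hc
  rw [not_lt] at hc
  have : h - 1 < prevIdx W c h := by omega
  obtain ⟨i, h1, h2, _⟩ := lt_prevIdx_iff.1 this
  omega

theorem prevIdx_le : prevIdx W c h ≤ h := by
  rcases Nat.eq_zero_or_pos h with rfl | hh
  · rw [prevIdx_of_le_one (by omega)]
  · exact (prevIdx_lt hh).le

theorem charAt_prevIdx (hn : 0 < prevIdx W c h) : charAt W (prevIdx W c h) = c := by
  have h0 : prevIdx W c h - 1 < prevIdx W c h := by omega
  obtain ⟨i, h1, h2, h3⟩ := lt_prevIdx_iff.1 h0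
  rwa [le_antisymm (by omega) (le_prevIdx_of_occ (by omega) h2 h3)]

/-- Both sides say that `c` occurs strictly between `h` and `r`. This adjunction is what allows a
character to be moved between a prefix embedded leftmost and a suffix embedded rightmost. -/
theorem nextIdx_lt_iff_lt_prevIdx {r : ℕ} (hr : r ≤ W.length + 1) :
    nextIdx W c h < r ↔ h < prevIdx W c r := by
  rw [lt_prevIdx_iff]
  rcases Nat.eq_zero_or_pos r with rfl | h0
  · simp
  · have : nextIdx W c h < r ↔ nextIdx W c h ≤ r - 1 := by omega
    rw [this, nextIdx_le_iff (by omega)]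
    exact exists_congr fun i => by constructor <;> rintro ⟨h1, h2, h3⟩ <;> exact ⟨h1, by omega, h3⟩

theorem charAt_eq_getElem {i : ℕ} (h1 : 1 ≤ i) (h2 : i ≤ W.length) :
    charAt W i = W[i - 1]'(by omega) := by
  rw [charAt, List.getD_eq_getElem _ _ (show i - 1 < W.length by omega)]

end Occurrences

/-! ### Leftmost and rightmost embeddings of subsequences. -/

section Embeddings

/-- The end of the leftmost embedding of `Z` after position `i`. -/
def lend (W : List ℕ) (i : ℕ) (Z : List ℕ) : ℕ := Z.foldl (fun i c => nextIdx W c i) i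

/-- The start of the rightmost embedding of `Z`. -/
def rstart (W Z : List ℕ) : ℕ := Z.foldr (fun c i => prevIdx W c i) (W.length + 1)

@[simp] theorem lend_nil (W : List ℕ) (i : ℕ) : lend W i [] = i := rfl
@[simp] theorem lend_cons (W : List ℕ) (i c : ℕ) (Z : List ℕ) :
    lend W i (c :: Z) = lend W (nextIdx W c i) Z := rfl
@[simp] theorem lend_append (W : List ℕ) (i : ℕ) (P Q : List ℕ) :
    lend W i (P ++ Q) = lend W (lend W i P) Q := by simp [lend]
@[simp] theorem rstart_nil (W : List ℕ) : rstart W [] = W.length + 1 := rfl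
@[simp] theorem rstart_cons (W : List ℕ) (c : ℕ) (Z : List ℕ) :
    rstart W (c :: Z) = prevIdx W c (rstart W Z) := rfl

variable {W : List ℕ}

theorem rstart_le (Z : List ℕ) : rstart W Z ≤ W.length + 1 := by
  induction Z with
  | nil => simp
  | cons c Z ih => exact prevIdx_le.trans ih

/-- The adjunction hands the characters of `P` over to the suffix one at a time. -/
theorem lend_lt_rstart_iff {i : ℕ} (P Q : List ℕ) :
    lend W i P < rstart W Q ↔ i < rstart W (P ++ Q) := by
  induction P generalizing i with
  | nil => simp
  | cons c P ih =>
    rw [lend_cons, ih, nextIdx_lt_iff_lt_prevIdx (rstart_le _)]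
    rfl

/-- Embedding greedily from the right is optimal: the rest `Q` may as well start as late as
possible, so only an occurrence of `c` between `k` and `rstart W Q` is needed. The value 0 of
`rstart` encodes that there is no embedding at all. -/
theorem sublist_drop_iff {k : ℕ} (hk : k ≤ W.length) (Q : List ℕ) :
    Q.Sublist (W.drop k) ↔ k < rstart W Q := by
  induction Q generalizing k with
  | nil => simp; omega
  | cons c Q ih =>
    rw [rstart_cons, lt_prevIdx_iff, List.cons_sublist_iff]
    constructor
    · rintro ⟨r₁, r₂, h1, h2, h3⟩
      obtain ⟨a, b, rfl⟩ := List.append_of_mem h2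
      have hlen : W.length = k + (a.length + 1 + b.length + r₂.length) := by
        have := congrArg List.length h1
        simp at this; omega
      have hdrop : W.drop (k + a.length + 1) = b ++ r₂ := by
        rw [add_assoc, ← List.drop_drop, h1]
        simp
      refine ⟨k + a.length + 1, by omega, ?_, ?_⟩
      · exact (ih (by omega)).1 (hdrop ▸ h3.trans (List.sublist_append_right _ _))
      · rw [charAt_eq_getElem (by omega) (by omega)]
        have h5 : (W.drop k)[a.length]? = some c := by rw [h1]; simp
        rw [List.getElem?_drop] at h5
        exact (List.getElem?_eq_some_iff.1 h5).2
    · rintro ⟨i, h1, h2, h3⟩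
      have hi : i ≤ W.length := by have := rstart_le (W := W) Q; omega
      refine ⟨(W.drop k).take (i - k), W.drop i, ?_, ?_, (ih hi).2 h2⟩
      · conv_lhs => rw [← List.take_append_drop (i - k) (W.drop k)]
        rw [List.drop_drop, Nat.add_sub_cancel' h1.le]
      · rw [charAt_eq_getElem (by omega) hi] at h3
        rw [← h3, List.mem_iff_getElem]
        refine ⟨i - 1 - k, by simp; omega, ?_⟩
        simp only [List.getElem_take, List.getElem_drop]
        congr 1
        omega

theorem sublist_iff_lend_lt_rstart (P Q : List ℕ) :
    (P ++ Q).Sublist W ↔ lend W 0 P < rstart W Q := by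
  rw [lend_lt_rstart_iff, ← sublist_drop_iff (Nat.zero_le _), List.drop_zero]

theorem insert_sublist_iff (P Q : List ℕ) (c : ℕ) :
    (P ++ c :: Q).Sublist W ↔ ∃ i, lend W 0 P < i ∧ i < rstart W Q ∧ charAt W i = c := by
  rw [sublist_iff_lend_lt_rstart, rstart_cons, lt_prevIdx_iff]

end Embeddings

/-! ### Maximality as absence of matches, and paths in `G`. -/

section Paths

variable {A B : List ℕ}

/-- An inserted character takes one position in the gap in `A` and one in the gap in `B`; carrying
the same character, the two positions form a match. Conversely, a match in the gap supplies the
character to insert. -/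
theorem isMCS_iff_no_match (Z : List ℕ) :
    IsMCS A B Z ↔ (0 < rstart A Z ∧ 0 < rstart B Z) ∧
      ∀ P Q, Z = P ++ Q → ¬ ∃ w, IsMatch A B w ∧ Below (lend A 0 P, lend B 0 P) w ∧
        Below w (rstart A Q, rstart B Q) := by
  have h0 : IsCommonSubseq A B Z ↔ 0 < rstart A Z ∧ 0 < rstart B Z := by
    simp [IsCommonSubseq, ← sublist_drop_iff]
  rw [IsMCS, h0]
  refine and_congr_right fun _ => forall_congr' fun P => forall_congr' fun Q => ?_
  rw [forall_comm]
  refine forall_congr' fun _ => ?_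
  rw [← not_exists, not_iff_not]
  simp only [IsCommonSubseq, insert_sublist_iff]
  constructor
  · rintro ⟨c, ⟨i, h1, h2, h3⟩, j, h4, h5, h6⟩
    have := rstart_le (W := A) Q
    have := rstart_le (W := B) Q
    exact ⟨(i, j), ⟨by simp; omega, by simp; omega, by simp; omega, by simp; omega, h3.trans h6.symm⟩,
      ⟨h1, h4⟩, h2, h5⟩
  · rintro ⟨w, hw, hl, hr⟩
    exact ⟨charAt A w.1, ⟨w.1, hl.1, hr.1, rfl⟩, w.2, hl.2, hr.2, hw.2.2.2.2.symm⟩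

/-- The vertices given by the leftmost embedding after `u` and the rightmost embedding of `Z`. -/
def embedPath (A B : List ℕ) : ℕ × ℕ → List ℕ → List Vertex
  | _, [] => []
  | u, c :: Q => ((rstart A (c :: Q), rstart B (c :: Q)), nextMatch A B c u) ::
      embedPath A B (nextMatch A B c u) Q

theorem IsMatch.matchChar_snd {w : ℕ × ℕ} (h : IsMatch A B w) : charAt B w.2 = matchChar A w :=
  h.2.2.2.2.symm

/-- The pair `v` only serves to exclude the default value: what is strictly below a pair at most one
past the ends consists of genuine occurrences. -/
theorem isMatch_nextMatch {c : ℕ} {u v : ℕ × ℕ} (hv : Below (nextMatch A B c u) v)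
    (hA : v.1 ≤ A.length + 1) (hB : v.2 ≤ B.length + 1) (hu1 : u.1 ≤ A.length)
    (hu2 : u.2 ≤ B.length) :
    IsMatch A B (nextMatch A B c u) ∧ matchChar A (nextMatch A B c u) = c ∧
      Below u (nextMatch A B c u) := by
  have h1 : nextIdx A c u.1 ≤ A.length := by have := hv.1; simp only [nextMatch] at this; omega
  have h2 : nextIdx B c u.2 ≤ B.length := by have := hv.2; simp only [nextMatch] at this; omega
  have h3 := lt_nextIdx (c := c) hu1
  have h4 := lt_nextIdx (c := c) hu2
  refine ⟨⟨?_, h1, ?_, h2, ?_⟩, charAt_nextIdx h1, h3, h4⟩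
  · simp only [nextMatch]; omega
  · simp only [nextMatch]; omega
  · simp only [nextMatch]; rw [charAt_nextIdx h1, charAt_nextIdx h2]

theorem isMatch_prevMatch {c : ℕ} {v : ℕ × ℕ} (h1 : 0 < prevIdx A c v.1) (h2 : 0 < prevIdx B c v.2)
    (hA : v.1 ≤ A.length + 1) (hB : v.2 ≤ B.length + 1) :
    IsMatch A B (prevMatch A B c v) ∧ matchChar A (prevMatch A B c v) = c := by
  have h3 : 1 ≤ v.1 := by
    by_contra h; rw [prevIdx_of_le_one (by omega)] at h1; omega
  have h4 : 1 ≤ v.2 := by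
    by_contra h; rw [prevIdx_of_le_one (by omega)] at h2; omega
  have h5 := prevIdx_lt (W := A) (c := c) h3
  have h6 := prevIdx_lt (W := B) (c := c) h4
  refine ⟨⟨h1, ?_, h2, ?_, ?_⟩, charAt_prevIdx h1⟩
  · simp only [prevMatch]; omega
  · simp only [prevMatch]; omega
  · simp only [prevMatch]; rw [charAt_prevIdx h1, charAt_prevIdx h2]

/-- Consecutive vertices belong to a split of `Z` into nonempty parts, and the edge between them
asks for `u ≺ v` with `u` the leftmost end of the first part and `v` the rightmost start of the
second. The remaining entries of the edge agree with prev and next by the recursions of the two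
embeddings, so all that is left is that the gap contains no match. -/
theorem isChain_embedPath_iff (Z : List ℕ) (u : ℕ × ℕ) (h1 : u.1 < rstart A Z)
    (h2 : u.2 < rstart B Z) :
    (embedPath A B u Z).IsChain (EdgeG A B) ↔
      ∀ P Q, Z = P ++ Q → P ≠ [] → Q ≠ [] →
        ¬ ∃ w, IsMatch A B w ∧ Below (lend A u.1 P, lend B u.2 P) w ∧
          Below w (rstart A Q, rstart B Q) := by
  induction Z generalizing u with
  | nil => simp [embedPath]
  | cons c Z ih =>
    cases Z with
    | nil =>
      simp only [embedPath, List.isChain_singleton, true_iff]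
      intro P Q h hP hQ
      cases P with
      | nil => exact absurd rfl hP
      | cons a P => cases Q with
        | nil => exact absurd rfl hQ
        | cons b Q => simp at h
    | cons c' Z =>
      have hle1 := rstart_le (W := A) (c' :: Z)
      have hle2 := rstart_le (W := B) (c' :: Z)
      have n1 : nextIdx A c u.1 < rstart A (c' :: Z) := by
        rwa [nextIdx_lt_iff_lt_prevIdx hle1]
      have n2 : nextIdx B c u.2 < rstart B (c' :: Z) := by
        rwa [nextIdx_lt_iff_lt_prevIdx hle2]
      have b1 : u.1 ≤ A.length := by have := rstart_le (W := A) (c :: c' :: Z); omega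
      have b2 : u.2 ≤ B.length := by have := rstart_le (W := B) (c :: c' :: Z); omega
      obtain ⟨m1, m2, m3⟩ := isMatch_nextMatch (c := c) (u := u)
        (v := (rstart A (c' :: Z), rstart B (c' :: Z))) ⟨n1, n2⟩ hle1 hle2 b1 b2
      have hv := isMatch_prevMatch (A := A) (B := B) (c := c') (v := (rstart A Z, rstart B Z))
        (by have := n1; rw [rstart_cons] at this; simp only; omega)
        (by have := n2; rw [rstart_cons] at this; simp only; omega) (rstart_le Z) (rstart_le Z)
      have hedge : EdgeG A B ((rstart A (c :: c' :: Z), rstart B (c :: c' :: Z)), nextMatch A B c u)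
          ((rstart A (c' :: Z), rstart B (c' :: Z)), nextMatch A B c' (nextMatch A B c u)) ↔
          ¬ ∃ w, IsMatch A B w ∧ Below (nextMatch A B c u) w ∧
            Below w (rstart A (c' :: Z), rstart B (c' :: Z)) := by
        constructor
        · rintro ⟨u', v', h, hp, hq⟩
          simp only [Prod.mk.injEq] at hp hq
          rw [hp.2, hq.1]
          exact h.2.2.2
        · intro h
          refine ⟨nextMatch A B c u, (rstart A (c' :: Z), rstart B (c' :: Z)),
            ⟨m1, hv.1, ⟨n1, n2⟩, h⟩, ?_, ?_⟩
          · rw [m2]; rfl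
          · have := hv.2
            simp only [prevMatch] at this
            simp only [rstart_cons]
            rw [this]
      have hih := ih (nextMatch A B c u) n1 n2
      have hchain : (embedPath A B u (c :: c' :: Z)).IsChain (EdgeG A B) ↔
          EdgeG A B ((rstart A (c :: c' :: Z), rstart B (c :: c' :: Z)), nextMatch A B c u)
          ((rstart A (c' :: Z), rstart B (c' :: Z)), nextMatch A B c' (nextMatch A B c u)) ∧
          (embedPath A B (nextMatch A B c u) (c' :: Z)).IsChain (EdgeG A B) := by
        simp only [embedPath]
        exact List.isChain_cons_cons
      rw [hchain, hedge, hih]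
      constructor
      · rintro ⟨h3, h4⟩ P Q hPQ hP hQ
        cases P with
        | nil => exact absurd rfl hP
        | cons a P =>
          simp only [List.cons_append, List.cons.injEq] at hPQ
          obtain ⟨rfl, hPQ⟩ := hPQ
          cases P with
          | nil => simp only [List.nil_append] at hPQ; subst hPQ; exact h3
          | cons b P => exact h4 (b :: P) Q hPQ (by simp) hQ
      · intro h
        refine ⟨h [c] (c' :: Z) rfl (by simp) (by simp), fun P Q hPQ hP hQ => ?_⟩
        exact h (c :: P) Q (by rw [hPQ]; rfl) (by simp) hQ

/-- All bounds on the lengths of paths, and the termination of the traversal, come from this strict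
increase. -/
theorem EdgeG.below {p q : Vertex} (h : EdgeG A B p q) : Below p.2 q.2 := by
  obtain ⟨u, v, h, rfl, rfl⟩ := h
  exact ⟨lt_nextIdx h.1.2.1, lt_nextIdx h.1.2.2.2.1⟩

theorem Prec.nextMatch_le {u v : ℕ × ℕ} (h : Prec A B u v) :
    (nextMatch A B (matchChar A v) u).1 ≤ v.1 ∧ (nextMatch A B (matchChar A v) u).2 ≤ v.2 :=
  ⟨nextIdx_le_of_occ h.2.2.1.1 h.2.1.2.1 rfl,
    nextIdx_le_of_occ h.2.2.1.2 h.2.1.2.2.2.1 h.2.1.matchChar_snd⟩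

theorem Prec.le_prevMatch {u v : ℕ × ℕ} (h : Prec A B u v) :
    u.1 ≤ (prevMatch A B (matchChar A u) v).1 ∧ u.2 ≤ (prevMatch A B (matchChar A u) v).2 :=
  ⟨le_prevIdx_of_occ h.1.1 h.2.2.1.1 rfl,
    le_prevIdx_of_occ h.1.2.2.1 h.2.2.1.2 h.1.matchChar_snd⟩

theorem Prec.matchChar_nextMatch {u v : ℕ × ℕ} (h : Prec A B u v) :
    matchChar A (nextMatch A B (matchChar A v) u) = matchChar A v :=
  charAt_nextIdx (h.nextMatch_le.1.trans h.2.1.2.1)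

/-- An edge computes the first component of its tail from that of its head by prev, which is the
recursion of the rightmost embedding started at the sink; and it computes the second component of
its head from that of its tail by next, which is the recursion of the leftmost embedding. So the
string and the first vertex's second match leave no freedom. -/
theorem eq_embedPath_of_chain (p : Vertex) (l : List Vertex)
    (hch : (p :: l).IsChain (EdgeG A B)) (hlast : (p :: l).getLast? = some (sink A B))
    (hs : IsMatch A B (sink A B).1) :
    p.1 = (rstart A (pathString A (p :: l)), rstart B (pathString A (p :: l))) ∧
      l = embedPath A B p.2 (pathString A l) := by
  induction l generalizing p with
  | nil =>
    simp only [List.getLast?_singleton, Option.some.injEq] at hlast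
    subst hlast
    have h1 := hs.1
    have h2 := hs.2.2.1
    have h3 := hs.2.2.2.2
    simp only [sink] at h1 h2 h3
    simp [pathString, embedPath, sink, matchChar, prevIdx_succ h1, prevIdx_succ h2, h3]
  | cons q l ih =>
    rw [List.isChain_cons_cons] at hch
    obtain ⟨h1, h2⟩ := ih q hch.2 (by rwa [List.getLast?_cons_cons] at hlast)
    obtain ⟨u, v, h, rfl, rfl⟩ := hch.1
    have hc := h.matchChar_nextMatch
    constructor
    -- The right-hand side of `h1` mentions `v` again, through the string; quantifying over the
    -- coordinates replaces `v` in the argument of prev only.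
    · have key : ∀ x y, v = (x, y) → prevMatch A B (matchChar A u) v =
          (prevIdx A (matchChar A u) x, prevIdx B (matchChar A u) y) := by
        rintro _ _ rfl; rfl
      exact key _ _ h1
    · simp only [pathString, List.map_cons, embedPath] at h1 h2 ⊢
      rw [hc] at h1 ⊢
      rw [← h2, ← h1]

/-- Reachability from the source is carried along the list, and the induction returns with
reachability of the sink. -/
theorem isChain_allMCSEdge {s : Vertex} (l : List Vertex)
    (hs : Relation.ReflTransGen (EdgeG A B) source s) (hch : (s :: l).IsChain (EdgeG A B))
    (hlast : (s :: l).getLast? = some (sink A B)) :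
    (s :: l).IsChain (AllMCSEdge A B) ∧ Relation.ReflTransGen (EdgeG A B) s (sink A B) := by
  induction l generalizing s with
  | nil =>
    simp only [List.getLast?_singleton, Option.some.injEq] at hlast
    subst hlast
    exact ⟨List.isChain_singleton _, .refl⟩
  | cons q l ih =>
    rw [List.isChain_cons_cons] at hch ⊢
    obtain ⟨h1, h2⟩ := ih (hs.tail hch.1) hch.2 (by rwa [List.getLast?_cons_cons] at hlast)
    exact ⟨⟨⟨hch.1, hs, h2⟩, h1⟩, .head hch.1 h2⟩

/-- Pruning `G` to the all-MCS graph thus loses no source-to-sink path, and these can be studied in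
`G` itself. -/
theorem isSourceSinkPath_iff (P : List Vertex) :
    IsSourceSinkPath A B P ↔
      P.head? = some source ∧ P.getLast? = some (sink A B) ∧ P.IsChain (EdgeG A B) := by
  constructor
  · rintro ⟨h1, h2, h3⟩
    exact ⟨h1, h2, h3.imp fun _ _ h => h.1⟩
  · rintro ⟨h1, h2, h3⟩
    refine ⟨h1, h2, ?_⟩
    cases P with
    | nil => simp at h1
    | cons s l =>
      simp only [List.head?_cons, Option.some.injEq] at h1
      subst h1
      exact (isChain_allMCSEdge l .refl h3 h2).1

theorem embedPath_getLast? (u : ℕ × ℕ) (c : ℕ) (Z : List ℕ) :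
    (embedPath A B u (Z ++ [c])).getLast? =
      some ((rstart A [c], rstart B [c]), (lend A u.1 (Z ++ [c]), lend B u.2 (Z ++ [c]))) := by
  induction Z generalizing u with
  | nil => simp [embedPath, nextMatch]
  | cons d Z ih =>
    simp only [List.cons_append, embedPath]
    rw [List.getLast?_cons, ih]
    simp [nextMatch]

theorem pathString_embedPath (u : ℕ × ℕ) (Z : List ℕ) (h1 : u.1 < rstart A Z) :
    pathString A (embedPath A B u Z) = Z := by
  induction Z generalizing u with
  | nil => rfl
  | cons c Z ih =>
    have n1 : nextIdx A c u.1 < rstart A Z := by rwa [nextIdx_lt_iff_lt_prevIdx (rstart_le _)]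
    have := ih (nextMatch A B c u) n1
    simp only [pathString, embedPath, List.map_cons, List.cons.injEq] at this ⊢
    refine ⟨charAt_nextIdx ?_, this⟩
    have := rstart_le (W := A) Z
    omega

end Paths

end MCS

namespace MCS

/-! ### Strings with sentinels: source, sink and the empty parts. -/

section Framed

variable {τ : ℕ} {A' : List ℕ}

theorem charAt_framed_one : charAt (1 :: A' ++ [τ]) 1 = 1 := rfl

theorem charAt_framed_last : charAt (1 :: A' ++ [τ]) (1 :: A' ++ [τ]).length = τ := by
  simp [charAt]

theorem charAt_framed_mid {i : ℕ} (h1 : 1 < i) (h2 : i < (1 :: A' ++ [τ]).length) :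
    charAt (1 :: A' ++ [τ]) i ∈ A' := by
  simp at h2
  rw [charAt_eq_getElem (by omega) (by simp; omega)]
  obtain ⟨j, rfl⟩ : ∃ j, i = j + 2 := ⟨i - 2, by omega⟩
  simp only [Nat.add_succ_sub_one, List.cons_append, List.getElem_cons_succ]
  rw [List.getElem_append_left (by omega)]
  exact List.getElem_mem _

/-- Each sentinel occurs only once; therefore embeddings of framed strings start at position 1
(`rstart_framed`) and end at the last position (`lend_framed`). -/
theorem eq_one_of_charAt_framed (hτ : τ ≠ 1) (hA : ∀ c ∈ A', c ≠ 1 ∧ c ≠ τ) {i : ℕ} (h1 : 1 ≤ i)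
    (h2 : i ≤ (1 :: A' ++ [τ]).length) (h : charAt (1 :: A' ++ [τ]) i = 1) : i = 1 := by
  by_contra hi
  rcases h2.lt_or_eq with h2 | rfl
  · exact (hA _ (charAt_framed_mid (by omega) h2)).1 h
  · exact hτ (charAt_framed_last.symm.trans h)

theorem eq_length_of_charAt_framed (hτ : τ ≠ 1) (hA : ∀ c ∈ A', c ≠ 1 ∧ c ≠ τ) {i : ℕ} (h1 : 1 ≤ i)
    (h2 : i ≤ (1 :: A' ++ [τ]).length) (h : charAt (1 :: A' ++ [τ]) i = τ) :
    i = (1 :: A' ++ [τ]).length := by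
  by_contra hi
  rcases h1.lt_or_eq with h1 | rfl
  · exact (hA _ (charAt_framed_mid h1 (by omega))).2 h
  · exact hτ h.symm

theorem nextIdx_framed_one : nextIdx (1 :: A' ++ [τ]) 1 0 = 1 := by
  rw [nextIdx_of_lt (by simp), zero_add, if_pos charAt_framed_one]

theorem prevIdx_framed_last :
    prevIdx (1 :: A' ++ [τ]) τ ((1 :: A' ++ [τ]).length + 1) = (1 :: A' ++ [τ]).length := by
  rw [prevIdx_succ (by simp), if_pos charAt_framed_last]

theorem rstart_framed (hτ : τ ≠ 1) (hA : ∀ c ∈ A', c ≠ 1 ∧ c ≠ τ) {Z : List ℕ}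
    (h : 0 < rstart (1 :: A' ++ [τ]) (1 :: Z)) : rstart (1 :: A' ++ [τ]) (1 :: Z) = 1 := by
  refine eq_one_of_charAt_framed hτ hA h ?_ (charAt_prevIdx h)
  have h1 := rstart_le (W := 1 :: A' ++ [τ]) Z
  have h3 : 1 ≤ rstart (1 :: A' ++ [τ]) Z := by
    by_contra h0
    have h4 : rstart (1 :: A' ++ [τ]) Z ≤ 1 := by omega
    rw [rstart_cons, prevIdx_of_le_one h4] at h
    omega
  have h2 : rstart (1 :: A' ++ [τ]) (1 :: Z) < rstart (1 :: A' ++ [τ]) Z := prevIdx_lt h3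
  omega

theorem lend_framed (hτ : τ ≠ 1) (hA : ∀ c ∈ A', c ≠ 1 ∧ c ≠ τ) {Z : List ℕ}
    (h : 0 < rstart (1 :: A' ++ [τ]) (Z ++ [τ])) :
    lend (1 :: A' ++ [τ]) 0 (Z ++ [τ]) = (1 :: A' ++ [τ]).length := by
  have h1 : lend (1 :: A' ++ [τ]) 0 (Z ++ [τ]) < (1 :: A' ++ [τ]).length + 1 := by
    have := (lend_lt_rstart_iff (W := 1 :: A' ++ [τ]) (i := 0) (Z ++ [τ]) []).2 (by simpa using h)
    simpa using this
  have h2 : nextIdx (1 :: A' ++ [τ]) τ (lend (1 :: A' ++ [τ]) 0 Z) ≤ (1 :: A' ++ [τ]).length := by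
    rw [lend_append] at h1
    exact Nat.lt_succ_iff.1 h1
  rw [lend_append]
  refine eq_length_of_charAt_framed hτ hA ?_ h2 (charAt_nextIdx h2)
  obtain ⟨i, h3, h4, _⟩ := (nextIdx_le_iff h2).1 le_rfl
  simp only [lend_cons, lend_nil]
  omega

end Framed

section FramedPair

variable {τ : ℕ} {A' B' : List ℕ}

theorem isMatch_sink_framed : IsMatch (1 :: A' ++ [τ]) (1 :: B' ++ [τ])
    (sink (1 :: A' ++ [τ]) (1 :: B' ++ [τ])).1 := by
  refine ⟨by simp [sink], by simp [sink], by simp [sink], by simp [sink], ?_⟩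
  simp only [sink]
  rw [charAt_framed_last, charAt_framed_last]

/-- The embeddings start from the fictitious pair `(0, 0)`, after which the first sentinel is found
at `(1, 1)`; so the walk begins in the source, and symmetrically the last sentinel puts its end in
the sink. -/
theorem isSourceSinkPath_embedPath (hτ : τ ≠ 1) (hA : ∀ c ∈ A', c ≠ 1 ∧ c ≠ τ)
    (hB : ∀ c ∈ B', c ≠ 1 ∧ c ≠ τ) {Z : List ℕ}
    (h : IsMCS (1 :: A' ++ [τ]) (1 :: B' ++ [τ]) (1 :: Z ++ [τ])) :
    IsSourceSinkPath (1 :: A' ++ [τ]) (1 :: B' ++ [τ])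
      (embedPath (1 :: A' ++ [τ]) (1 :: B' ++ [τ]) (0, 0) (1 :: Z ++ [τ])) := by
  rw [isMCS_iff_no_match] at h
  obtain ⟨⟨h1, h2⟩, h3⟩ := h
  rw [isSourceSinkPath_iff]
  refine ⟨?_, ?_, ?_⟩
  · have e1 := rstart_framed (Z := Z ++ [τ]) hτ hA h1
    have e2 := rstart_framed (Z := Z ++ [τ]) hτ hB h2
    simp only [List.cons_append] at e1 e2
    have n1 := nextIdx_framed_one (τ := τ) (A' := A')
    have n2 := nextIdx_framed_one (τ := τ) (A' := B')
    simp only [List.cons_append] at n1 n2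
    simp only [embedPath, List.cons_append, List.head?_cons, e1, e2, n1, n2, source, nextMatch]
  · rw [embedPath_getLast?, lend_framed hτ hA h1, lend_framed hτ hB h2]
    simp only [rstart_cons, rstart_nil, prevIdx_framed_last, sink]
  · rw [isChain_embedPath_iff _ _ h1 h2]
    exact fun P Q h _ _ => h3 P Q h

theorem pathString_framed {P : List Vertex}
    (h : IsSourceSinkPath (1 :: A' ++ [τ]) (1 :: B' ++ [τ]) P) :
    ∃ Z, pathString (1 :: A' ++ [τ]) P = 1 :: Z ++ [τ] ∧
      P = embedPath (1 :: A' ++ [τ]) (1 :: B' ++ [τ]) (0, 0) (1 :: Z ++ [τ]) := by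
  rw [isSourceSinkPath_iff] at h
  obtain ⟨h1, h2, h3⟩ := h
  cases P with
  | nil => simp at h1
  | cons p l =>
    simp only [List.head?_cons, Option.some.injEq] at h1
    obtain ⟨e1, e2⟩ := eq_embedPath_of_chain p l h3 h2 isMatch_sink_framed
    obtain ⟨Z, hZ⟩ : ∃ Z, pathString (1 :: A' ++ [τ]) (p :: l) = 1 :: Z ++ [τ] := by
      cases l using List.reverseRecOn with
      | nil =>
        -- A path with a single vertex would identify source and sink, but the framed strings have
        -- length at least 2.
        simp [h1, source, sink] at h2
      | append_singleton l q =>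
        have : q = sink (1 :: A' ++ [τ]) (1 :: B' ++ [τ]) := by
          rw [← List.cons_append, List.getLast?_append] at h2
          simpa using h2
        refine ⟨pathString (1 :: A' ++ [τ]) l, ?_⟩
        simp only [pathString, List.map_cons, List.map_append, List.map_nil]
        rw [this, h1]
        simp only [matchChar, sink, source, charAt_framed_last]
        rfl
    refine ⟨Z, hZ, ?_⟩
    rw [hZ] at e1
    have hp : pathString (1 :: A' ++ [τ]) l = Z ++ [τ] := by
      simpa [pathString] using (List.cons.inj (by simpa [pathString] using hZ)).2
    rw [hp] at e2
    have n1 := nextIdx_framed_one (τ := τ) (A' := A')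
    have n2 := nextIdx_framed_one (τ := τ) (A' := B')
    have hn : nextMatch (1 :: A' ++ [τ]) (1 :: B' ++ [τ]) 1 (0, 0) = p.2 := by
      rw [h1]; simp only [nextMatch, n1, n2, source]
    have : embedPath (1 :: A' ++ [τ]) (1 :: B' ++ [τ]) (0, 0) (1 :: (Z ++ [τ])) = p :: l := by
      rw [embedPath, hn, ← e2]
      congr 1
      exact Prod.ext e1.symm rfl
    exact this.symm

theorem isMCS_pathString (P : List Vertex)
    (h : IsSourceSinkPath (1 :: A' ++ [τ]) (1 :: B' ++ [τ]) P) :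
    IsMCS (1 :: A' ++ [τ]) (1 :: B' ++ [τ]) (pathString (1 :: A' ++ [τ]) P) := by
  obtain ⟨Z, h4, h5⟩ := pathString_framed h
  rw [h4]
  rw [isSourceSinkPath_iff] at h
  obtain ⟨h1, h2, h3⟩ := h
  rw [h5] at h1 h2 h3
  rw [embedPath_getLast?] at h2
  simp only [List.cons_append, embedPath, List.head?_cons, Option.some.injEq, source, Prod.mk.injEq]
    at h1
  simp only [sink, Option.some.injEq, Prod.mk.injEq] at h2
  have r1 : 0 < rstart (1 :: A' ++ [τ]) (1 :: Z ++ [τ]) := by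
    have := h1.1.1; simp only [List.cons_append] at this ⊢; omega
  have r2 : 0 < rstart (1 :: B' ++ [τ]) (1 :: Z ++ [τ]) := by
    have := h1.1.2; simp only [List.cons_append] at this ⊢; omega
  rw [isMCS_iff_no_match]
  refine ⟨⟨r1, r2⟩, fun P Q hPQ => ?_⟩
  -- In front of the first character there is no room, because the rightmost embedding starts at
  -- position 1.
  rcases eq_or_ne P [] with rfl | hP
  · rintro ⟨w, hw, _, h6⟩
    obtain rfl : 1 :: Z ++ [τ] = Q := hPQ
    have := h6.1
    have := h1.1.1
    have := hw.1
    simp only [List.cons_append] at *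
    omega
  -- Behind the last character there is no room, because the leftmost embedding ends at the last
  -- position.
  rcases eq_or_ne Q [] with rfl | hQ
  · rintro ⟨w, hw, h6, _⟩
    rw [List.append_nil] at hPQ
    subst hPQ
    have := h6.1
    have := h2.2.1
    have := hw.2.1
    simp only [List.cons_append] at *
    omega
  exact (isChain_embedPath_iff _ _ r1 r2).1 h3 P Q hPQ hP hQ

end FramedPair

/-! ### Renaming characters, and the bijection between paths and MCSs. -/

section Normalize

variable (X Y : List ℕ)

/-- The new name of a character. -/
def rename (c : ℕ) : ℕ := (X ++ Y).idxOf c + 2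

/-- The original name of a character. -/
def restore (c : ℕ) : ℕ := (X ++ Y).getD (c - 2) 0

variable {X Y}

theorem restore_rename {c : ℕ} (h : c ∈ X ++ Y) : restore X Y (rename X Y c) = c := by
  have := List.idxOf_lt_length_iff.2 h
  rw [restore, rename, Nat.add_sub_cancel, List.getD_eq_getElem _ _ this]
  exact List.getElem_idxOf this

theorem map_restore_rename {Z : List ℕ} (h : ∀ c ∈ Z, c ∈ X ++ Y) :
    (Z.map (rename X Y)).map (restore X Y) = Z := by
  rw [List.map_map]
  conv_rhs => rw [← List.map_id Z]
  exact List.map_congr_left fun c hc => restore_rename (h c hc)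

theorem normalize_eq (Z : List ℕ) :
    normalize X Y Z = 1 :: Z.map (rename X Y) ++ [X.length + Y.length + 2] := rfl

theorem rename_ne {Z : List ℕ} (h : ∀ c ∈ Z, c ∈ X ++ Y) :
    ∀ c ∈ Z.map (rename X Y), c ≠ 1 ∧ c ≠ X.length + Y.length + 2 := by
  intro c hc
  obtain ⟨d, hd, rfl⟩ := List.mem_map.1 hc
  have := List.idxOf_lt_length_iff.2 (h d hd)
  rw [List.length_append] at this
  unfold rename
  omega

theorem restore_normalize {Z : List ℕ} (h : ∀ c ∈ Z, c ∈ X ++ Y) :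
    ((normalize X Y Z).tail.dropLast).map (restore X Y) = Z := by
  rw [normalize_eq, List.cons_append, List.tail_cons, List.dropLast_concat, map_restore_rename h]

theorem normalize_sublist_iff {Z T : List ℕ} (hZ : ∀ c ∈ Z, c ∈ X ++ Y) (hT : ∀ c ∈ T, c ∈ X ++ Y) :
    (normalize X Y Z).Sublist (normalize X Y T) ↔ Z.Sublist T := by
  rw [normalize_eq, normalize_eq, List.append_sublist_append_right, List.cons_sublist_cons]
  constructor
  · intro h
    have := h.map (restore X Y)
    rwa [map_restore_rename hZ, map_restore_rename hT] at this
  · exact fun h => h.map _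

/-- A character in front of the first sentinel would push that sentinel into `T ++ [τ]`, where it
does not occur, and likewise at the other end. So every insertion that stays a subsequence happens
between the sentinels. -/
theorem insert_framed_cases {τ c : ℕ} {P Q Z T : List ℕ} (h : 1 :: Z ++ [τ] = P ++ Q)
    (hs : (P ++ c :: Q).Sublist (1 :: T ++ [τ])) (h1 : τ ≠ 1) (hT : ∀ c ∈ T, c ≠ 1 ∧ c ≠ τ) :
    ∃ P' Q', P = 1 :: P' ∧ Q = Q' ++ [τ] ∧ Z = P' ++ Q' ∧ (P' ++ c :: Q').Sublist T := by
  have hone : 1 ∉ T ++ [τ] := by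
    simp only [List.mem_append, List.mem_singleton, not_or]
    exact ⟨fun h => (hT 1 h).1 rfl, fun h => h1 h.symm⟩
  have htau : τ ∉ 1 :: T := by
    simp only [List.mem_cons, not_or]
    exact ⟨h1, fun h => (hT τ h).2 rfl⟩
  cases P with
  | nil =>
    exfalso
    rw [List.nil_append] at h hs
    subst h
    simp only [List.cons_append] at hs
    rw [List.cons_sublist_cons'] at hs
    rcases hs with hs | ⟨_, hs⟩
    · exact hone (hs.subset (by simp))
    · exact hone (hs.subset (by simp))
  | cons p P =>
    simp only [List.cons_append, List.cons.injEq] at h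
    obtain ⟨rfl, h⟩ := h
    cases Q using List.reverseRecOn with
    | nil =>
      exfalso
      rw [List.append_nil] at h
      subst h
      -- If the last `τ` of the target is unused, everything embeds into `1 :: T`, which lacks `τ`;
      -- if it is used, then by the appended `c`, and what precedes `c` embeds into `1 :: T`.
      have : (1 :: Z ++ [τ]).Sublist (1 :: T) := by
        rw [← List.append_sublist_append_right [c]]
        rcases List.sublist_append_iff.1 hs with ⟨l₁, l₂, e, s1, s2⟩
        rcases List.sublist_singleton.1 s2 with rfl | rfl
        · exfalso
          rw [List.append_nil] at e
          subst e
          exact htau (s1.subset (by simp))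
        · have e' : (1 :: Z ++ [τ]) ++ [c] = l₁ ++ [τ] := by simpa using e
          have := List.append_inj' e' rfl
          rw [this.1]
          exact (List.append_sublist_append_right _).2 s1
      exact htau (this.subset (by simp))
    | append_singleton Q q =>
      rw [← List.append_assoc] at h
      obtain ⟨hZ, hq⟩ := List.append_inj' h rfl
      simp only [List.cons.injEq, and_true] at hq
      subst hq
      refine ⟨P, Q, rfl, rfl, hZ, ?_⟩
      have : (1 :: (P ++ c :: Q) ++ [τ]).Sublist (1 :: T ++ [τ]) := by simpa using hs
      rwa [List.append_sublist_append_right, List.cons_sublist_cons] at this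

theorem isMCS_normalize_iff {Z : List ℕ} (hZ : ∀ c ∈ Z, c ∈ X ++ Y) :
    IsMCS (normalize X Y X) (normalize X Y Y) (normalize X Y Z) ↔ IsMCS X Y Z := by
  have hX : ∀ c ∈ X, c ∈ X ++ Y := fun c hc => List.mem_append_left _ hc
  have hY : ∀ c ∈ Y, c ∈ X ++ Y := fun c hc => List.mem_append_right _ hc
  have hcs : ∀ {Z}, (∀ c ∈ Z, c ∈ X ++ Y) → (IsCommonSubseq (normalize X Y X) (normalize X Y Y)
      (normalize X Y Z) ↔ IsCommonSubseq X Y Z) := fun hZ =>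
    and_congr (normalize_sublist_iff hZ hX) (normalize_sublist_iff hZ hY)
  refine and_congr (hcs hZ) ⟨?_, ?_⟩
  · rintro h P Q c rfl hc
    refine h (1 :: P.map (rename X Y)) (Q.map (rename X Y) ++ [X.length + Y.length + 2])
      (rename X Y c) (by simp [normalize_eq]) ?_
    have := (hcs (Z := P ++ c :: Q) fun d hd => hX d (hc.1.subset hd)).2 hc
    simpa [normalize_eq] using this
  · intro h P Q c hPQ hc
    have hτ : X.length + Y.length + 2 ≠ 1 := by omega
    obtain ⟨P', Q', rfl, rfl, e, s⟩ := insert_framed_cases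
      (Z := Z.map (rename X Y)) (T := X.map (rename X Y)) hPQ hc.1 hτ (rename_ne hX)
    obtain ⟨P'', Q'', e1, e2, _, s'⟩ := insert_framed_cases
      (Z := Z.map (rename X Y)) (T := Y.map (rename X Y)) hPQ hc.2 hτ (rename_ne hY)
    obtain rfl := (List.cons.inj e1).2
    obtain rfl := (List.append_inj' e2 rfl).1
    -- The inserted `c` is not known to be a renamed character. This is harmless: the whole sublist
    -- relation is restored, and only `X`, `Y` and `Z` have to come back exactly.
    refine h (P'.map (restore X Y)) (Q'.map (restore X Y)) (restore X Y c) ?_ ⟨?_, ?_⟩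
    · rw [← List.map_append, ← e, map_restore_rename hZ]
    · have := s.map (restore X Y)
      rwa [map_restore_rename hX, List.map_append, List.map_cons] at this
    · have := s'.map (restore X Y)
      rwa [map_restore_rename hY, List.map_append, List.map_cons] at this

theorem exists_eq_normalize_of_path {P : List Vertex}
    (h : IsSourceSinkPath (normalize X Y X) (normalize X Y Y) P) :
    ∃ Z, (∀ c ∈ Z, c ∈ X ++ Y) ∧ pathString (normalize X Y X) P = normalize X Y Z ∧
      IsMCS X Y Z := by
  have hX : ∀ c ∈ X, c ∈ X ++ Y := fun c hc => List.mem_append_left _ hc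
  obtain ⟨Z, h1, -⟩ := pathString_framed h
  have h2 := isMCS_pathString P h
  have h3 : Z.Sublist (X.map (rename X Y)) := by
    have := h2.1.1
    rw [h1, List.append_sublist_append_right, List.cons_sublist_cons] at this
    exact this
  -- A subsequence of the renamed `X` is itself a renamed string, which is how the original `Z` is
  -- recovered.
  obtain ⟨T, hT, rfl⟩ := List.sublist_map_iff.1 h3
  have hT' : ∀ c ∈ T, c ∈ X ++ Y := fun c hc => hX c (hT.subset hc)
  refine ⟨T, hT', h1, (isMCS_normalize_iff hT').1 ?_⟩
  have e : pathString (normalize X Y X) P = normalize X Y T := h1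
  rw [← e]
  exact h2

theorem exists_path_of_isMCS {Z : List ℕ} (h : IsMCS X Y Z) :
    ∃ P, IsSourceSinkPath (normalize X Y X) (normalize X Y Y) P ∧
      pathString (normalize X Y X) P = normalize X Y Z := by
  have hX : ∀ c ∈ X, c ∈ X ++ Y := fun c hc => List.mem_append_left _ hc
  have hY : ∀ c ∈ Y, c ∈ X ++ Y := fun c hc => List.mem_append_right _ hc
  have hZ : ∀ c ∈ Z, c ∈ X ++ Y := fun c hc => hX c (h.1.1.subset hc)
  have h' := (isMCS_normalize_iff hZ).2 h
  refine ⟨_, isSourceSinkPath_embedPath (by omega) (rename_ne hX) (rename_ne hY) h', ?_⟩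
  exact pathString_embedPath _ _ ((isMCS_iff_no_match _).1 h').1.1

/-- Both paths are `embedPath` of the strings that they represent. -/
theorem pathString_injOn {P Q : List Vertex}
    (hP : IsSourceSinkPath (normalize X Y X) (normalize X Y Y) P)
    (hQ : IsSourceSinkPath (normalize X Y X) (normalize X Y Y) Q)
    (h : pathString (normalize X Y X) P = pathString (normalize X Y X) Q) : P = Q := by
  obtain ⟨Z, h1, h2⟩ := pathString_framed hP
  obtain ⟨T, h3, h4⟩ := pathString_framed hQ
  rw [h2, h4, ← h1, ← h3]
  exact congrArg (embedPath _ _ (0, 0)) h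

end Normalize

end MCS

namespace MCS

/-! ### The program that normalizes the input. -/

namespace Enum331

open Var Arr

variable {M W : ℕ}

/-- The registers that hold the lengths of the strings, before and after normalization, and the
size of the alphabet. -/
structure Sizes (n m : ℕ) (s : State Var Arr) : Prop where
  nx : s.reg Var.nx = n
  ny : s.reg Var.ny = m
  lx : s.reg Var.lx = n + 2
  ly : s.reg Var.ly = m + 2
  sg : s.reg Var.sg = n + m + 2

theorem Sizes.frame {n m : ℕ} {c : Cmd Var Arr} {s s' : State Var Arr} (h : Sizes n m s)
    (hF : Frame c s s') (hc : ∀ x ∈ [Var.nx, Var.ny, Var.lx, Var.ly, Var.sg], x ∉ c.regs) :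
    Sizes n m s' := by
  simp only [List.mem_cons, List.not_mem_nil, or_false, forall_eq_or_imp, forall_eq] at hc
  obtain ⟨h1, h2, h3, h4, h5⟩ := hc
  exact ⟨(hF.reg _ h1).trans h.nx, (hF.reg _ h2).trans h.ny, (hF.reg _ h3).trans h.lx,
    (hF.reg _ h4).trans h.ly, (hF.reg _ h5).trans h.sg⟩

/-- The condition `ho` covers the two offsets in use, the constant 0 and the register `nx`: neither
changes while the loop counter `p` runs. -/
theorem addSentinels_spec {s : State Var Arr} (o : Expr Var Arr) (l : Var) (strOut : Arr)
    (ov σ : ℕ) (Z : List ℕ) (hlp : l ≠ p) (hlab : Arr.lab ≠ strOut)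
    (ho : ∀ s' : State Var Arr, s'.reg nx = s.reg nx → o.InBounds M s' ∧ o.eval s' = ov)
    (hoc : o.cost ≤ 1) (hl : s.reg l = Z.length + 2) (hsg : s.reg sg = σ)
    (hZ : ∀ i < Z.length, s.mem lab (ov + i) = Z.getD i 0)
    (hZW : ∀ c ∈ Z, c ≤ W) (hσ : σ ≤ W) (hM : ov + Z.length + 2 < M) (hW : Z.length + 2 ≤ W) :
    WP M W (addSentinels o l strOut) (fun s' =>
      s'.clock ≤ s.clock + 30 * (Z.length + 1) ∧
      ∀ i, 1 ≤ i → i ≤ Z.length + 2 → s'.mem strOut i = charAt (1 :: Z ++ [σ]) i) s := by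
  rw [addSentinels, WP.seq_iff, WP.store_iff, WP.seq_iff]
  refine ⟨by simp, by simp, by simp; omega, by simp; omega, ?_⟩
  refine WP.forRange_uniform 0 Z.length 10
    (fun i _ mem => mem strOut 1 = 1 ∧ ∀ j < i, mem strOut (j + 2) = Z.getD j 0)
    (by simp) (by simp) (Nat.zero_le _) (by omega) ?_ ?_ ?_ ?_
  · simp
  · intro i s' hF _ _ _ _
    have := hF.reg l (by simp [hlp])
    simp at this
    simp [this, hl]
  · intro i s' hF hp _ hi ⟨h1, h2⟩
    have hnx := hF.reg nx (by simp)
    obtain ⟨o1, o2⟩ := ho s' (by simpa using hnx)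
    have hlabm : s'.mem lab = s.mem lab := by
      rw [hF.mem lab (by simpa using hlab)]
      ext j; simp [hlab]
    have hval : s'.mem lab (ov + i) = Z.getD i 0 := by rw [hlabm, hZ i hi]
    have hle : Z.getD i 0 ≤ W := by
      rw [List.getD_eq_getElem _ _ hi]; exact hZW _ (List.getElem_mem _)
    simp only [WP.store_iff, Expr.InBounds, Expr.eval, Expr.add_def, hp, o1, o2, hval,
      Expr.ofNat_def, State.tick_reg, State.setMem_reg, State.tick_clock, State.setMem_clock,
      Expr.cost, State.tick_mem, State.setMem_mem, if_true]
    refine ⟨⟨trivial, trivial⟩, ⟨⟨trivial, trivial⟩, by omega⟩, by omega, hle, trivial, by omega,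
      by simpa using h1, fun j hj => ?_⟩
    split_ifs with hji
    · obtain rfl : j = i := by omega
      rfl
    · exact h2 j (by omega)
  · intro s' hF hp hc ⟨h1, h2⟩
    have hl' := hF.reg l (by simp [hlp])
    have hs' := hF.reg sg (by simp)
    simp at hl' hs' hc
    simp only [WP.store_iff, Expr.InBounds, Expr.eval, hl', hl, hs', hsg, State.tick_clock,
      State.setMem_clock, Expr.cost]
    refine ⟨trivial, trivial, by omega, hσ, by omega, ?_⟩
    intro i hi1 hi2
    simp only [State.tick_mem, State.setMem_mem, if_true]
    split_ifs with hi
    · subst hi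
      simp [charAt]
    · rcases Nat.eq_or_lt_of_le hi1 with rfl | hi1
      · rw [h1]; rfl
      · obtain ⟨j, rfl⟩ : ∃ j, i = j + 2 := ⟨i - 2, by omega⟩
        rw [h2 j (by omega)]
        simp only [charAt, Nat.add_succ_sub_one, List.cons_append, List.getD_cons_succ]
        rw [List.getD_append _ _ _ _ (by omega)]

theorem idxOf_getD_le (l : List ℕ) {i : ℕ} (h : i < l.length) : l.idxOf (l.getD i 0) ≤ i := by
  induction l generalizing i with
  | nil => simp at h
  | cons a l ih =>
    cases i with
    | zero => simp
    | succ i =>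
      rw [List.getD_cons_succ, List.idxOf_cons]
      have := ih (i := i) (by simpa using h)
      cases a == l.getD i 0
      · simpa using this
      · simp

/-- A linear search for every position, hence quadratic time; it stops at the position itself at the
latest. -/
theorem labels_spec {s : State Var Arr} (Z : List ℕ) (n m : ℕ) (hnx : s.reg nx = n)
    (hny : s.reg ny = m) (hn : n + m = Z.length) (hcat : ∀ j < Z.length, s.mem cat j = Z.getD j 0)
    (hM : Z.length ≤ M) (hW : Z.length + 2 ≤ W) :
    WP M W (forRange (V := Var) (A := Arr) p 0 (nx + ny)
      (q ::= 0 ;;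
        Cmd.loop (.not (.eq (cat q) (cat p))) (q ::= q + 1) ;;
        Cmd.store lab p (q + 2))) (fun s' =>
      s'.clock ≤ s.clock + 60 * (Z.length + 1) ^ 2 ∧
      ∀ j < Z.length, s'.mem lab j = Z.idxOf (Z.getD j 0) + 2) s := by
  refine WP.forRange_uniform 0 Z.length (20 * (Z.length + 1))
    (fun i _ mem => ∀ j < i, mem lab j = Z.idxOf (Z.getD j 0) + 2)
    (by simp) (by simp) (Nat.zero_le _) (by omega) (by simp) ?_ ?_ ?_
  · intro i s' hF _ _ _ _
    have h1 := hF.reg nx (by simp)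
    have h2 := hF.reg ny (by simp)
    simp [h1, h2, hnx, hny, hn]
  · intro i s' hF hp _ hi hI
    have hcat : ∀ j < Z.length, s'.mem cat j = Z.getD j 0 := fun j hj => by
      rw [hF.mem cat (by simp), hcat j hj]
    -- The search ends at the first occurrence `k ≤ i` of the character at position `i`, so `k`
    -- bounds the search counter.
    obtain ⟨k, hk⟩ : ∃ k, k = Z.idxOf (Z.getD i 0) := ⟨_, rfl⟩
    have hki : k ≤ i := hk ▸ idxOf_getD_le Z hi
    have hkv : Z.getD k 0 = Z.getD i 0 := by
      have hk' : k < Z.length := by omega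
      rw [List.getD_eq_getElem _ _ hk']
      simp only [hk]
      exact List.getElem_idxOf _
    simp only [WP.seq_iff, WP.assign_iff]
    refine ⟨by simp, by simp, ?_⟩
    refine WP.loop (fun t => t.reg p = i ∧ t.mem = s'.mem ∧ t.reg q ≤ k ∧
      t.clock ≤ s'.clock + 2 + t.reg q * 11) (fun t => k - t.reg q) ?_ ?_ ?_ ?_
    · simp [hp]
    · rintro t ⟨h1, h2, h3, h4⟩
      simp [h1]
      omega
    · rintro t ⟨h1, h2, h3, h4⟩ ht
      have hne : t.reg q ≠ k := by
        intro e
        simp only [Test.Holds, Expr.eval, h1, h2, e] at ht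
        rw [hcat k (by omega), hcat i hi, hkv] at ht
        exact ht rfl
      simp [h1, h2]
      omega
    · rintro t ⟨h1, h2, h3, h4⟩ ht
      have he : t.reg q = k := by
        simp only [Test.Holds, Expr.eval, h1, h2, not_not] at ht
        rw [hcat _ (by omega), hcat i hi] at ht
        refine le_antisymm h3 ?_
        rw [hk, ← ht]
        exact idxOf_getD_le _ (by omega)
      simp only [WP.store_iff, Expr.InBounds, Expr.eval, Expr.add_def, h1, h2, he, Expr.ofNat_def,
        State.tick_reg, State.setMem_reg, State.tick_clock, State.setMem_clock,
        Expr.cost, Test.cost, State.tick_mem, State.setMem_mem, if_true]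
      refine ⟨trivial, ⟨trivial, trivial⟩, by omega, by omega, trivial, by omega, fun j hj => ?_⟩
      split_ifs with hji
      · rw [hji, ← hk]
      · exact hI j (by omega)
  · intro s' hF _ hc hI
    refine ⟨?_, hI⟩
    simp at hc
    nlinarith

theorem rename_le {X Y Z : List ℕ} (hZ : ∀ c ∈ Z, c ∈ X ++ Y) :
    ∀ c ∈ Z.map (rename X Y), c ≤ X.length + Y.length + 2 := by
  intro c hc
  obtain ⟨d, hd, rfl⟩ := List.mem_map.1 hc
  have := List.idxOf_lt_length_iff.2 (hZ d hd)
  rw [List.length_append] at this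
  unfold rename; omega

theorem getD_map_rename {X Y : List ℕ} (Z : List ℕ) {i : ℕ} (hi : i < Z.length) :
    (Z.map (rename X Y)).getD i 0 = rename X Y (Z.getD i 0) := by
  rw [List.getD_eq_getElem _ _ (by simpa using hi), List.getD_eq_getElem _ _ hi, List.getElem_map]

theorem normalizeInput_spec {s : State Var Arr} (X Y : List ℕ)
    (hnx : s.reg nx = X.length) (hny : s.reg ny = Y.length)
    (hX : ∀ i, s.mem inX i = X.getD i 0) (hY : ∀ i, s.mem inY i = Y.getD i 0)
    (hXW : ∀ c ∈ X, c ≤ W) (hYW : ∀ c ∈ Y, c ≤ W)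
    (hM : X.length + Y.length + 4 ≤ M) (hW : X.length + Y.length + 4 ≤ W) :
    WP M W normalizeInput (fun s' =>
      s'.clock ≤ s.clock + 500 * (X.length + Y.length + 4) ^ 2 ∧
      Sizes X.length Y.length s' ∧
      (∀ i < X.length + Y.length, s'.mem cat i = (X ++ Y).getD i 0) ∧
      (∀ i, 1 ≤ i → i ≤ X.length + 2 → s'.mem Arr.X i = charAt (normalize X Y X) i) ∧
      (∀ i, 1 ≤ i → i ≤ Y.length + 2 → s'.mem Arr.Y i = charAt (normalize X Y Y) i)) s := by
  have hXYW : ∀ i, (X ++ Y).getD i 0 ≤ W := by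
    intro i
    rcases Nat.lt_or_ge i (X ++ Y).length with h | h
    · rw [List.getD_eq_getElem _ _ h]
      rcases List.mem_append.1 (List.getElem_mem h) with h | h
      · exact hXW _ h
      · exact hYW _ h
    · rw [List.getD_eq_default _ _ h]; omega
  have hlen : (X ++ Y).length = X.length + Y.length := List.length_append
  have hXl : (X.map (rename X Y)).length = X.length := List.length_map _
  have hYl : (Y.map (rename X Y)).length = Y.length := List.length_map _
  have b1 : (X ++ Y).length ≤ M := by omega
  have b2 : (X ++ Y).length + 2 ≤ W := by omega
  have b3 : X.length + Y.length + 2 ≤ W := by omega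
  have b4 : 0 + (X.map (rename X Y)).length + 2 < M := by omega
  have b5 : (X.map (rename X Y)).length + 2 ≤ W := by omega
  have b6 : X.length + (Y.map (rename X Y)).length + 2 < M := by omega
  have b7 : (Y.map (rename X Y)).length + 2 ≤ W := by omega
  have b8 : X.length ≤ W := by omega
  have b9 : Y.length ≤ W := by omega
  -- The quadratic term is hidden behind `T`, and the facts about it behind functions of `Unit`, so
  -- that linear arithmetic is not handed nonlinear hypotheses.
  obtain ⟨T, hT1, hT2⟩ : ∃ T, (Unit → 60 * ((X ++ Y).length + 1) ^ 2 ≤ T) ∧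
      (Unit → 100 * (X.length + Y.length + 4) + T ≤ 500 * (X.length + Y.length + 4) ^ 2) :=
    ⟨_, fun _ => le_rfl, fun _ => by rw [hlen]; nlinarith⟩
  unfold normalizeInput
  simp only [WP.seq_iff, WP.assign_iff]
  refine ⟨by simp, by simp [hnx]; omega, by simp, by simp [hny]; omega, by simp,
    by simp [hnx, hny]; omega, ?_⟩
  -- The state becomes opaque once the few facts about it that matter have been extracted.
  generalize hs0 : State.tick _ _ = s0
  have hS0 : Sizes X.length Y.length s0 := by
    constructor <;> simp [← hs0, hnx, hny]
  have hX0 : ∀ i, s0.mem inX i = X.getD i 0 := by intro i; rw [← hs0]; exact hX i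
  have hY0 : ∀ i, s0.mem inY i = Y.getD i 0 := by intro i; rw [← hs0]; exact hY i
  have hc0 : s0.clock ≤ s.clock + 20 := by simp [← hs0]
  clear hs0
  refine WP.forRange_uniform 0 X.length 10
    (fun i _ mem => ∀ j < i, mem cat j = X.getD j 0)
    (by simp) (by simp) (Nat.zero_le _) b8 (by simp) ?_ ?_ ?_
  · intro i s' hF _ _ _ _
    have := hF.reg nx (by simp)
    simp [this, hS0.nx]
  · intro i s' hF hp _ hi hI
    have h1 : s'.mem inX i = X.getD i 0 := by
      rw [hF.mem inX (by simp), hX0]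
    have h2 : X.getD i 0 ≤ W := by
      rw [List.getD_eq_getElem _ _ hi]; exact hXW _ (List.getElem_mem _)
    simp [hp, h1]
    simp at h2
    refine ⟨by omega, by omega, fun j hj => ?_⟩
    split_ifs with hji
    · rw [hji]
    · simpa using hI j (by omega)
  intro s1 hF1 _ hc1 hI1
  simp at hc1
  have hS1 := hS0.frame hF1 (by simp)
  rw [WP.seq_iff]
  refine WP.forRange_uniform 0 Y.length 10
    (fun i _ mem => ∀ j < X.length + i, mem cat j = (X ++ Y).getD j 0)
    (by simp) (by simp) (Nat.zero_le _) b9 ?_ ?_ ?_ ?_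
  · intro j hj
    rw [hI1 j (by omega), List.getD_append _ _ _ _ (by omega)]
  · intro i s' hF _ _ _ _
    have := hF.reg ny (by simp)
    simp [this, hS1.ny]
  · intro i s' hF hp _ hi hI
    have hnx' : s'.reg nx = X.length := by rw [hF.reg nx (by simp), hS1.nx]
    have h1 : s'.mem inY i = (X ++ Y).getD (X.length + i) 0 := by
      rw [hF.mem inY (by simp), hF1.mem inY (by simp), List.getD_append_right _ _ _ _ (by omega),
        hY0, Nat.add_sub_cancel_left]
    have h2 := hXYW (X.length + i)
    simp only [WP.store_iff, Expr.InBounds, Expr.eval, hp, h1, hnx', Expr.add_def]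
    refine ⟨by simp, ⟨trivial, by omega⟩, by omega, h2, hp, by simp, ?_⟩
    intro j hj
    simp only [State.tick_mem, State.setMem_mem, if_true]
    split_ifs with hji
    · rw [hji]
    · exact hI j (by omega)
  intro s2 hF2 _ hc2 hI2
  simp at hc2
  have hS2 := hS1.frame hF2 (by simp)
  rw [WP.seq_iff]
  refine (labels_spec (X ++ Y) X.length Y.length hS2.nx hS2.ny (by simp) (by simpa using hI2)
    b1 b2).mono_frame ?_
  rintro s3 hF3 ⟨hc3, hI3⟩
  replace hc3 := hc3.trans (Nat.add_le_add_left (hT1 ()) _)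
  rw [WP.seq_iff]
  have hI3 : ∀ j < X.length + Y.length, s3.mem lab j = rename X Y ((X ++ Y).getD j 0) := by
    simpa [rename] using hI3
  have hS3 := hS2.frame hF3 (by simp)
  have hcat3 : ∀ j < X.length + Y.length, s3.mem cat j = (X ++ Y).getD j 0 := fun j hj => by
    rw [hF3.mem cat (by simp), hI2 j hj]
  refine (addSentinels_spec 0 lx Arr.X 0 (X.length + Y.length + 2) (X.map (rename X Y)) (by simp)
    (by simp) (by simp) (by simp) (by simp [hS3.lx]) hS3.sg ?_ 
    (fun c hc => (rename_le (by simp +contextual) c hc).trans b3) b3 b4 b5).mono_frame ?_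
  · intro i hi
    rw [List.length_map] at hi
    rw [zero_add, hI3 i (by omega), getD_map_rename _ hi, List.getD_append _ _ _ _ hi]
  rintro s4 hF4 ⟨hc4, hI4⟩
  rw [List.length_map] at hc4
  have hS4 := hS3.frame hF4 (by simp [addSentinels])
  refine (addSentinels_spec nx ly Arr.Y X.length (X.length + Y.length + 2) (Y.map (rename X Y))
    (by simp) (by simp) ?_ (by simp) ?_ ?_ ?_ 
    (fun c hc => (rename_le (by simp +contextual) c hc).trans b3) b3 b6 b7).mono_frame ?_
  · intro s' hs'
    simp [hs', hS4.nx]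
  · simp [hS4.ly]
  · exact hS4.sg
  · intro i hi
    rw [List.length_map] at hi
    rw [hF4.mem lab (by simp [addSentinels]), hI3 _ (by omega), getD_map_rename _ hi,
      List.getD_append_right _ _ _ _ (by omega), Nat.add_sub_cancel_left]
  rintro s5 hF5 ⟨hc5, hI5⟩
  refine ⟨?_, ?_, ?_, ?_, ?_⟩
  · rw [List.length_map] at hc5
    have : s5.clock ≤ s.clock + 100 * (X.length + Y.length + 4) + T := by omega
    exact this.trans (by rw [add_assoc]; exact Nat.add_le_add_left (hT2 ()) _)
  · exact hS4.frame hF5 (by simp [addSentinels])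
  · intro i hi
    rw [hF5.mem cat (by simp [addSentinels]), hF4.mem cat (by simp [addSentinels]), hcat3 i hi]
  · intro i h1 h2
    rw [hF5.mem Arr.X (by simp [addSentinels]), hI4 i h1 (by simpa using h2)]
    rfl
  · intro i h1 h2
    rw [hI5 i h1 (by simpa using h2)]
    rfl

end Enum331

end MCS

namespace MCS

/-! ### The tables of next and previous occurrences, and the numbering of indices. -/

namespace Enum331

open Var Arr

variable {M W : ℕ}

theorem row_index_inj {L c c' h h' : ℕ} (hh : h ≤ L) (hh' : h' ≤ L) :
    c * (L + 1) + h = c' * (L + 1) + h' ↔ c = c' ∧ h = h' := by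
  constructor
  · intro e
    have h1 : (c * (L + 1) + h) / (L + 1) = c := by
      rw [mul_comm, Nat.mul_add_div (by omega), Nat.div_eq_of_lt (by omega), add_zero]
    have h2 : (c' * (L + 1) + h') / (L + 1) = c' := by
      rw [mul_comm, Nat.mul_add_div (by omega), Nat.div_eq_of_lt (by omega), add_zero]
    have : c = c' := by rw [← h1, e, h2]
    subst this
    exact ⟨rfl, by omega⟩
  · rintro ⟨rfl, rfl⟩; rfl

/-- The rows below `c` of a table hold the values of `f`. -/
def RowsBelow (L c : ℕ) (f : ℕ → ℕ → ℕ) (mem : ℕ → ℕ) : Prop :=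
  ∀ c' h, 1 ≤ c' → c' < c → 1 ≤ h → h ≤ L → mem (c' * (L + 1) + h) = f c' h

/-- A write into row `c` does not disturb the rows below it, because column indices do not exceed
`L`. -/
theorem RowsBelow.update {L c i v : ℕ} {f : ℕ → ℕ → ℕ} {mem mem' : ℕ → ℕ}
    (h : RowsBelow L c f mem) (hi : i ≤ L)
    (hm : ∀ k, mem' k = if k = c * (L + 1) + i then v else mem k) : RowsBelow L c f mem' := by
  intro c' k h1 h2 h3 h4
  rw [hm, if_neg, h c' k h1 h2 h3 h4]
  rw [row_index_inj h4 hi]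
  omega

/-- A row is filled by two scans during which the register `t` carries the latest occurrence met:
from left to right for prev, from right to left for next. The value is stored before the current
position is inspected, because both notions are strict. -/
theorem tableRow_spec {s : State Var Arr} (str : Arr) (l : Var) (nextT prevT : Arr) (Z : List ℕ)
    (L σ cv : ℕ) (hL : Z.length = L) (h1 : str ≠ nextT) (h2 : str ≠ prevT) (h3 : nextT ≠ prevT)
    (hl : l ∉ [Var.c, Var.t, Var.h, Var.p]) (hrl : s.reg l = L) (hc : s.reg Var.c = cv)
    (hstr : ∀ i, 1 ≤ i → i ≤ L → s.mem str i = charAt Z i) (hcv : cv ≤ σ)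
    (hM : (σ + 1) * (L + 1) ≤ M) (hW : L + 2 ≤ W)
    (hp : RowsBelow L cv (prevIdx Z) (s.mem prevT)) (hn : RowsBelow L cv (nextIdx Z) (s.mem nextT)) :
    WP M W (t ::= 0 ;;
      forRange (V := Var) (A := Arr) h 1 (l + 1)
        (Cmd.store prevT (tableAt l Var.c h) t ;;
          ifThen (.eq (str h) Var.c) (t ::= h)) ;;
      t ::= l + 1 ;;
      forRange p 0 l
        (h ::= l - p ;;
          Cmd.store nextT (tableAt l Var.c h) t ;;
          ifThen (.eq (str h) Var.c) (t ::= h))) (fun s' =>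
      s'.clock ≤ s.clock + 100 * (L + 1) ∧ RowsBelow L (cv + 1) (prevIdx Z) (s'.mem prevT) ∧
        RowsBelow L (cv + 1) (nextIdx Z) (s'.mem nextT)) s := by
  simp only [List.mem_cons, List.not_mem_nil, or_false, not_or] at hl
  obtain ⟨hlc, hlt, hlh, hlp⟩ := hl
  have hidx : ∀ i ≤ L, cv * (L + 1) + i < M := by
    intro i hi
    refine lt_of_lt_of_le ?_ hM
    have : cv * (L + 1) ≤ σ * (L + 1) := Nat.mul_le_mul_right _ hcv
    rw [add_mul]
    omega
  rw [WP.seq_iff, WP.assign_iff]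
  refine ⟨by simp, by simp, ?_⟩
  rw [WP.seq_iff]
  refine WP.forRange_uniform 1 (L + 1) 30
    (fun i reg mem => reg t = prevIdx Z cv i ∧ RowsBelow L cv (prevIdx Z) (mem prevT) ∧
      ∀ k, 1 ≤ k → k < i → mem prevT (cv * (L + 1) + k) = prevIdx Z cv k)
    (by simp) (by simp) (by omega) (by omega) ?_ ?_ ?_ ?_
  · refine ⟨?_, hp, by omega⟩
    rw [prevIdx_of_le_one le_rfl]
    simp
  · intro i s' hF _ _ _ _
    have := hF.reg l (by simp [hlh, hlt])
    simp [hlt, hrl] at this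
    simp [this]
  · rintro i s' hF hi hi1 hi2 ⟨ht, hr, hk⟩
    have hl' : s'.reg l = L := by simpa [hlt, hrl] using hF.reg l (by simp [hlh, hlt])
    have hc' : s'.reg Var.c = cv := by simpa [hc] using hF.reg Var.c (by simp)
    have hs' : s'.mem str i = charAt Z i := by
      rw [hF.mem str (by simp [h2])]
      exact hstr i hi1 (by omega)
    have hb := hidx i (by omega)
    have hiM : i < M := by nlinarith
    have htW : prevIdx Z cv i ≤ W := by
      have := prevIdx_le (W := Z) (c := cv) (h := i); omega
    have hcur : ∀ k, 1 ≤ k → k < i + 1 →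
        (if cv * (L + 1) + k = cv * (L + 1) + i then prevIdx Z cv i
          else s'.mem prevT (cv * (L + 1) + k)) = prevIdx Z cv k := by
      intro k hk1 hk2
      split_ifs with e
      · rw [show k = i by omega]
      · exact hk k hk1 (by omega)
    have hstep := prevIdx_succ (W := Z) (c := cv) hi1
    simp only [tableAt, WP.seq_iff, WP.store_iff, WP.ifThen_iff, WP.assign_iff, Expr.add_def,
      Expr.mul_def, Expr.ofNat_def, Expr.InBounds, Expr.eval, Expr.cost, Test.InBounds, Test.Holds,
      Test.cost, State.tick_reg, State.tick_mem, State.tick_clock, State.setMem_reg,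
      State.setMem_mem, State.setMem_clock, State.setReg_reg, State.setReg_mem,
      State.setReg_clock, hl', hc', hi, ht, hs', if_true, h2, if_false, reduceCtorEq]
    refine ⟨by simp, trivial, hb, htW, by simp [hiM], fun he => ?_, fun he => ?_⟩
    · refine ⟨trivial, by omega, trivial, by omega, ?_, hr.update (i := i) (v := prevIdx Z cv i) (by omega) (fun k => by simp), hcur⟩
      rw [hstep, if_pos he]
    · refine ⟨trivial, by omega, ?_, hr.update (i := i) (v := prevIdx Z cv i) (by omega) (fun k => by simp), hcur⟩
      rw [hstep, if_neg he]
  intro s1 hF1 _ hc1 ⟨_, hr1, hk1⟩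
  have hl1 : s1.reg l = L := by simpa [hlt, hrl] using hF1.reg l (by simp [hlh, hlt])
  have hcc1 : s1.reg Var.c = cv := by simpa [hc] using hF1.reg Var.c (by simp)
  have hstr1 : ∀ i, 1 ≤ i → i ≤ L → s1.mem str i = charAt Z i := by
    intro i hi1 hi2
    rw [hF1.mem str (by simp [h2])]
    exact hstr i hi1 hi2
  have hn1 : RowsBelow L cv (nextIdx Z) (s1.mem nextT) := by
    rw [hF1.mem nextT (by simp [h3])]; exact hn
  have hp1 : RowsBelow L (cv + 1) (prevIdx Z) (s1.mem prevT) := by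
    intro c' k g1 g2 g3 g4
    rcases Nat.lt_succ_iff_lt_or_eq.1 g2 with g2 | rfl
    · exact hr1 c' k g1 g2 g3 g4
    · exact hk1 k g3 (by omega)
  simp at hc1
  rw [WP.seq_iff, WP.assign_iff]
  refine ⟨by simp, by simp [hl1]; omega, ?_⟩
  -- The counter `i` stands for the index `L - i`, so the indices `L, …, 1` are treated in
  -- decreasing order.
  refine WP.forRange_uniform 0 L 30
    (fun i reg mem => reg t = nextIdx Z cv (L - i) ∧ RowsBelow L cv (nextIdx Z) (mem nextT) ∧
      ∀ k, L - i < k → k ≤ L → mem nextT (cv * (L + 1) + k) = nextIdx Z cv k)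
    (by simp) (by simp) (by omega) (by omega) ?_ ?_ ?_ ?_
  · refine ⟨?_, hn1, by omega⟩
    rw [nextIdx_of_le (by omega)]
    simp [hl1, hL]
  · intro i s' hF _ _ _ _
    have := hF.reg l (by simp [hlh, hlt, hlp])
    simp [hlt, hl1] at this
    simp [this]
  · rintro i s' hF hi hi1 hi2 ⟨ht, hr, hk⟩
    have hl' : s'.reg l = L := by simpa [hlt, hl1] using hF.reg l (by simp [hlh, hlt, hlp])
    have hc' : s'.reg Var.c = cv := by simpa [hcc1] using hF.reg Var.c (by simp)
    have hs' : s'.mem str (L - i) = charAt Z (L - i) := by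
      rw [hF.mem str (by simp [h1])]
      exact hstr1 _ (by omega) (by omega)
    have hb := hidx (L - i) (by omega)
    have hiM : L - i < M := by nlinarith
    have htW : nextIdx Z cv (L - i) ≤ W := by
      have := nextIdx_le_succ_length (W := Z) (c := cv) (h := L - i); omega
    have hcur : ∀ k, L - (i + 1) < k → k ≤ L →
        (if cv * (L + 1) + k = cv * (L + 1) + (L - i) then nextIdx Z cv (L - i)
          else s'.mem nextT (cv * (L + 1) + k)) = nextIdx Z cv k := by
      intro k hk1 hk2
      split_ifs with e
      · rw [show k = L - i by omega]
      · exact hk k (by omega) hk2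
    have hstep := nextIdx_of_lt (W := Z) (c := cv) (h := L - (i + 1)) (by omega)
    rw [show L - (i + 1) + 1 = L - i by omega] at hstep
    simp only [tableAt, WP.seq_iff, WP.store_iff, WP.ifThen_iff, WP.assign_iff, Expr.add_def,
      Expr.mul_def, Expr.sub_def, Expr.ofNat_def, Expr.InBounds, Expr.eval, Expr.cost,
      Test.InBounds, Test.Holds,
      Test.cost, State.tick_reg, State.tick_mem, State.tick_clock, State.setMem_reg,
      State.setMem_mem, State.setMem_clock, State.setReg_reg, State.setReg_mem,
      State.setReg_clock, hl', hc', hi, ht, hs', if_true, h1, hlh, if_false, reduceCtorEq]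
    refine ⟨by simp, by omega, by simp, trivial, hb, htW, by simp [hiM], fun he => ?_, fun he => ?_⟩
    · refine ⟨trivial, by omega, trivial, by omega, ?_, hr.update (i := L - i) (v := nextIdx Z cv (L - i)) (by omega) (fun k => by simp), hcur⟩
      rw [hstep, if_pos he]
    · refine ⟨trivial, by omega, ?_, hr.update (i := L - i) (v := nextIdx Z cv (L - i)) (by omega) (fun k => by simp), hcur⟩
      rw [hstep, if_neg he]
  intro s2 hF2 _ hc2 ⟨_, hr2, hk2⟩
  simp [hl1] at hc2
  refine ⟨by omega, ?_, ?_⟩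
  · rw [hF2.mem prevT (by simp [h3.symm])]; exact hp1
  · intro c' k g1 g2 g3 g4
    rcases Nat.lt_succ_iff_lt_or_eq.1 g2 with g2 | rfl
    · exact hr2 c' k g1 g2 g3 g4
    · exact hk2 k (by omega) g4

theorem buildTable_spec {s : State Var Arr} (str : Arr) (l : Var) (nextT prevT : Arr) (Z : List ℕ)
    (L σ : ℕ) (hL : Z.length = L) (h1 : str ≠ nextT) (h2 : str ≠ prevT) (h3 : nextT ≠ prevT)
    (hl : l ∉ [Var.c, Var.t, Var.h, Var.p]) (hrl : s.reg l = L) (hsg : s.reg sg = σ)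
    (hstr : ∀ i, 1 ≤ i → i ≤ L → s.mem str i = charAt Z i)
    (hM : (σ + 1) * (L + 1) ≤ M) (hW : L + 2 ≤ W) (hσ : σ + 1 ≤ W) :
    WP M W (buildTable str l nextT prevT) (fun s' =>
      s'.clock ≤ s.clock + 200 * ((σ + 1) * (L + 1)) ∧
        RowsBelow L (σ + 1) (prevIdx Z) (s'.mem prevT) ∧
        RowsBelow L (σ + 1) (nextIdx Z) (s'.mem nextT)) s := by
  have hl' := hl
  simp only [List.mem_cons, List.not_mem_nil, or_false, not_or] at hl
  obtain ⟨hlc, hlt, hlh, hlp⟩ := hl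
  unfold buildTable
  refine WP.forRange_uniform 1 (σ + 1) (100 * (L + 1))
    (fun i _ mem => RowsBelow L i (prevIdx Z) (mem prevT) ∧ RowsBelow L i (nextIdx Z) (mem nextT))
    (by simp) (by simp) (by omega) hσ ?_ ?_ ?_ ?_
  · exact ⟨fun _ _ _ _ => by omega, fun _ _ _ _ => by omega⟩
  · intro i s' hF _ _ _ _
    have := hF.reg sg (by simp)
    simp [this, hsg]
  · rintro i s' hF hi hi1 hi2 ⟨hp, hn⟩
    have hrl' : s'.reg l = L := by rw [hF.reg l (by simp [hlc, hlt, hlh, hlp]), hrl]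
    refine (tableRow_spec str l nextT prevT Z L σ i hL h1 h2 h3 hl' hrl' hi ?_ (by omega) hM hW hp
      hn).mono_frame ?_
    · intro k hk1 hk2
      rw [hF.mem str (by simp [h1, h2]), hstr k hk1 hk2]
    · rintro s'' hF' ⟨g1, g2, g3⟩
      exact ⟨by rw [hF'.reg Var.c (by simp), hi], g1, g2, g3⟩
  · rintro s' hF _ hc ⟨hp, hn⟩
    refine ⟨?_, hp, hn⟩
    simp at hc
    nlinarith

theorem indexOf_lt {n m i j d : ℕ} (hi : i ≤ n) (hj : j ≤ m) (hd : d < n + m) :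
    (i * (m + 1) + j) * (n + m) + d < numKeys n m := by
  unfold numKeys
  have h1 : i * (m + 1) + j + 1 ≤ (n + 1) * (m + 1) := by
    have := Nat.mul_le_mul_right (m + 1) hi
    rw [add_mul]
    omega
  have := Nat.mul_le_mul_right (n + m) h1
  rw [add_mul] at this
  omega

/-- A mixed-radix number: `j` and `d` are digits to the bases `m + 1` and `n + m`, and the leading
digit `i` needs no bound. -/
theorem indexOf_inj {n m i j d i' j' d' : ℕ} (hj : j ≤ m) (hd : d < n + m) (hj' : j' ≤ m)
    (hd' : d' < n + m) :
    (i * (m + 1) + j) * (n + m) + d = (i' * (m + 1) + j') * (n + m) + d' ↔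
      i = i' ∧ j = j' ∧ d = d' := by
  obtain ⟨k, hk⟩ : ∃ k, n + m = k + 1 := ⟨n + m - 1, by omega⟩
  rw [hk, row_index_inj (by omega) (by omega), row_index_inj hj hj', and_assoc]

/-- The array `row` recovers the leading digit of a key, which the output phase could not compute
directly because the machine has no division. -/
theorem initIndices_spec {s : State Var Arr} (n m : ℕ) (hlx : s.reg lx = n) (hly : s.reg ly = m)
    (hM : numKeys n m ≤ M) (hW : numKeys n m ≤ W) (hn : 2 ≤ n) (hm : 2 ≤ m) :
    WP M W initIndices (fun s' =>
      s'.clock ≤ s.clock + 100 * numKeys n m ∧ s'.reg K = numKeys n m ∧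
      ∀ i j d, i ≤ n → j ≤ m → d < n + m → s'.mem row ((i * (m + 1) + j) * (n + m) + d) = i) s := by
  have hW1 : n + m ≤ numKeys n m := Nat.le_mul_of_pos_left _ (by positivity)
  unfold initIndices
  rw [WP.seq_iff, WP.assign_iff]
  have hK : Expr.eval s (((lx : Expr Var Arr) + 1) * (ly + 1) * (lx + ly)) = numKeys n m := by
    simp [hlx, hly, numKeys]
  refine ⟨by simp, by rw [hK]; exact hW, ?_⟩
  rw [hK]
  generalize hs0 : State.tick _ _ = s0
  have hlx0 : s0.reg lx = n := by simp [← hs0, hlx]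
  have hly0 : s0.reg ly = m := by simp [← hs0, hly]
  have hK0 : s0.reg K = numKeys n m := by simp [← hs0]
  have hc0 : s0.clock ≤ s.clock + 20 := by simp [← hs0]
  clear hs0 hK
  refine WP.forRange_uniform 0 (n + 1) ((m + 1) * (60 * (n + m)))
    (fun u _ mem => ∀ i j d, i < u → j ≤ m → d < n + m →
      mem row ((i * (m + 1) + j) * (n + m) + d) = i)
    (by simp) (by simp) (by omega) (by omega) (by intro i j d h; omega) ?_ ?_ ?_
  · intro i s' hF _ _ _ _
    have := hF.reg lx (by simp)
    simp [this, hlx0]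
  · intro u s1 hF1 hu _ hun hI
    have hlx1 : s1.reg lx = n := by rw [hF1.reg lx (by simp), hlx0]
    have hly1 : s1.reg ly = m := by rw [hF1.reg ly (by simp), hly0]
    refine WP.forRange_uniform 0 (m + 1) (30 * (n + m))
      (fun v _ mem => ∀ i j d, (i < u ∨ i = u ∧ j < v) → j ≤ m → d < n + m →
        mem row ((i * (m + 1) + j) * (n + m) + d) = i)
      (by simp) (by simp) (by omega) (by omega) (fun i j d h => hI i j d (by omega)) ?_ ?_ ?_
    · intro i s' hF _ _ _ _
      have := hF.reg ly (by simp)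
      simp [this, hly1]
    · intro v s2 hF2 hv _ hvm hI
      have hlx2 : s2.reg lx = n := by rw [hF2.reg lx (by simp), hlx1]
      have hly2 : s2.reg ly = m := by rw [hF2.reg ly (by simp), hly1]
      have hu2 : s2.reg ui = u := by rw [hF2.reg ui (by simp), hu]
      refine WP.forRange_uniform 0 (n + m) 16
        (fun w _ mem => ∀ i j d, (i < u ∨ i = u ∧ (j < v ∨ j = v ∧ d < w)) → j ≤ m → d < n + m →
          mem row ((i * (m + 1) + j) * (n + m) + d) = i)
        (by simp) (by simp) (by omega) (by omega) (fun i j d h => hI i j d (by omega)) ?_ ?_ ?_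
      · intro i s' hF _ _ _ _
        have h1 := hF.reg lx (by simp)
        have h2 := hF.reg ly (by simp)
        simp [h1, h2, hlx2, hly2]
      · intro w s3 hF3 hw _ hwn hI
        have hlx3 : s3.reg lx = n := by rw [hF3.reg lx (by simp), hlx2]
        have hly3 : s3.reg ly = m := by rw [hF3.reg ly (by simp), hly2]
        have hu3 : s3.reg ui = u := by rw [hF3.reg ui (by simp), hu2]
        have hv3 : s3.reg uj = v := by rw [hF3.reg uj (by simp), hv]
        have hlt := indexOf_lt (n := n) (m := m) (i := u) (j := v) (d := w) (by omega) (by omega) hwn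
        simp only [indexOf, WP.store_iff, Expr.add_def, Expr.mul_def, Expr.ofNat_def, Expr.InBounds,
          Expr.eval, Expr.cost, State.tick_reg, State.tick_mem, State.tick_clock, State.setMem_reg,
          State.setMem_mem, State.setMem_clock, hlx3, hly3, hu3, hv3, hw,
          if_true]
        refine ⟨by simp, trivial, by omega, by omega, trivial, by omega, ?_⟩
        intro i j d h hj hd
        have e := indexOf_inj (i := i) (i' := u) (j' := v) hj hd (by omega) hwn
        split_ifs with hk
        · exact (e.1 hk).1.symm
        · rw [e] at hk
          exact hI i j d (by omega) hj hd
      · intro s3 hF3 _ hc3 hI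
        refine ⟨by rw [hF3.reg uj (by simp), hv], ?_, fun i j d h hj hd => hI i j d (by omega) hj hd⟩
        simp at hc3
        omega
    · intro s2 hF2 _ hc2 hI
      refine ⟨by rw [hF2.reg ui (by simp), hu], ?_, fun i j d h hj hd => hI i j d (by omega) hj hd⟩
      simp at hc2
      nlinarith
  · intro s1 hF1 _ hc1 hI
    refine ⟨?_, by rw [hF1.reg K (by simp), hK0], fun i j d hi => hI i j d (by omega)⟩
    simp at hc1
    have e : (n + 1) * ((m + 1) * (60 * (n + m))) = 60 * numKeys n m := by unfold numKeys; ring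
    have e2 : (n + 1) * ((m + 1) * (60 * (n + m)) + 3 + 7) = 60 * numKeys n m + 10 * n + 10 := by
      rw [← e]; ring
    omega

end Enum331

end MCS

namespace MCS

/-! ### The staircase scan that finds all `v` with `u ≺ v`. -/

namespace Enum331

open Var Arr

variable {M W : ℕ} {A B : List ℕ} {σ : ℕ}

/-- The normalized strings `A` and `B` and the tables of next and previous occurrences are in
memory. -/
structure HasTables (A B : List ℕ) (σ : ℕ) (s : State Var Arr) : Prop where
  lx : s.reg lx = A.length
  ly : s.reg ly = B.length
  X : ∀ i, 1 ≤ i → i ≤ A.length → s.mem X i = charAt A i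
  Y : ∀ i, 1 ≤ i → i ≤ B.length → s.mem Y i = charAt B i
  prevX : RowsBelow A.length (σ + 1) (prevIdx A) (s.mem prevX)
  prevY : RowsBelow B.length (σ + 1) (prevIdx B) (s.mem prevY)
  nextX : RowsBelow A.length (σ + 1) (nextIdx A) (s.mem nextX)
  nextY : RowsBelow B.length (σ + 1) (nextIdx B) (s.mem nextY)

theorem HasTables.frame {c : Cmd Var Arr} {s s' : State Var Arr} (h : HasTables A B σ s)
    (hF : Frame c s s') (hr : ∀ x ∈ [Var.lx, Var.ly], x ∉ c.regs)
    (ha : ∀ a ∈ [Arr.X, Arr.Y, Arr.prevX, Arr.prevY, Arr.nextX, Arr.nextY], a ∉ c.arrs) :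
    HasTables A B σ s' := by
  simp only [List.mem_cons, List.not_mem_nil, or_false, forall_eq_or_imp, forall_eq] at hr ha
  obtain ⟨r1, r2⟩ := hr
  obtain ⟨a1, a2, a3, a4, a5, a6⟩ := ha
  constructor
  · rw [hF.reg _ r1]; exact h.lx
  · rw [hF.reg _ r2]; exact h.ly
  · rw [hF.mem _ a1]; exact h.X
  · rw [hF.mem _ a2]; exact h.Y
  · rw [hF.mem _ a3]; exact h.prevX
  · rw [hF.mem _ a4]; exact h.prevY
  · rw [hF.mem _ a5]; exact h.nextX
  · rw [hF.mem _ a6]; exact h.nextY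

theorem HasTables.tick {s : State Var Arr} (h : HasTables A B σ s) (k : ℕ) :
    HasTables A B σ (s.tick k) := ⟨h.lx, h.ly, h.X, h.Y, h.prevX, h.prevY, h.nextX, h.nextY⟩

/-- Strings over `{1, …, σ}` whose last characters match only each other, with enough memory and
large enough words. -/
structure Fits (M W : ℕ) (A B : List ℕ) (σ : ℕ) : Prop where
  lenA : 2 ≤ A.length
  lenB : 2 ≤ B.length
  charA : ∀ i, 1 ≤ i → i ≤ A.length → 1 ≤ charAt A i ∧ charAt A i ≤ σ
  charB : ∀ i, 1 ≤ i → i ≤ B.length → 1 ≤ charAt B i ∧ charAt B i ≤ σ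
  last : ∀ u, IsMatch A B u → u.1 = A.length → u.2 = B.length
  tableA : (σ + 1) * (A.length + 1) ≤ M
  tableB : (σ + 1) * (B.length + 1) ≤ M
  keys_lt : numKeys A.length B.length < M
  keys_le : numKeys A.length B.length < W

theorem key_lt_numKeys {n m : ℕ} {w : Vertex} (h1 : w.2.1 ≤ n) (h2 : w.2.2 ≤ m) (h3 : 1 ≤ w.1.1)
    (h4 : w.1.2 ≤ m) (h5 : 1 ≤ n) : key n m w < numKeys n m :=
  indexOf_lt h1 h2 (by omega)

theorem length_add_length_le (n m : ℕ) : n + m ≤ numKeys n m :=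
  Nat.le_mul_of_pos_left _ (by positivity)

/-- The edge of `G` that is given by `u ≺ v`. -/
def mkEdge (A B : List ℕ) (u v : ℕ × ℕ) : Vertex × Vertex :=
  ((prevMatch A B (matchChar A u) v, u), (v, nextMatch A B (matchChar A v) u))

theorem edgeG_iff {p q : Vertex} : EdgeG A B p q ↔ ∃ u v, Prec A B u v ∧ (p, q) = mkEdge A B u v := by
  simp [EdgeG, mkEdge]

/-- Since `u` and `v` are components of the two endpoints, listing each pair once lists each edge
once. -/
theorem mkEdge_inj {u v u' v' : ℕ × ℕ} (h : mkEdge A B u v = mkEdge A B u' v') : u = u' ∧ v = v' := by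
  simp only [mkEdge, Prod.mk.injEq] at h
  exact ⟨h.1.2, h.2.1⟩

/-- The list of edges in memory. -/
structure HasEdges (n m : ℕ) (es : List (Vertex × Vertex)) (s : State Var Arr) : Prop where
  E : s.reg E = es.length
  src : ∀ e (h : e < es.length), s.mem src e = key n m es[e].1
  dst : ∀ e (h : e < es.length), s.mem dst e = key n m es[e].2

theorem HasEdges.frame {n m : ℕ} {es : List (Vertex × Vertex)} {c : Cmd Var Arr}
    {s s' : State Var Arr} (h : HasEdges n m es s)
    (hF : Frame c s s') (hr : Var.E ∉ c.regs) (h1 : Arr.src ∉ c.arrs) (h2 : Arr.dst ∉ c.arrs) :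
    HasEdges n m es s' := by
  constructor
  · rw [hF.reg _ hr]; exact h.E
  · rw [hF.mem _ h1]; exact h.src
  · rw [hF.mem _ h2]; exact h.dst

theorem HasEdges.tick {n m : ℕ} {es : List (Vertex × Vertex)} {s : State Var Arr}
    (h : HasEdges n m es s) (k : ℕ) : HasEdges n m es (s.tick k) := ⟨h.E, h.src, h.dst⟩

/-- Both prev and next lie between `u` and `v` coordinatewise, hence inside the strings. -/
theorem edge_mem {u v : ℕ × ℕ} (h : Prec A B u v) :
    1 ≤ (prevMatch A B (matchChar A u) v).1 ∧ (prevMatch A B (matchChar A u) v).1 ≤ A.length ∧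
    1 ≤ (prevMatch A B (matchChar A u) v).2 ∧ (prevMatch A B (matchChar A u) v).2 ≤ B.length ∧
    1 ≤ (nextMatch A B (matchChar A v) u).1 ∧ (nextMatch A B (matchChar A v) u).1 ≤ A.length ∧
    1 ≤ (nextMatch A B (matchChar A v) u).2 ∧ (nextMatch A B (matchChar A v) u).2 ≤ B.length := by
  have h1 := h.le_prevMatch
  have h2 := h.nextMatch_le
  have h3 : (prevMatch A B (matchChar A u) v).1 ≤ v.1 := prevIdx_le
  have h4 : (prevMatch A B (matchChar A u) v).2 ≤ v.2 := prevIdx_le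
  have h5 : u.1 < (nextMatch A B (matchChar A v) u).1 := lt_nextIdx h.1.2.1
  have h6 : u.2 < (nextMatch A B (matchChar A v) u).2 := lt_nextIdx h.1.2.2.2.1
  have h7 := h.1.1
  have h8 := h.1.2.2.1
  have h9 := h.2.1.2.1
  have h10 := h.2.1.2.2.2.1
  omega

theorem listEdge_spec (hf : Fits M W A B σ) {s : State Var Arr} {u v : ℕ × ℕ}
    {es : List (Vertex × Vertex)} (hT : HasTables A B σ s)
    (hE : HasEdges A.length B.length es s) (hu1 : s.reg ui = u.1) (hu2 : s.reg uj = u.2)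
    (hv1 : s.reg vi = v.1) (hv2 : s.reg vj = v.2) (huv : Prec A B u v)
    (hM : es.length < M) (hW : es.length < W) :
    WP M W listEdge (fun s' => s'.clock ≤ s.clock + 100 ∧
      HasEdges A.length B.length (es ++ [mkEdge A B u v]) s') s := by
  have hmem := edge_mem huv
  obtain ⟨⟨u1, u2, u3, u4, uc⟩, ⟨v1, v2, v3, v4, vc⟩, -, -⟩ := id huv
  have cu := hf.charA u.1 u1 u2
  have cv := hf.charA v.1 v1 v2
  have hXu := hT.X u.1 u1 u2
  have hXv := hT.X v.1 v1 v2
  have t1 := hT.prevX (charAt A u.1) v.1 cu.1 (by omega) v1 v2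
  have t2 := hT.prevY (charAt A u.1) v.2 cu.1 (by omega) v3 v4
  have t3 := hT.nextX (charAt A v.1) u.1 cv.1 (by omega) u1 u2
  have t4 := hT.nextY (charAt A v.1) u.2 cv.1 (by omega) u3 u4
  have hin : ∀ {L c h : ℕ}, c ≤ σ → h ≤ L → (σ + 1) * (L + 1) ≤ M → c * (L + 1) + h < M := by
    intro L c h hc hh hM
    have := Nat.mul_le_mul_right (L + 1) hc
    rw [add_mul] at hM
    omega
  have i1 := hin cu.2 v2 hf.tableA
  have i2 := hin cu.2 v4 hf.tableB
  have i3 := hin cv.2 u2 hf.tableA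
  have i4 := hin cv.2 u4 hf.tableB
  have hK := hf.keys_lt
  have hKW := hf.keys_le
  have hNK := length_add_length_le A.length B.length
  have k1 := key_lt_numKeys (n := A.length) (m := B.length) (w := (mkEdge A B u v).1) u2 u4
    hmem.1 hmem.2.2.2.1 (by have := hf.lenA; omega)
  have k2 := key_lt_numKeys (n := A.length) (m := B.length) (w := (mkEdge A B u v).2)
    hmem.2.2.2.2.2.1 hmem.2.2.2.2.2.2.2 v1 v4 (by have := hf.lenA; omega)
  simp only [mkEdge, prevMatch, nextMatch, matchChar, key] at hmem k1 k2
  have hu1M : u.1 < M := by omega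
  have hv1M : v.1 < M := by omega
  have hlx := hT.lx
  have hly := hT.ly
  have hE0 := hE.E
  simp only [listEdge, tableAt, keyOf, indexOf, WP.seq_iff, WP.assign_iff, WP.store_iff,
    Expr.add_def, Expr.mul_def, Expr.sub_def, Expr.ofNat_def, Expr.InBounds, Expr.eval, Expr.cost,
    State.tick_reg, State.tick_mem, State.tick_clock, State.setMem_reg,
    State.setMem_clock, State.setReg_mem, State.setReg_reg, State.setReg_clock, reduceCtorEq,
    if_true, if_false, hlx, hly, hu1, hu2, hv1, hv2, hXu, hXv, t1, t2, t3, t4, hE0, and_true,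
    true_and]
  refine ⟨⟨hu1M, i1⟩, by omega, ⟨hu1M, i2⟩, by omega, ⟨hv1M, i3⟩, by omega, ⟨hv1M, i4⟩, by omega,
    hM, by omega, hM, by omega, by omega, by omega, ?_⟩
  constructor
  · simp
  · intro e he
    simp only [List.length_append, List.length_singleton] at he
    simp only [State.tick_mem, State.setReg_mem, State.setMem_mem, reduceCtorEq, if_true, if_false]
    split_ifs with h
    · subst h
      simp [mkEdge, key, prevMatch, matchChar]
    · have := hE.src e (by omega)
      rw [this, List.getElem_append_left]
  · intro e he
    simp only [List.length_append, List.length_singleton] at he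
    simp only [State.tick_mem, State.setReg_mem, State.setMem_mem, reduceCtorEq, if_true, if_false]
    split_ifs with h
    · subst h
      simp [mkEdge, key, nextMatch, matchChar]
    · have := hE.dst e (by omega)
      rw [this, List.getElem_append_left]

/-- The loop of the procedure FindEdges(u), at `v`, has listed the edges to `vs`. -/
structure Scanned (A B : List ℕ) (u v : ℕ × ℕ) (vs : List (ℕ × ℕ)) : Prop where
  nodup : vs.Nodup
  prec : ∀ w ∈ vs, Prec A B u w ∧ (w.2 < v.2 ∨ v.1 < w.1)
  no_match : ∀ w, IsMatch A B w → Below u w → w.1 < v.1 → v.2 ≤ w.2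
  complete : ∀ w, Prec A B u w → w ∈ vs ∨ (v.2 ≤ w.2 ∧ w.1 ≤ v.1)

/-- The loop has also dealt with `v` itself. -/
structure ScannedHere (A B : List ℕ) (u v : ℕ × ℕ) (vs : List (ℕ × ℕ)) : Prop where
  nodup : vs.Nodup
  prec : ∀ w ∈ vs, Prec A B u w ∧ (w.2 < v.2 ∨ v.1 < w.1 ∨ w = v)
  no_match : ∀ w, IsMatch A B w → Below u w → w.1 < v.1 → v.2 ≤ w.2
  complete : ∀ w, Prec A B u w → w ∈ vs ∨ (v.2 ≤ w.2 ∧ w.1 ≤ v.1 ∧ w ≠ v)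
  here : IsMatch A B v → v ∈ vs

/-- By `no_match` the open rectangle between `u` and `v` is free of matches, so a match that the
scan meets needs no further test. -/
theorem Scanned.prec_of_match {u v : ℕ × ℕ} {vs : List (ℕ × ℕ)} (h : Scanned A B u v vs)
    (hu : IsMatch A B u) (hv : IsMatch A B v) (hb : Below u v) : Prec A B u v := by
  refine ⟨hu, hv, hb, ?_⟩
  rintro ⟨w, hw, h1, h2⟩
  have := h.no_match w hw h1 h2.1
  have := h2.2
  omega

theorem Scanned.append {u v : ℕ × ℕ} {vs : List (ℕ × ℕ)} (h : Scanned A B u v vs)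
    (hu : IsMatch A B u) (hv : IsMatch A B v) (hb : Below u v) :
    ScannedHere A B u v (vs ++ [v]) where
  nodup := by
    refine List.Nodup.append h.nodup (List.nodup_singleton _) ?_
    intro w hw hw'
    rw [List.mem_singleton] at hw'
    subst hw'
    have := (h.prec w hw).2
    omega
  prec w hw := by
    rcases List.mem_append.1 hw with hw | hw
    · have := h.prec w hw
      exact ⟨this.1, by tauto⟩
    · rw [List.mem_singleton] at hw
      subst hw
      exact ⟨h.prec_of_match hu hv hb, by simp⟩
  no_match := h.no_match
  complete w hw := by
    by_cases hwv : w = v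
    · left; simp [hwv]
    · rcases h.complete w hw with h1 | h1
      · left; exact List.mem_append_left _ h1
      · right; exact ⟨h1.1, h1.2, hwv⟩
  here _ := by simp

theorem Scanned.here_of_not_match {u v : ℕ × ℕ} {vs : List (ℕ × ℕ)} (h : Scanned A B u v vs)
    (hv : ¬ IsMatch A B v) : ScannedHere A B u v vs where
  nodup := h.nodup
  prec w hw := by
    have := h.prec w hw
    exact ⟨this.1, by tauto⟩
  no_match := h.no_match
  complete w hw := by
    rcases h.complete w hw with h1 | h1
    · exact .inl h1
    · refine .inr ⟨h1.1, h1.2, ?_⟩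
      rintro rfl
      exact hv hw.2.1
  here h' := absurd h' hv

/-- The scan jumps to another match in the same row. What lies to the right of it in higher rows is
no longer of interest, because the new match is strictly between `u` and anything there; and in the
row itself nothing was skipped, because prev gives the nearest occurrence. -/
theorem ScannedHere.left {u v : ℕ × ℕ} {vs : List (ℕ × ℕ)} (h : ScannedHere A B u v vs)
    (hv1 : v.1 ≤ A.length) (hv : v.2 ≤ B.length) (hu : u.2 < v.2)
    (ht : u.1 < prevIdx A (charAt B v.2) v.1) :
    Scanned A B u (prevIdx A (charAt B v.2) v.1, v.2) vs := by
  have hlt : prevIdx A (charAt B v.2) v.1 < v.1 := by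
    obtain ⟨i, h1, h2, h3⟩ := lt_prevIdx_iff.1 ht
    exact prevIdx_lt (by omega)
  have hm : IsMatch A B (prevIdx A (charAt B v.2) v.1, v.2) :=
    ⟨by simp only; omega, by simp only; omega, by simp only; omega, hv, charAt_prevIdx (by omega)⟩
  refine ⟨h.nodup, fun w hw => ⟨(h.prec w hw).1, ?_⟩, fun w h1 h2 h3 => ?_, fun w hw => ?_⟩
  · rcases (h.prec w hw).2 with h1 | h1 | rfl
    · exact .inl h1
    · exact .inr (by simp only; omega)
    · exact .inr hlt
  · exact h.no_match w h1 h2 (by simp only at h3; omega)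
  · rcases h.complete w hw with h1 | ⟨h1, h2, h3⟩
    · exact .inl h1
    · refine .inr ⟨h1, ?_⟩
      simp only
      by_contra hc
      rcases Nat.lt_or_ge v.2 w.2 with h4 | h4
      · exact hw.2.2.2 ⟨_, hm, ⟨ht, hu⟩, by simp only; omega, h4⟩
      · have e : w.2 = v.2 := by omega
        have h5 : w.1 < v.1 := by
          rcases h2.lt_or_eq with h2 | h2
          · exact h2
          · exact absurd (Prod.ext h2 e) h3
        have := le_prevIdx_of_occ (W := A) (c := charAt B v.2) hw.2.1.1 h5
          (by rw [hw.2.1.2.2.2.2, e])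
        omega

/-- If prev does not exceed `u.1`, then the row has no further match to the right of `u` and left of
`v`, so it is finished. -/
theorem ScannedHere.up {u v : ℕ × ℕ} {vs : List (ℕ × ℕ)} (h : ScannedHere A B u v vs)
    (ht : ¬ u.1 < prevIdx A (charAt B v.2) v.1) :
    Scanned A B u (v.1, v.2 + 1) vs := by
  have hno : ∀ w, IsMatch A B w → u.1 < w.1 → w.1 < v.1 → w.2 ≠ v.2 := by
    intro w hw h1 h2 h3
    exact ht (lt_prevIdx_iff.2 ⟨w.1, h1, h2, by rw [hw.2.2.2.2, h3]⟩)
  refine ⟨h.nodup, fun w hw => ⟨(h.prec w hw).1, ?_⟩, fun w h1 h2 h3 => ?_, fun w hw => ?_⟩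
  · rcases (h.prec w hw).2 with h1 | h1 | rfl
    · exact .inl (by simp only; omega)
    · exact .inr h1
    · exact .inl (by simp)
  · have h4 := h.no_match w h1 h2 h3
    have := hno w h1 h2.1 h3
    simp only
    omega
  · rcases h.complete w hw with h1 | ⟨h1, h2, h3⟩
    · exact .inl h1
    · refine .inr ⟨?_, h2⟩
      simp only
      by_contra hc
      have e : w.2 = v.2 := by omega
      have h5 : w.1 < v.1 := by
        rcases h2.lt_or_eq with h2 | h2
        · exact h2
        · exact absurd (Prod.ext h2 e) h3
      exact hno w hw.2.1 hw.2.2.1.1 h5 e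

/-- Every iteration decreases `vi` or increases `vj`, which gives at most `|A| + |B|` iterations,
each listing at most one edge. -/
theorem findEdges_spec (hf : Fits M W A B σ) {s : State Var Arr} {u : ℕ × ℕ}
    {es : List (Vertex × Vertex)} (hT : HasTables A B σ s)
    (hE : HasEdges A.length B.length es s) (hu1 : s.reg ui = u.1) (hu2 : s.reg uj = u.2)
    (hu : IsMatch A B u) (hM : es.length + A.length + B.length ≤ M)
    (hW : es.length + A.length + B.length ≤ W) :
    WP M W findEdges (fun s' => s'.clock ≤ s.clock + 300 * (A.length + B.length) ∧
      ∃ vs : List (ℕ × ℕ), vs.Nodup ∧ (∀ v, v ∈ vs ↔ Prec A B u v) ∧ vs.length ≤ A.length + B.length ∧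
        HasEdges A.length B.length (es ++ vs.map (mkEdge A B u)) s') s := by
  obtain ⟨u1, u2, u3, u4, uc⟩ := id hu
  -- The scan starts in the last column without comparing it to that of `u`. This is safe: a match
  -- in the last column is in the last row too, and then there are no rows left to scan.
  have hlast := hf.last u hu
  have hK := hf.keys_lt
  have hKW := hf.keys_le
  have hNK := length_add_length_le A.length B.length
  have hlA := hf.lenA
  have hlB := hf.lenB
  unfold findEdges
  rw [WP.seq_iff, WP.assign_iff, WP.seq_iff, WP.assign_iff]
  refine ⟨by simp, by simp [hT.lx]; omega, by simp, by simp [hu2]; omega, ?_⟩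
  generalize hs0 : State.tick _ _ = s0
  have hT0 : HasTables A B σ s0 := by
    subst hs0
    exact ⟨hT.lx, hT.ly, hT.X, hT.Y, hT.prevX, hT.prevY, hT.nextX, hT.nextY⟩
  have hE0 : HasEdges A.length B.length es s0 := by subst hs0; exact ⟨hE.E, hE.src, hE.dst⟩
  have hu10 : s0.reg ui = u.1 := by simp [← hs0, hu1]
  have hu20 : s0.reg uj = u.2 := by simp [← hs0, hu2]
  have hv10 : s0.reg vi = A.length := by simp [← hs0, hT.lx]
  have hv20 : s0.reg vj = u.2 + 1 := by simp [← hs0, hu2]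
  have hc0 : s0.clock ≤ s.clock + 6 := by simp [← hs0]
  clear hs0
  -- Here `k` bounds the number of iterations from above. It grows by one whenever `vj - vi` grows
  -- by at least one, and it bounds both the number of listed edges and the time.
  let Inv : State Var Arr → Prop := fun t => HasTables A B σ t ∧ (t.reg ui = u.1 ∧ t.reg uj = u.2) ∧
    (t.reg vi ≤ A.length ∧ u.2 < t.reg vj ∧ t.reg vj ≤ B.length + 1 ∧
      (t.reg vj ≤ B.length → u.1 < t.reg vi)) ∧
    ∃ (vs : List (ℕ × ℕ)) (k : ℕ), HasEdges A.length B.length (es ++ vs.map (mkEdge A B u)) t ∧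
      Scanned A B u (t.reg vi, t.reg vj) vs ∧ vs.length ≤ k ∧
      k + t.reg vi + u.2 + 1 ≤ t.reg vj + A.length ∧ t.clock ≤ s.clock + 6 + k * 200
  refine WP.loop Inv (fun t => t.reg vi + (B.length + 1 - t.reg vj)) ?_ ?_ ?_ ?_
  · refine ⟨hT0, ⟨hu10, hu20⟩, by omega, [], 0, by simpa using hE0, ?_, by simp, by omega, by omega⟩
    rw [hv10, hv20]
    refine ⟨List.nodup_nil, by simp, fun w _ h _ => h.2, fun w hw => .inr ?_⟩
    exact ⟨hw.2.2.1.2, hw.2.1.2.1⟩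
  · rintro t ⟨hT, -⟩
    simp
  · rintro t ⟨hT, ⟨hu1, hu2⟩, ⟨b1, b2, b3, b4⟩, vs, k, hE, hS, hk, hkk, hc⟩ ht
    have hvB : t.reg vj ≤ B.length := by
      simp [hT.ly] at ht; omega
    have hlt := b4 hvB
    have hXv := hT.X (t.reg vi) (by omega) b1
    have hYv := hT.Y (t.reg vj) (by omega) hvB
    have hmatch : charAt A (t.reg vi) = charAt B (t.reg vj) ↔ IsMatch A B (t.reg vi, t.reg vj) :=
      ⟨fun h => ⟨by simp only; omega, b1, by simp only; omega, hvB, h⟩, fun h => h.2.2.2.2⟩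
    have hlen : vs.length < A.length + B.length := by omega
    rw [WP.seq_iff]
    have key : WP M W (ifThen (.eq (Arr.X vi) (Arr.Y vj)) listEdge) (fun t' => ∃ vs' : List (ℕ × ℕ),
        HasEdges A.length B.length (es ++ vs'.map (mkEdge A B u)) t' ∧
        ScannedHere A B u (t.reg vi, t.reg vj) vs' ∧ vs'.length ≤ k + 1 ∧
        t'.clock ≤ t.clock + 120)
        (t.tick (Test.cost (Test.lt (vj : Expr Var Arr) (ly + 1)) + 1)) := by
      rw [WP.ifThen_iff]
      simp only [Test.InBounds, Test.Holds, Expr.eval, Expr.InBounds, State.tick_mem,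
        State.tick_reg, hXv, hYv, hmatch]
      refine ⟨⟨⟨trivial, by omega⟩, trivial, by omega⟩, fun hm => ?_, fun hm => ?_⟩
      · have hprec := hS.prec_of_match hu hm ⟨hlt, b2⟩
        have hlen' : (es ++ vs.map (mkEdge A B u)).length < es.length + A.length + B.length := by
          rw [List.length_append, List.length_map]; omega
        refine (listEdge_spec hf ((hT.tick _).tick _) ((hE.tick _).tick _) hu1 hu2 rfl rfl hprec
          (hlen'.trans_le hM) (hlen'.trans_le hW)).mono ?_
        rintro t' ⟨h1, h2⟩
        refine ⟨vs ++ [(t.reg vi, t.reg vj)], ?_, hS.append hu hm ⟨hlt, b2⟩, ?_, ?_⟩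
        · simpa [List.append_assoc] using h2
        · simp; omega
        · simp at h1; omega
      · refine ⟨vs, (hE.tick _).tick _, hS.here_of_not_match hm, by omega, ?_⟩
        simp
    refine key.mono_frame ?_
    rintro t' hF ⟨vs', hE', hS', hk', hc'⟩
    have hT' : HasTables A B σ t' := (hT.tick _).frame hF (by simp [listEdge]) (by simp [listEdge])
    have hu1' : t'.reg ui = u.1 := by rw [hF.reg ui (by simp [listEdge])]; exact hu1
    have hu2' : t'.reg uj = u.2 := by rw [hF.reg uj (by simp [listEdge])]; exact hu2
    have hv1' : t'.reg vi = t.reg vi := by rw [hF.reg vi (by simp [listEdge])]; rfl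
    have hv2' : t'.reg vj = t.reg vj := by rw [hF.reg vj (by simp [listEdge])]; rfl
    clear key
    generalize t.reg vi = a at *
    generalize t.reg vj = b at *
    have cb := hf.charB b (by omega) hvB
    have hY' := hT'.Y b (by omega) hvB
    have tp := hT'.prevX (charAt B b) a cb.1 (by omega) (by omega) b1
    have hidx : charAt B b * (A.length + 1) + a < M := by
      have h1 := Nat.mul_le_mul_right (A.length + 1) cb.2
      have h2 := hf.tableA
      rw [add_mul] at h2
      omega
    have hple : prevIdx A (charAt B b) a ≤ a := prevIdx_le
    have hlx' := hT'.lx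
    simp only [tableAt, WP.seq_iff, WP.assign_iff, WP.ite_iff, Expr.add_def, Expr.mul_def,
      Expr.ofNat_def, Expr.InBounds, Expr.eval, Expr.cost, Test.InBounds, Test.Holds, Test.cost,
      State.tick_reg, State.setReg_reg, reduceCtorEq, if_true,
      if_false, hu1', hv1', hv2', hY', hlx', tp, and_true, true_and]
    refine ⟨⟨by omega, hidx⟩, by omega, fun hlt' => ⟨by omega, ?_, ?_⟩, fun hnlt => ⟨by omega, ?_, ?_⟩⟩
    · have hlt2 : prevIdx A (charAt B b) a < a := prevIdx_lt (by omega)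
      refine ⟨⟨hT'.lx, hT'.ly, hT'.X, hT'.Y, hT'.prevX, hT'.prevY, hT'.nextX, hT'.nextY⟩,
        ⟨by simpa using hu1', by simpa using hu2'⟩, by simp [hv2']; omega, vs', k + 1,
        ⟨hE'.E, hE'.src, hE'.dst⟩, ?_, hk', ?_, ?_⟩
      · simpa [hv2'] using hS'.left b1 hvB b2 hlt'
      · simp [hv2']; omega
      · simp; omega
    · have hlt2 : prevIdx A (charAt B b) a < a := prevIdx_lt (by omega)
      simp; omega
    · refine ⟨⟨hT'.lx, hT'.ly, hT'.X, hT'.Y, hT'.prevX, hT'.prevY, hT'.nextX, hT'.nextY⟩,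
        ⟨by simpa using hu1', by simpa using hu2'⟩, by simp [hv1']; omega, vs', k + 1,
        ⟨hE'.E, hE'.src, hE'.dst⟩, ?_, hk', ?_, ?_⟩
      · simpa [hv1'] using hS'.up hnlt
      · simp [hv1']; omega
      · simp; omega
    · simp; omega
  · rintro t ⟨hT, ⟨hu1, hu2⟩, ⟨b1, b2, b3, b4⟩, vs, k, hE, hS, hk, hkk, hc⟩ ht
    have hvB : t.reg vj = B.length + 1 := by
      simp [hT.ly] at ht; omega
    refine ⟨?_, vs, hS.nodup, fun v => ⟨fun hv => (hS.prec v hv).1, fun hv => ?_⟩, by omega,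
      hE.tick _⟩
    · simp; omega
    · rcases hS.complete v hv with h1 | ⟨h1, h2⟩
      · exact h1
      · have := hv.2.1.2.2.2.1
        simp only at h1
        omega

end Enum331

end MCS

namespace MCS

/-! ### Listing all edges of `G`. -/

namespace Enum331

open Var Arr

variable {M W : ℕ} {A B : List ℕ} {σ : ℕ}

/-- A state with the given registers and arrays. -/
def bareState (reg : Var → ℕ) (mem : Arr → ℕ → ℕ) : State Var Arr := ⟨reg, mem, 0, [], []⟩

/-- `es` lists the edges of `G` that are given by the `u ≺ v` where `u` satisfies `P`. -/
structure ListsEdges (A B : List ℕ) (P : ℕ × ℕ → Prop) (es : List (Vertex × Vertex)) : Prop where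
  nodup : es.Nodup
  mem_iff : ∀ e, e ∈ es ↔ ∃ u v, P u ∧ Prec A B u v ∧ e = mkEdge A B u v

theorem ListsEdges.congr {P Q : ℕ × ℕ → Prop} {es : List (Vertex × Vertex)}
    (h : ListsEdges A B P es) (hPQ : ∀ u, IsMatch A B u → (P u ↔ Q u)) : ListsEdges A B Q es := by
  refine ⟨h.nodup, fun e => (h.mem_iff e).trans ?_⟩
  refine exists_congr fun u => exists_congr fun v => ?_
  constructor
  · rintro ⟨h1, h2, h3⟩; exact ⟨(hPQ u h2.1).1 h1, h2, h3⟩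
  · rintro ⟨h1, h2, h3⟩; exact ⟨(hPQ u h2.1).2 h1, h2, h3⟩

theorem ListsEdges.append {P Q : ℕ × ℕ → Prop} {es : List (Vertex × Vertex)} {u : ℕ × ℕ}
    {vs : List (ℕ × ℕ)} (h : ListsEdges A B P es) (hvs : vs.Nodup)
    (hmem : ∀ v, v ∈ vs ↔ Prec A B u v) (hu : ¬ P u) (hQ : ∀ w, Q w ↔ P w ∨ w = u) :
    ListsEdges A B Q (es ++ vs.map (mkEdge A B u)) where
  nodup := by
    refine List.Nodup.append h.nodup (hvs.map fun v w e => (mkEdge_inj e).2) ?_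
    intro e h1 h2
    obtain ⟨u', v', h3, -, rfl⟩ := (h.mem_iff e).1 h1
    obtain ⟨v, -, e⟩ := List.mem_map.1 h2
    exact hu ((mkEdge_inj e).1 ▸ h3)
  mem_iff e := by
    simp only [List.mem_append, h.mem_iff, List.mem_map, hmem, hQ]
    constructor
    · rintro (⟨u', v, h1, h2, rfl⟩ | ⟨v, h1, rfl⟩)
      · exact ⟨u', v, .inl h1, h2, rfl⟩
      · exact ⟨u, v, .inr rfl, h1, rfl⟩
    · rintro ⟨u', v, h1 | rfl, h2, rfl⟩
      · exact .inl ⟨u', v, h1, h2, rfl⟩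
      · exact .inr ⟨v, h2, rfl⟩

/-- `u` precedes `(i, j)` lexicographically. -/
def LexBefore (i j : ℕ) (u : ℕ × ℕ) : Prop := u.1 < i ∨ u.1 = i ∧ u.2 < j

theorem listEdges_spec (hf : Fits M W A B σ) {s : State Var Arr} (hT : HasTables A B σ s) :
    WP M W listEdges (fun s' =>
      s'.clock ≤ s.clock + 400 * numKeys A.length B.length ∧
      ∃ es : List (Vertex × Vertex), es.Nodup ∧ (∀ e, e ∈ es ↔ EdgeG A B e.1 e.2) ∧
        es.length ≤ numKeys A.length B.length ∧ HasEdges A.length B.length es s') s := by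
  obtain ⟨N, hN⟩ : ∃ N, N = A.length + B.length := ⟨_, rfl⟩
  have hlA := hf.lenA
  have hlB := hf.lenB
  have hAW : A.length + 1 ≤ W := by
    have := hf.keys_le; have := length_add_length_le A.length B.length; omega
  have hBW : B.length + 1 ≤ W := by
    have := hf.keys_le; have := length_add_length_le A.length B.length; omega
  -- After `i` complete rows and `j` more pairs, at most `(i * |B| + j) * N` edges have been listed,
  -- and one more batch of `N` still stays within the number of keys.
  have hKN : ∀ i j, i ≤ A.length → j ≤ B.length → (i * B.length + j) * N + N ≤
      numKeys A.length B.length := by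
    intro i j hi hj
    have h1 : i * B.length + j + 1 ≤ (A.length + 1) * (B.length + 1) := by
      have := Nat.mul_le_mul_right B.length hi
      rw [add_mul]
      nlinarith
    have := Nat.mul_le_mul_right N h1
    unfold numKeys
    rw [← hN]
    linarith
  unfold listEdges
  rw [WP.seq_iff, WP.assign_iff]
  refine ⟨by simp, by simp, ?_⟩
  generalize hs0 : State.tick _ _ = s0
  have hT0 : HasTables A B σ s0 := by
    subst hs0
    exact ⟨hT.lx, hT.ly, hT.X, hT.Y, hT.prevX, hT.prevY, hT.nextX, hT.nextY⟩
  have hE0 : s0.reg E = 0 := by simp [← hs0]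
  have hc0 : s0.clock ≤ s.clock + 2 := by simp [← hs0]
  clear hs0
  -- The invariant sees only registers and arrays, whereas `HasEdges` speaks of states; `bareState`
  -- bridges the two.
  refine WP.forRange_uniform 1 (A.length + 1) ((B.length + 1) * (320 * N))
    (fun i reg mem => ∃ es : List (Vertex × Vertex), ListsEdges A B (LexBefore i 1) es ∧
      es.length ≤ ((i - 1) * B.length) * N ∧
      HasEdges A.length B.length es (bareState reg mem))
    (by simp) (by simp) (by omega) (by omega) ?_ ?_ ?_ ?_
  · refine ⟨[], ⟨List.nodup_nil, fun e => ?_⟩, by simp, by simp [bareState, hE0], by simp, by simp⟩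
    simp only [List.not_mem_nil, false_iff]
    rintro ⟨u, v, h1, h2, -⟩
    have := h2.1.1
    have := h2.1.2.2.1
    rcases h1 with h1 | h1 <;> omega
  · intro i s' hF _ _ _ _
    have := hF.reg lx (by simp [findEdges, listEdge])
    simp [this, hT0.lx]
  · rintro i s1 hF1 hi hi1 hi2 ⟨es1, hes1, hl1, hE1⟩
    have hT1 := hT0.frame hF1 (by simp [findEdges, listEdge]) (by simp [findEdges, listEdge])
    refine WP.forRange_uniform 1 (B.length + 1) (300 * N + 20)
      (fun j reg mem => ∃ es : List (Vertex × Vertex), ListsEdges A B (LexBefore i j) es ∧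
        es.length ≤ ((i - 1) * B.length + (j - 1)) * N ∧
        HasEdges A.length B.length es (bareState reg mem))
      (by simp) (by simp) (by omega) (by omega) ?_ ?_ ?_ ?_
    · refine ⟨es1, hes1, by simpa using hl1, ?_, hE1.src, hE1.dst⟩
      have := hE1.E
      simpa [bareState] using this
    · intro i s' hF _ _ _ _
      have := hF.reg ly (by simp [findEdges, listEdge])
      simp [this, hT1.ly]
    · rintro j s2 hF2 hj hj1 hj2 ⟨es2, hes2, hl2, hE2⟩
      have hT2 := hT1.frame hF2 (by simp [findEdges, listEdge]) (by simp [findEdges, listEdge])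
      have hi' : s2.reg ui = i := by rw [hF2.reg ui (by simp [findEdges, listEdge]), hi]
      have hXi := hT2.X i hi1 (by omega)
      have hYj := hT2.Y j hj1 (by omega)
      have hroom := hKN (i - 1) (j - 1) (by omega) (by omega)
      have hMl := hf.keys_lt
      have hWl := hf.keys_le
      have hNK := length_add_length_le A.length B.length
      have hnext : ((i - 1) * B.length + (j + 1 - 1)) * N =
          ((i - 1) * B.length + (j - 1)) * N + N := by
        rw [show j + 1 - 1 = (j - 1) + 1 by omega, ← add_assoc, add_mul _ 1, one_mul]
      rw [WP.ifThen_iff]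
      simp only [Test.InBounds, Expr.InBounds, Test.Holds, Expr.eval, hi', hj, hXi, hYj]
      refine ⟨⟨⟨trivial, by omega⟩, trivial, by omega⟩, fun hm => ?_, fun hm => ?_⟩
      · have hu : IsMatch A B (i, j) := ⟨hi1, by simp only; omega, hj1, by simp only; omega, hm⟩
        have hE2' : HasEdges A.length B.length es2 s2 := ⟨hE2.E, hE2.src, hE2.dst⟩
        refine (findEdges_spec (u := (i, j)) hf (hT2.tick _) (hE2'.tick _) hi' hj hu (by omega)
          (by omega)).mono_frame ?_
        rintro s3 hF3 ⟨hc3, vs, h1, h2, h3, h4⟩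
        refine ⟨by rw [hF3.reg uj (by simp [findEdges, listEdge])]; exact hj, ?_,
          es2 ++ vs.map (mkEdge A B (i, j)), hes2.append h1 h2 ?_ ?_, ?_, ?_⟩
        · simp at hc3; omega
        · simp [LexBefore]
        · intro w
          simp only [LexBefore, Prod.ext_iff]
          omega
        · rw [List.length_append, List.length_map]; omega
        · refine ⟨?_, h4.src, h4.dst⟩
          have := h4.E
          simpa [bareState] using this
      -- A pair that is not a match is the lower end of no `≺`, so it may be counted as treated.
      · refine ⟨hj, by simp, es2, hes2.congr ?_, by omega, ?_, hE2.src, hE2.dst⟩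
        · intro u hu
          have hne : u ≠ (i, j) := by rintro rfl; exact hm hu.2.2.2.2
          simp only [LexBefore, ne_eq, Prod.ext_iff] at hne ⊢
          omega
        · have := hE2.E
          simpa [bareState] using this
    · rintro s2 hF2 _ hc2 ⟨es2, hes2, hl2, hE2⟩
      refine ⟨by rw [hF2.reg ui (by simp [findEdges, listEdge])]; exact hi, ?_, es2,
        hes2.congr ?_, ?_, ?_, hE2.src, hE2.dst⟩
      · simp at hc2
        nlinarith
      · intro u hu
        have := hu.2.2.2.1
        have := hu.2.2.1
        simp only [LexBefore]
        omega
      · have e : i + 1 - 1 = (i - 1) + 1 := by omega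
        rw [e, add_mul, one_mul]
        simpa using hl2
      · have := hE2.E
        simpa [bareState] using this
  · rintro s1 hF1 _ hc1 ⟨es, hes, hl, hE⟩
    refine ⟨?_, es, hes.nodup, fun e => ?_, ?_, ⟨hE.E, hE.src, hE.dst⟩⟩
    · simp at hc1
      have e : A.length * ((B.length + 1) * (320 * N)) + (B.length + 1) * (320 * N) =
          320 * numKeys A.length B.length := by unfold numKeys; rw [← hN]; ring
      have e2 : A.length * ((B.length + 1) * (320 * N) + 3 + 7) =
          A.length * ((B.length + 1) * (320 * N)) + 10 * A.length := by ring
      have h2 := length_add_length_le A.length B.length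
      have h3 : 4 * 3 ≤ (B.length + 1) * (320 * N) := Nat.mul_le_mul (by omega) (by omega) |>.trans'
        (by norm_num : 4 * 3 ≤ 3 * 4)
      omega
    · rw [hes.mem_iff, edgeG_iff]
      refine exists_congr fun u => exists_congr fun v => ?_
      constructor
      · rintro ⟨-, h2, h3⟩; exact ⟨h2, h3⟩
      · rintro ⟨h2, h3⟩
        have := h2.1.2.1
        exact ⟨.inl (by omega), h2, h3⟩
    · have := hKN A.length 0 le_rfl (by omega)
      simp only [Nat.add_sub_cancel, add_zero] at hl this
      omega

end Enum331

end MCS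

namespace MCS

/-! ### Counting sort of the edges into arrays of sequences. -/

namespace Enum331

open Var Arr

variable {M W : ℕ}

/-- The number of entries with key `k`. -/
def keyCount (kvs : List (ℕ × ℕ)) (k : ℕ) : ℕ := kvs.countP (fun e => e.1 = k)

/-- The number of entries with keys less than `k`. -/
def keyOffset (kvs : List (ℕ × ℕ)) (k : ℕ) : ℕ := kvs.countP (fun e => e.1 < k)

theorem keyOffset_zero (kvs : List (ℕ × ℕ)) : keyOffset kvs 0 = 0 := by simp [keyOffset]

theorem keyOffset_succ (kvs : List (ℕ × ℕ)) (k : ℕ) :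
    keyOffset kvs (k + 1) = keyOffset kvs k + keyCount kvs k := by
  induction kvs with
  | nil => rfl
  | cons e kvs ih =>
    simp only [keyOffset, keyCount, List.countP_cons, decide_eq_true_eq] at ih ⊢
    rw [ih]
    split_ifs <;> omega

theorem keyOffset_mono (kvs : List (ℕ × ℕ)) {k l : ℕ} (h : k ≤ l) :
    keyOffset kvs k ≤ keyOffset kvs l := by
  refine List.countP_mono_left fun e _ he => ?_
  simp only [decide_eq_true_eq] at he ⊢
  omega

theorem keyOffset_le_length (kvs : List (ℕ × ℕ)) (k : ℕ) : keyOffset kvs k ≤ kvs.length :=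
  List.countP_le_length

theorem keyCount_append (l l' : List (ℕ × ℕ)) (k : ℕ) :
    keyCount (l ++ l') k = keyCount l k + keyCount l' k := List.countP_append

theorem keyCount_singleton (e : ℕ × ℕ) (k : ℕ) :
    keyCount [e] k = if e.1 = k then 1 else 0 := by
  simp [keyCount, List.countP_cons]

/-- Entry `i` itself is not yet counted in the first `i` entries, so its block still has a free
cell. -/
theorem keyCount_take_lt {kvs : List (ℕ × ℕ)} {i : ℕ} (hi : i < kvs.length) :
    keyCount (kvs.take i) kvs[i].1 < keyCount kvs kvs[i].1 := by
  have h : keyCount (kvs.take (i + 1)) kvs[i].1 ≤ keyCount kvs kvs[i].1 :=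
    (List.take_sublist _ _).countP_le
  rw [List.take_succ_eq_append_getElem hi, keyCount_append, keyCount_singleton, if_pos rfl] at h
  omega

theorem keyCount_take_le (kvs : List (ℕ × ℕ)) (i k : ℕ) :
    keyCount (kvs.take i) k ≤ keyCount kvs k := (List.take_sublist _ _).countP_le

/-- The offsets and elements of an array of sequences: the sequence with index `k < K` consists of
the values of the entries with key `k`. -/
structure StoresSeqs (K : ℕ) (kvs : List (ℕ × ℕ)) (offs seqs : ℕ → ℕ) : Prop where
  offs : ∀ k ≤ K, offs k = keyOffset kvs k
  seqs : ∀ k < K, (List.range' (keyOffset kvs k) (keyCount kvs k)).map seqs =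
    (kvs.filter (fun e => e.1 = k)).map Prod.snd

/-- The blocks of different keys are disjoint intervals and the written cell lies inside the block
of its own key; within that block it is the first free cell, so nothing stored is overwritten and
the value is appended. -/
theorem seqs_insert {kvs : List (ℕ × ℕ)} {seqs seqs' : ℕ → ℕ} {i k : ℕ} (hi : i < kvs.length)
    (h : ∀ k, (List.range' (keyOffset kvs k) (keyCount (kvs.take i) k)).map seqs =
      ((kvs.take i).filter (fun e => e.1 = k)).map Prod.snd)
    (hs : ∀ j, seqs' j = if j = keyOffset kvs kvs[i].1 + keyCount (kvs.take i) kvs[i].1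
      then kvs[i].2 else seqs j) :
    (List.range' (keyOffset kvs k) (keyCount (kvs.take (i + 1)) k)).map seqs' =
      ((kvs.take (i + 1)).filter (fun e => e.1 = k)).map Prod.snd := by
  have hlt := keyCount_take_lt hi
  have hsame : (List.range' (keyOffset kvs k) (keyCount (kvs.take i) k)).map seqs' =
      (List.range' (keyOffset kvs k) (keyCount (kvs.take i) k)).map seqs := by
    refine List.map_congr_left fun j hj => ?_
    rw [hs, if_neg]
    rw [List.mem_range'_1] at hj
    have h1 := keyCount_take_le kvs i k
    have h2 := keyOffset_succ kvs k
    have h3 := keyOffset_succ kvs kvs[i].1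
    rcases lt_trichotomy k kvs[i].1 with hk | hk | hk
    · have := keyOffset_mono kvs (Nat.succ_le_of_lt hk)
      simp only [Nat.succ_eq_add_one] at this
      omega
    · rw [← hk]; omega
    · have := keyOffset_mono kvs (Nat.succ_le_of_lt hk)
      simp only [Nat.succ_eq_add_one] at this
      omega
  rw [List.take_succ_eq_append_getElem hi, keyCount_append, keyCount_singleton, List.filter_append,
    List.map_append, ← h k, ← hsame]
  by_cases hk : kvs[i].1 = k
  · rw [if_pos hk, List.range'_concat, List.map_append]
    congr 1
    simp [hk, hs]
  · simp [hk]

/-- The count for key `k` is stored in cell `k + 1`, so that summing in place turns the counts into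
the offsets, beginning with 0. A second copy of the offsets in `cur` serves as the write positions.
-/
theorem buildSeqs_spec {s : State Var Arr} (key val offs seqs : Arr) (n : ℕ) (kvs : List (ℕ × ℕ))
    (h1 : key ∉ [offs, seqs, Arr.cur]) (h2 : val ∉ [offs, seqs, Arr.cur]) (h3 : offs ≠ seqs)
    (h4 : offs ≠ Arr.cur) (h5 : seqs ≠ Arr.cur)
    (hK : s.reg K = n) (hE : s.reg E = kvs.length)
    (hkey : ∀ e (h : e < kvs.length), s.mem key e = kvs[e].1)
    (hval : ∀ e (h : e < kvs.length), s.mem val e = kvs[e].2)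
    (hn : ∀ e ∈ kvs, e.1 < n) (hv : ∀ e ∈ kvs, e.2 ≤ W)
    (hM : n < M) (hW : n < W) (hlM : kvs.length ≤ M) (hlW : kvs.length ≤ W) :
    WP M W (buildSeqs key val offs seqs) (fun s' =>
      s'.clock ≤ s.clock + 100 * (n + kvs.length + 1) ∧
      StoresSeqs n kvs (s'.mem offs) (s'.mem seqs)) s := by
  simp only [List.mem_cons, List.not_mem_nil, or_false, not_or] at h1 h2
  obtain ⟨k1, k2, k3⟩ := h1
  obtain ⟨v1, v2, v3⟩ := h2
  have hkn : ∀ e (h : e < kvs.length), kvs[e].1 < n := fun e h => hn _ (List.getElem_mem h)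
  have hcl : ∀ l k, keyCount l k ≤ l.length := fun _ _ => List.countP_le_length
  unfold buildSeqs
  rw [WP.seq_iff]
  refine WP.forRange_uniform 0 (n + 1) 4 (fun i _ mem => ∀ k < i, mem offs k = 0)
    (by simp) (by simp) (by omega) (by omega) (by simp) ?_ ?_ ?_
  · intro i s' hF _ _ _ _
    have := hF.reg K (by simp)
    simp [this, hK]
  · intro i s' hF hi _ hi2 hI
    simp [hi]
    refine ⟨by omega, fun k hk => ?_⟩
    exact fun hk' => hI k (by omega)
  intro s1 hF1 _ hc1 hI1
  simp at hc1
  have hK1 : s1.reg K = n := by rw [hF1.reg K (by simp), hK]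
  have hE1 : s1.reg E = kvs.length := by rw [hF1.reg E (by simp), hE]
  have hkey1 : s1.mem key = s.mem key := hF1.mem key (by simp [k1])
  have hval1 : s1.mem val = s.mem val := hF1.mem val (by simp [v1])
  rw [WP.seq_iff]
  refine WP.forRange_uniform 0 kvs.length 20
    (fun i _ mem => mem offs 0 = 0 ∧ ∀ k < n, mem offs (k + 1) = keyCount (kvs.take i) k)
    (by simp) (by simp) (by omega) (by omega)
    ⟨hI1 0 (by omega), fun k hk => by rw [hI1 _ (by omega)]; simp [keyCount]⟩ ?_ ?_ ?_
  · intro i s' hF _ _ _ _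
    have := hF.reg E (by simp)
    simp [this, hE1]
  · rintro i s' hF hi _ hi2 ⟨hI0, hI⟩
    have hk : s'.mem key i = kvs[i].1 := by rw [hF.mem key (by simp [k1]), hkey1, hkey i hi2]
    have hb := hkn i hi2
    have hle := hcl (kvs.take i) kvs[i].1
    simp only [List.length_take] at hle
    have hIk := hI _ hb
    simp only [WP.store_iff, Expr.add_def, Expr.ofNat_def, Expr.InBounds, Expr.eval, Expr.cost,
      State.tick_reg, State.setMem_reg, State.tick_clock, State.setMem_clock, State.tick_mem,
      State.setMem_mem, hi, hk, hIk, if_true, and_true, true_and]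
    refine ⟨by omega, by omega, by omega, by omega, by omega, by simpa using hI0, fun k hkn => ?_⟩
    rw [List.take_succ_eq_append_getElem hi2, keyCount_append, keyCount_singleton, hI k hkn]
    split_ifs <;> first | omega | simp_all
  rintro s2 hF2 _ hc2 ⟨hI0, hI2⟩
  simp at hc2
  rw [List.take_length] at hI2
  have hK2 : s2.reg K = n := by rw [hF2.reg K (by simp), hK1]
  have hE2 : s2.reg E = kvs.length := by rw [hF2.reg E (by simp), hE1]
  have hkey2 : s2.mem key = s.mem key := (hF2.mem key (by simp [k1])).trans hkey1
  have hval2 : s2.mem val = s.mem val := (hF2.mem val (by simp [v1])).trans hval1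
  rw [WP.seq_iff]
  refine WP.forRange_uniform 0 n 20
    (fun i _ mem => (∀ k ≤ i, mem offs k = keyOffset kvs k) ∧
      ∀ k, i ≤ k → k < n → mem offs (k + 1) = keyCount kvs k)
    (by simp) (by simp) (by omega) (by omega)
    ⟨fun k hk => ?_, fun k _ hk => hI2 k hk⟩ ?_ ?_ ?_
  · obtain rfl : k = 0 := by omega
    rw [keyOffset_zero]; exact hI0
  · intro i s' hF _ _ _ _
    have := hF.reg K (by simp)
    simp [this, hK2]
  · rintro i s' hF hi _ hi2 ⟨hI, hI'⟩
    have e1 := hI i le_rfl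
    have e2 := hI' i le_rfl hi2
    have e3 := keyOffset_succ kvs i
    have e4 := keyOffset_le_length kvs (i + 1)
    simp only [WP.store_iff, Expr.add_def, Expr.ofNat_def, Expr.InBounds, Expr.eval, Expr.cost,
      State.tick_reg, State.setMem_reg, State.tick_clock, State.setMem_clock, State.tick_mem,
      State.setMem_mem, hi, e1, e2, if_true, and_true, true_and]
    refine ⟨by omega, by omega, by omega, by omega, fun k hk => ?_, fun k hk1 hk2 => ?_⟩
    · split_ifs with h
      · rw [h]; omega
      · exact hI k (by omega)
    · rw [if_neg (by omega)]; exact hI' k (by omega) hk2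
  rintro s3 hF3 _ hc3 ⟨hI3, -⟩
  simp at hc3
  have hK3 : s3.reg K = n := by rw [hF3.reg K (by simp), hK2]
  have hE3 : s3.reg E = kvs.length := by rw [hF3.reg E (by simp), hE2]
  have hkey3 : s3.mem key = s.mem key := (hF3.mem key (by simp [k1])).trans hkey2
  have hval3 : s3.mem val = s.mem val := (hF3.mem val (by simp [v1])).trans hval2
  rw [WP.seq_iff]
  refine WP.forRange_uniform 0 n 10
    (fun i _ mem => ∀ k < i, mem cur k = keyOffset kvs k)
    (by simp) (by simp) (by omega) (by omega) (by simp) ?_ ?_ ?_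
  · intro i s' hF _ _ _ _
    have := hF.reg K (by simp)
    simp [this, hK3]
  · intro i s' hF hi _ hi2 hI
    have e1 : s'.mem offs i = keyOffset kvs i := by
      rw [hF.mem offs (by simp [h4]), hI3 i (by omega)]
    have e4 := keyOffset_le_length kvs i
    simp only [WP.store_iff, Expr.InBounds, Expr.eval, Expr.cost,
      State.tick_reg, State.setMem_reg, State.tick_clock, State.setMem_clock, State.tick_mem,
      State.setMem_mem, hi, e1, if_true, true_and]
    refine ⟨by omega, by omega, by omega, by omega, fun k hk => ?_⟩
    split_ifs with h
    · rw [h]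
    · exact hI k (by omega)
  intro s4 hF4 _ hc4 hI4
  simp at hc4
  have hE4 : s4.reg E = kvs.length := by rw [hF4.reg E (by simp), hE3]
  have hkey4 : s4.mem key = s.mem key := (hF4.mem key (by simp [k3])).trans hkey3
  have hval4 : s4.mem val = s.mem val := (hF4.mem val (by simp [v3])).trans hval3
  have hoffs4 : s4.mem offs = s3.mem offs := hF4.mem offs (by simp [h4])
  refine WP.forRange_uniform 0 kvs.length 30
    (fun i _ mem => (∀ k < n, mem cur k = keyOffset kvs k + keyCount (kvs.take i) k) ∧
      ∀ k, (List.range' (keyOffset kvs k) (keyCount (kvs.take i) k)).map (mem seqs) =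
        ((kvs.take i).filter (fun e => e.1 = k)).map Prod.snd)
    (by simp) (by simp) (by omega) (by omega)
    ⟨fun k hk => by rw [hI4 _ hk]; simp [keyCount], fun k => by simp [keyCount]⟩ ?_ ?_ ?_
  · intro i s' hF _ _ _ _
    have := hF.reg E (by simp)
    simp [this, hE4]
  · rintro i s' hF hi _ hi2 ⟨hI, hI'⟩
    have hk : s'.mem key i = kvs[i].1 := by rw [hF.mem key (by simp [k2, k3]), hkey4, hkey i hi2]
    have hvv : s'.mem val i = kvs[i].2 := by rw [hF.mem val (by simp [v2, v3]), hval4, hval i hi2]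
    have hb := hkn i hi2
    have hvW := hv _ (List.getElem_mem hi2)
    have hIk := hI _ hb
    have hlt := keyCount_take_lt hi2
    have e3 := keyOffset_succ kvs kvs[i].1
    have e4 := keyOffset_le_length kvs (kvs[i].1 + 1)
    simp only [WP.seq_iff, WP.store_iff, Expr.add_def, Expr.ofNat_def, Expr.InBounds, Expr.eval,
      Expr.cost, State.tick_reg, State.setMem_reg, State.tick_clock, State.setMem_clock,
      State.tick_mem, State.setMem_mem, hi, hk, hvv, hIk, h5.symm, k2, if_false, and_true, true_and]
    refine ⟨by omega, by omega, by omega, hvW, by omega, by omega, by omega, by omega, by omega,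
      fun k hkn => ?_, fun k => ?_⟩
    · rw [List.take_succ_eq_append_getElem hi2, keyCount_append, keyCount_singleton, hI k hkn]
      rw [if_pos trivial]
      by_cases hke : k = kvs[i].1
      · rw [if_pos hke, if_pos hke.symm, hke]; omega
      · rw [if_neg hke, if_neg (Ne.symm hke)]; omega
    · exact seqs_insert hi2 hI' fun j => by
        rw [State.setMem_mem, if_neg h5, State.tick_mem, State.setMem_mem, if_pos rfl]
  rintro s5 hF5 _ hc5 ⟨-, hI5⟩
  simp at hc5
  refine ⟨by omega, fun k hk => ?_, fun k hk => ?_⟩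
  · rw [hF5.mem offs (by simp [h3, h4]), hoffs4, hI3 k hk]
  · have := hI5 k
    rwa [List.take_length] at this

end Enum331

end MCS

namespace MCS

/-! ### Breadth-first search and filtering of the edges. -/

namespace Enum331

open Var Arr

variable {M W : ℕ}

theorem StoresSeqs.mem_iff {n k w : ℕ} {kvs : List (ℕ × ℕ)} {offs seqs : ℕ → ℕ}
    (h : StoresSeqs n kvs offs seqs) (hk : k < n) :
    (k, w) ∈ kvs ↔ ∃ p, offs k ≤ p ∧ p < offs (k + 1) ∧ seqs p = w := by
  have h1 : (k, w) ∈ kvs ↔ w ∈ (kvs.filter (fun e => e.1 = k)).map Prod.snd := by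
    simp only [List.mem_map, List.mem_filter, decide_eq_true_eq]
    constructor
    · exact fun h => ⟨_, ⟨h, rfl⟩, rfl⟩
    · rintro ⟨⟨a, b⟩, ⟨h, rfl⟩, rfl⟩
      exact h
  rw [h1, ← h.seqs k hk, h.offs k hk.le, h.offs (k + 1) hk, keyOffset_succ]
  simp only [List.mem_map, List.mem_range'_1, and_assoc]

/-- This makes the search linear: each key enters the queue at most once, so the costs of the visits
add up to the numbers of edges and keys. -/
theorem sum_keyCount_le (kvs : List (ℕ × ℕ)) {n : ℕ} {l : List ℕ} (hl : l.Nodup)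
    (hn : ∀ k ∈ l, k < n) : (l.map (fun k => keyCount kvs k + 1)).sum ≤ kvs.length + n := by
  have h1 : ∀ n, ∑ k ∈ Finset.range n, (keyCount kvs k + 1) = keyOffset kvs n + n := by
    intro n
    induction n with
    | zero => simp [keyOffset_zero]
    | succ n ih => rw [Finset.sum_range_succ, ih, keyOffset_succ]; omega
  rw [← List.sum_toFinset _ hl]
  refine (Finset.sum_le_sum_of_subset (t := Finset.range n) fun k hk => ?_).trans ?_
  · simpa using hn k (by simpa using hk)
  · rw [h1]
    have := keyOffset_le_length kvs n
    omega

/-- The queue `q` of the breadth-first search from `st`. -/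
structure Searched (n st : ℕ) (kvs : List (ℕ × ℕ)) (q : List ℕ) (reg : Var → ℕ)
    (mem : Arr → ℕ → ℕ) : Prop where
  nodup : q.Nodup
  lt : ∀ k ∈ q, k < n
  head : st ∈ q
  reach : ∀ k ∈ q, Relation.ReflTransGen (fun k w => (k, w) ∈ kvs) st k
  qt : reg qt = q.length
  queue : ∀ i (h : i < q.length), mem queue i = q[i]
  mark : ∀ k < n, mem mark k = if k ∈ q then 1 else 0

/-- By the pigeonhole principle an unmarked key leaves room in the queue, so the queue never
overflows its array. -/
theorem Searched.length_lt {n st w : ℕ} {kvs : List (ℕ × ℕ)} {q : List ℕ} {reg : Var → ℕ}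
    {mem : Arr → ℕ → ℕ} (h : Searched n st kvs q reg mem) (hw : w < n) (hwq : w ∉ q) :
    q.length < n := by
  have : (w :: q).Nodup := List.nodup_cons.2 ⟨hwq, h.nodup⟩
  have h2 := (this.subperm (l₂ := List.range n) fun k hk => by
    rcases List.mem_cons.1 hk with rfl | hk
    · simpa using hw
    · simpa using h.lt k hk).length_le
  simpa using h2

theorem Searched.length_le {n st : ℕ} {kvs : List (ℕ × ℕ)} {q : List ℕ} {reg : Var → ℕ}
    {mem : Arr → ℕ → ℕ} (h : Searched n st kvs q reg mem) : q.length ≤ n := by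
  have h2 := (h.nodup.subperm (l₂ := List.range n) fun k hk => by
    simpa using h.lt k hk).length_le
  simpa using h2

/-- The queue grows only at its end, which the prefix relation `q <+: q'` records; the part already
processed stays in place. -/
theorem visit_spec {s : State Var Arr} {n st k : ℕ} {kvs : List (ℕ × ℕ)} {q : List ℕ}
    {offs seqs : Arr} (h1 : offs ∉ [mark, queue]) (h2 : seqs ∉ [mark, queue])
    (hS : StoresSeqs n kvs (s.mem offs) (s.mem seqs)) (hkv : ∀ e ∈ kvs, e.2 < n) (hk : k < n)
    (hM : n < M) (hW : n < W) (hlM : kvs.length ≤ M) (hlW : kvs.length ≤ W)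
    (hkr : s.reg Var.k = k) (hkq : k ∈ q) (hq : Searched n st kvs q s.reg s.mem) :
    WP M W (forRange (V := Var) (A := Arr) p (offs Var.k) (offs (Var.k + 1))
        (w ::= seqs p ;;
          ifThen (.eq (mark w) 0)
            (Cmd.store mark w 1 ;;
              Cmd.store queue qt w ;;
              qt ::= qt + 1))) (fun s' =>
      s'.clock ≤ s.clock + 50 * (keyCount kvs k + 1) ∧
      ∃ q', q <+: q' ∧ Searched n st kvs q' s'.reg s'.mem ∧ ∀ w, (k, w) ∈ kvs → w ∈ q') s := by
  simp only [List.mem_cons, List.not_mem_nil, or_false, not_or] at h1 h2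
  obtain ⟨o1, o2⟩ := h1
  obtain ⟨e1, e2⟩ := h2
  have ok := hS.offs k hk.le
  have ok1 := hS.offs (k + 1) hk
  have okl := keyOffset_le_length kvs (k + 1)
  have oks := keyOffset_succ kvs k
  have hmem := fun w => hS.mem_iff (w := w) hk
  refine WP.forRange_uniform (keyOffset kvs k) (keyOffset kvs (k + 1)) 30
    (fun i reg mem => ∃ q', q <+: q' ∧ Searched n st kvs q' reg mem ∧
      ∀ j, keyOffset kvs k ≤ j → j < i → s.mem seqs j ∈ q')
    ?_ ?_ (by omega) (by omega) ?_ ?_ ?_ ?_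
  · simp [Expr.InBounds, Expr.eval, hkr]; omega
  · simp [hkr, ok]
  · refine ⟨q, List.prefix_refl q, ⟨hq.nodup, hq.lt, hq.head, hq.reach, ?_, hq.queue, hq.mark⟩,
      fun j _ _ => by omega⟩
    simp [hq.qt]
  · intro i s' hF _ _ _ _
    have hr := hF.reg Var.k (by simp)
    have hm := hF.mem offs (by simp [o1, o2])
    simp [hr, hm, hkr, ok1]; omega
  · rintro i s' hF hi hi1 hi2 ⟨q', hqq, hq', hj⟩
    have hm := hF.mem seqs (by simp [e1, e2])
    have hin : (k, s.mem seqs i) ∈ kvs := (hmem _).2 ⟨i, by omega, by omega, rfl⟩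
    have hwn := hkv _ hin
    generalize hw : s.mem seqs i = w' at *
    have hmk := hq'.mark w' hwn
    have hqt := hq'.qt
    have hreach := (hq'.reach k (hqq.subset hkq)).tail hin
    simp only [WP.seq_iff, WP.store_iff, WP.assign_iff, WP.ifThen_iff, Expr.add_def,
      Expr.ofNat_def, Expr.InBounds, Expr.eval, Expr.cost, Test.InBounds, Test.Holds, Test.cost,
      State.tick_reg, State.tick_mem, State.tick_clock, State.setMem_reg,
      State.setMem_clock, State.setReg_reg, State.setReg_mem, State.setReg_clock, reduceCtorEq,
      if_true, if_false, hi, hm, hw, hmk, hqt, and_true, true_and]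
    refine ⟨by omega, by omega, by omega, fun hnq => ?_, fun hnq => ?_⟩
    · have hnq : w' ∉ q' := by
        intro h; simp [h] at hnq
      have hl := hq'.length_lt hwn hnq
      refine ⟨by omega, by omega, by omega, by omega, by omega, by omega, q' ++ [w'],
        hqq.trans (List.prefix_append _ _), ⟨?_, ?_, ?_, ?_, ?_, ?_, ?_⟩, ?_⟩
      · exact List.nodup_append'.2 ⟨hq'.nodup, by simp, by simpa using hnq⟩
      · intro x hx
        rcases List.mem_append.1 hx with hx | hx
        · exact hq'.lt x hx
        · obtain rfl := List.mem_singleton.1 hx; exact hwn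
      · exact List.mem_append_left _ hq'.head
      · intro x hx
        rcases List.mem_append.1 hx with hx | hx
        · exact hq'.reach x hx
        · obtain rfl := List.mem_singleton.1 hx; exact hreach
      · simp
      · intro j hjl
        simp only [List.length_append, List.length_singleton] at hjl
        simp only [State.tick_mem, State.setReg_mem, State.setMem_mem, reduceCtorEq, if_true,
          if_false]
        split_ifs with h
        · subst h; simp
        · rw [List.getElem_append_left (by omega)]; exact hq'.queue j (by omega)
      · intro x hx
        simp only [State.tick_mem, State.setReg_mem, State.setMem_mem, reduceCtorEq, if_true,
          if_false, List.mem_append, List.mem_singleton]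
        by_cases h : x = w'
        · simp [h]
        · simp [h, hq'.mark x hx]
      · intro j hj1 hj2
        by_cases h : j = i
        · subst h; simp [hw]
        · exact List.mem_append_left _ (hj j hj1 (by omega))
    · have hnq : w' ∈ q' := by
        by_contra h; simp [h] at hnq
      refine ⟨by omega, q', hqq, ⟨hq'.nodup, hq'.lt, hq'.head, hq'.reach, ?_, hq'.queue, hq'.mark⟩,
        fun j hj1 hj2 => ?_⟩
      · simp [hqt]
      · by_cases h : j = i
        · subst h; rwa [hw]
        · exact hj j hj1 (by omega)
  · rintro s' hF _ hc ⟨q', hqq, hq', hj⟩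
    simp [oks] at hc
    refine ⟨by omega, q', hqq, hq', fun w hw => ?_⟩
    obtain ⟨j, hj1, hj2, rfl⟩ := (hmem w).1 hw
    exact hj j (by omega) (by omega)

theorem bfs_spec {s : State Var Arr} {n st : ℕ} {kvs : List (ℕ × ℕ)}
    {offs seqs : Arr} {start : Expr Var Arr} (h1 : offs ∉ [mark, queue]) (h2 : seqs ∉ [mark, queue])
    (hS : StoresSeqs n kvs (s.mem offs) (s.mem seqs)) (hkv : ∀ e ∈ kvs, e.2 < n) (hst : st < n)
    (hM : n < M) (hW : n < W) (hlM : kvs.length ≤ M) (hlW : kvs.length ≤ W)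
    (hK : s.reg K = n) (hc : start.cost ≤ 50)
    (hstart : ∀ s' : State Var Arr, s'.reg lx = s.reg lx → s'.reg ly = s.reg ly →
      start.InBounds M s' ∧ start.eval s' = st) :
    WP M W (bfs offs seqs start) (fun s' =>
      s'.clock ≤ s.clock + 300 * (n + kvs.length + 1) ∧
      ∀ k < n, s'.mem mark k = 1 ↔ Relation.ReflTransGen (fun k w => (k, w) ∈ kvs) st k) s := by
  have h1' := h1
  have h2' := h2
  simp only [List.mem_cons, List.not_mem_nil, or_false, not_or] at h1 h2
  unfold bfs
  rw [WP.seq_iff]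
  refine WP.forRange_uniform 0 n 4 (fun i _ mem => ∀ k < i, mem mark k = 0)
    (by simp) (by simp) (by omega) (by omega) (by simp) ?_ ?_ ?_
  · intro i s' hF _ _ _ _
    have := hF.reg K (by simp)
    simp [this, hK]
  · intro i s' hF hi _ hi2 hI
    simp [hi]
    exact ⟨by omega, fun k hk hk' => hI k (by omega)⟩
  intro s1 hF1 _ hc1 hI1
  simp at hc1
  obtain ⟨st1, st2⟩ := hstart s1 (hF1.reg _ (by simp)) (hF1.reg _ (by simp))
  obtain ⟨st3, st4⟩ := hstart ((s1.setMem mark st 1).tick (start.cost + 1 + 1))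
    (hF1.reg _ (by simp)) (hF1.reg _ (by simp))
  simp only [WP.seq_iff, WP.store_iff, WP.assign_iff, Expr.ofNat_def, Expr.InBounds, Expr.eval,
    Expr.cost, st1, st2, st3, st4, true_and]
  refine ⟨by omega, by omega, by omega, by omega, by omega, by omega, ?_⟩
  generalize hs2 : State.tick _ _ = s2
  have hq2 : Searched n st kvs [st] s2.reg s2.mem := by
    subst hs2
    refine ⟨by simp, by simpa using hst, by simp, by simpa using .refl, by simp, by simp,
      fun k hk => ?_⟩
    simp only [State.tick_mem, State.setReg_mem, State.setMem_mem, reduceCtorEq, if_true,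
      if_false, List.mem_singleton]
    split_ifs
    · rfl
    · exact hI1 k hk
  have hS2 : StoresSeqs n kvs (s2.mem offs) (s2.mem seqs) := by
    have k1 : s2.mem offs = s.mem offs := by
      rw [← hF1.mem offs (by simp [h1])]; ext; simp [← hs2, h1]
    have k2 : s2.mem seqs = s.mem seqs := by
      rw [← hF1.mem seqs (by simp [h2])]; ext; simp [← hs2, h2]
    rw [k1, k2]; exact hS
  have hc2 : s2.clock ≤ s.clock + 14 * n + 130 := by
    subst hs2; simp; omega
  have hqh2 : s2.reg qh = 0 := by simp [← hs2]
  clear hs2 st1 st2 st3 st4 hc1 hI1 hF1 hS hK hstart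
  -- All successors of the entries in front of the head are already in the queue. When the head
  -- meets the tail, the queue is closed under successors and so contains everything reachable. Time
  -- is charged to the entries in front of the head.
  refine WP.loop (fun s' => ∃ q, Searched n st kvs q s'.reg s'.mem ∧ s'.reg qh ≤ q.length ∧
      (∀ k ∈ q.take (s'.reg qh), ∀ w, (k, w) ∈ kvs → w ∈ q) ∧
      s'.mem offs = s2.mem offs ∧ s'.mem seqs = s2.mem seqs ∧
      s'.clock ≤ s2.clock + 100 * ((q.take (s'.reg qh)).map (fun k => keyCount kvs k + 1)).sum)
    (fun s' => n - s'.reg qh) ⟨[st], hq2, by omega, by simp [hqh2], rfl, rfl, by omega⟩ ?_ ?_ ?_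
  · intro s' _; simp
  · rintro s' ⟨q, hq, hqh, hcl, ho, hs, hck⟩ ht
    simp only [Test.Holds, Expr.eval] at ht
    have hqt := hq.qt
    rw [hqt] at ht
    have hlen := hq.length_le
    have hget := hq.queue _ ht
    have hkn := hq.lt _ (List.getElem_mem ht)
    have hkq : q[s'.reg qh] ∈ q := List.getElem_mem ht
    generalize hk : q[s'.reg qh] = k at *
    rw [WP.seq_iff, WP.assign_iff, WP.seq_iff, WP.assign_iff]
    refine ⟨by simp; omega, by simp [hget]; omega, by simp, by simp; omega, ?_⟩
    generalize hs3 : State.tick _ _ = s3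
    have hq3 : Searched n st kvs q s3.reg s3.mem := by
      subst hs3
      exact ⟨hq.nodup, hq.lt, hq.head, hq.reach, by simp [hqt], hq.queue, hq.mark⟩
    have hk3 : s3.reg Var.k = k := by simp [← hs3, hget]
    have hqh3 : s3.reg qh = s'.reg qh + 1 := by simp [← hs3]
    have ho3 : s3.mem offs = s2.mem offs := by simp [← hs3, ho]
    have hs3' : s3.mem seqs = s2.mem seqs := by simp [← hs3, hs]
    have hc3 : s3.clock ≤ s'.clock + 20 := by simp [← hs3]
    clear hs3
    refine (visit_spec h1' h2' (by rw [ho3, hs3']; exact hS2) hkv hkn hM hW hlM hlW hk3 hkq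
      hq3).mono_frame ?_
    rintro s4 hF4 ⟨hc4, q', hqq, hq4, hall⟩
    have hqh4 : s4.reg qh = s'.reg qh + 1 := by rw [hF4.reg _ (by simp), hqh3]
    have htake : q'.take (s'.reg qh + 1) = q.take (s'.reg qh) ++ [k] := by
      obtain ⟨t, rfl⟩ := hqq
      rw [List.take_append_of_le_length (by omega), List.take_succ_eq_append_getElem ht, hk]
    have hle := hqq.length_le
    rw [hqh4]
    refine ⟨⟨q', hq4, by omega, ?_, ?_, ?_, ?_⟩, by omega⟩
    · rw [htake]
      intro x hx w hw
      rcases List.mem_append.1 hx with hx | hx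
      · exact hqq.subset (hcl x hx w hw)
      · obtain rfl := List.mem_singleton.1 hx
        exact hall w hw
    · rw [hF4.mem _ (by simp [h1]), ho3]
    · rw [hF4.mem _ (by simp [h2]), hs3']
    · rw [htake, List.map_append, List.sum_append]
      simp only [List.map_cons, List.map_nil, List.sum_cons, List.sum_nil]
      omega
  · rintro s' ⟨q, hq, hqh, hcl, ho, hs, hck⟩ ht
    simp only [Test.Holds, Expr.eval] at ht
    rw [hq.qt] at ht
    have hqe : s'.reg qh = q.length := by omega
    rw [hqe, List.take_length] at hcl hck
    have hsum := sum_keyCount_le kvs hq.nodup hq.lt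
    refine ⟨by simp; omega, fun k hk => ?_⟩
    rw [State.tick_mem, hq.mark k hk]
    constructor
    · intro h
      by_cases hkq : k ∈ q
      · exact hq.reach k hkq
      · simp [hkq] at h
    · intro h
      rw [if_pos]
      clear hk
      induction h with
      | refl => exact hq.head
      | tail _ h ih => exact hcl _ ih _ h

/-- The edges selected by `f` are kept if `mark` selects the keys of their entries in
`endpoint`. -/
theorem filterEdges_spec {s : State Var Arr} {n m : ℕ} {es : List (Vertex × Vertex)}
    (endpoint : Arr) (g : Vertex × Vertex → Vertex) (f : Vertex × Vertex → Bool)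
    (hend : ∀ s' : State Var Arr, ∀ e (h : e < es.length), s'.mem src e = key n m es[e].1 →
      s'.mem dst e = key n m es[e].2 → s'.mem endpoint e = key n m (g es[e]))
    (hE : HasEdges n m es s) (hf : ∀ e ∈ es, s.mem mark (key n m (g e)) = 1 ↔ f e = true)
    (hn : ∀ e ∈ es, key n m (g e) < M) (hn1 : ∀ e ∈ es, key n m e.1 ≤ W)
    (hn2 : ∀ e ∈ es, key n m e.2 ≤ W) (hlM : es.length ≤ M) (hlW : es.length ≤ W) :
    WP M W (filterEdges endpoint) (fun s' =>
      s'.clock ≤ s.clock + 100 * (es.length + 1) ∧ HasEdges n m (es.filter f) s') s := by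
  unfold filterEdges
  rw [WP.seq_iff, WP.assign_iff, WP.seq_iff]
  refine ⟨by simp, by simp, ?_⟩
  generalize hs0 : State.tick _ _ = s0
  have hE0 : HasEdges n m es s0 := by subst hs0; exact ⟨hE.E, hE.src, hE.dst⟩
  have hm0 : s0.mem mark = s.mem mark := by subst hs0; rfl
  have hr0 : s0.reg r = 0 := by simp [← hs0]
  have hc0 : s0.clock = s.clock + 2 := by simp [← hs0]
  clear hs0
  -- The list is filtered in place. The write position never overtakes the read position, which is
  -- why the entries from `i` on are still the original ones.
  refine WP.forRange_uniform 0 es.length 40 (fun i reg mem =>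
    reg r = ((es.take i).filter f).length ∧
    (∀ e (h : e < ((es.take i).filter f).length), mem src e = key n m ((es.take i).filter f)[e].1) ∧
    (∀ e (h : e < ((es.take i).filter f).length), mem dst e = key n m ((es.take i).filter f)[e].2) ∧
    (∀ e, i ≤ e → ∀ (h : e < es.length), mem src e = key n m es[e].1) ∧
    (∀ e, i ≤ e → ∀ (h : e < es.length), mem dst e = key n m es[e].2))
    (by simp) (by simp) (by omega) (by omega)
    ⟨by simp [hr0], by simp, by simp, fun e _ => hE0.src e, fun e _ => hE0.dst e⟩ ?_ ?_ ?_
  · intro i s' hF _ _ _ _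
    have := hF.reg E (by simp)
    simp [this, hE0.E]
  · rintro i s' hF hi _ hi2 ⟨hI1, hI2, hI3, hI4, hI5⟩
    have hm := hF.mem mark (by simp)
    rw [hm0] at hm
    have hs1 := hI4 i le_rfl hi2
    have hs2 := hI5 i le_rfl hi2
    have hep := hend s' i hi2 hs1 hs2
    have hmem := List.getElem_mem hi2
    have hmk := hf _ hmem
    have b1 := hn _ hmem
    have b2 := hn1 _ hmem
    have b3 := hn2 _ hmem
    have hle : ((es.take i).filter f).length ≤ i :=
      (List.length_filter_le _ _).trans (by simp)
    simp only [List.take_succ_eq_append_getElem hi2, List.filter_append]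
    simp only [WP.seq_iff, WP.store_iff, WP.assign_iff, WP.ifThen_iff, Expr.add_def,
      Expr.ofNat_def, Expr.InBounds, Expr.eval, Expr.cost, Test.InBounds, Test.Holds, Test.cost,
      State.tick_reg, State.tick_mem, State.tick_clock, State.setMem_reg, State.setMem_mem,
      State.setMem_clock, State.setReg_reg, State.setReg_mem, State.setReg_clock, reduceCtorEq,
      if_true, if_false, hi, hm, hep, hI1, hs1, hs2, hmk, and_true, true_and]
    refine ⟨by omega, fun hfe => ?_, fun hfe => ?_⟩
    · have hl1 : [es[i]].filter f = [es[i]] := by simp [hfe]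
      simp only [hl1]
      refine ⟨by omega, by omega, by omega, by omega, by omega, by omega, by omega, by omega,
        by simp, fun e he => ?_, fun e he => ?_, fun e he hel => ?_, fun e he hel => ?_⟩
      · simp only [List.length_append, List.length_singleton] at he
        split_ifs with h
        · subst h; simp
        · rw [List.getElem_append_left (by omega)]; exact hI2 e (by omega)
      · simp only [List.length_append, List.length_singleton] at he
        split_ifs with h
        · subst h; simp
        · rw [List.getElem_append_left (by omega)]; exact hI3 e (by omega)
      · rw [if_neg (by omega)]; exact hI4 e (by omega) hel
      · rw [if_neg (by omega)]; exact hI5 e (by omega) hel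
    · have hl1 : [es[i]].filter f = [] := by simp [hfe]
      simp only [hl1, List.append_nil]
      exact ⟨by omega, trivial, hI2, hI3, fun e he hel => hI4 e (by omega) hel,
        fun e he hel => hI5 e (by omega) hel⟩
  · rintro s' hF _ hc ⟨hI1, hI2, hI3, -, -⟩
    simp only [List.take_length, Expr.cost] at hI1 hI2 hI3 hc
    have hle : (es.filter f).length ≤ es.length := List.length_filter_le _ _
    rw [WP.assign_iff]
    refine ⟨by simp, by simp [hI1]; omega, ?_, ?_, hI2, hI3⟩
    · simp; simp at hc; omega
    · simp [hI1]

end Enum331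

end MCS

namespace MCS

/-! ### Numbering the vertices, and construction of the all-MCS graph. -/

namespace Enum331

open Var Arr

variable {M W : ℕ} {A B : List ℕ} {σ : ℕ}

/-- What the endpoints of the edges of `G`, the source and the sink have in common. -/
structure IsNode (A B : List ℕ) (w : Vertex) : Prop where
  one_le_fst : 1 ≤ w.2.1
  one_le_snd : 1 ≤ w.2.2
  fst_le_fst : w.2.1 ≤ w.1.1
  snd_le_snd : w.2.2 ≤ w.1.2
  fst_le : w.1.1 ≤ A.length
  snd_le : w.1.2 ≤ B.length
  not_below : w.2.1 = w.1.1 ∨ w.2.2 = w.1.2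

theorem isNode_source (hA : 2 ≤ A.length) (hB : 2 ≤ B.length) : IsNode A B source :=
  ⟨le_rfl, le_rfl, le_rfl, le_rfl, by simp only [source]; omega, by simp only [source]; omega, .inl rfl⟩

theorem isNode_sink (hA : 2 ≤ A.length) (hB : 2 ≤ B.length) : IsNode A B (sink A B) :=
  ⟨by simp only [sink]; omega, by simp only [sink]; omega, le_rfl, le_rfl, le_rfl, le_rfl, .inl rfl⟩

/-- If prev exceeded `u` in both coordinates, it would be a match strictly between `u` and `v`; the
same holds for next if it were below `v` in both. So the two matches of a vertex share a row or a
column, which makes the number of vertices cubic instead of quartic. -/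
theorem isNode_of_edgeG {p q : Vertex} (h : EdgeG A B p q) : IsNode A B p ∧ IsNode A B q := by
  obtain ⟨u, v, h, rfl, rfl⟩ := h
  have h1 := h.le_prevMatch
  have h2 := h.nextMatch_le
  have h3 := edge_mem h
  obtain ⟨hu, hv, huv, hno⟩ := h
  refine ⟨⟨hu.1, hu.2.2.1, h1.1, h1.2, h3.2.1, h3.2.2.2.1, ?_⟩,
    ⟨h3.2.2.2.2.1, h3.2.2.2.2.2.2.1, h2.1, h2.2, hv.2.1, hv.2.2.2.1, ?_⟩⟩
  · by_contra hne
    simp only [not_or] at hne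
    obtain ⟨k1, k2, k3, k4, -⟩ := hv
    refine hno ⟨prevMatch A B (matchChar A u) v, (isMatch_prevMatch ?_ ?_ ?_ ?_).1, ⟨?_, ?_⟩,
      prevIdx_lt k1, prevIdx_lt k3⟩
    · exact h3.1
    · exact h3.2.2.1
    all_goals omega
  · by_contra hne
    simp only [not_or] at hne
    obtain ⟨k1, k2, k3, k4, -⟩ := hu
    obtain ⟨l1, l2, l3, l4, -⟩ := hv
    have hb : Below (nextMatch A B (matchChar A v) u) v := by
      constructor <;> omega
    have := isMatch_nextMatch hb (by omega) (by omega) k2 k4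
    exact hno ⟨_, this.1, this.2.2, hb⟩

theorem IsNode.key_lt {w : Vertex} (h : IsNode A B w) :
    key A.length B.length w < numKeys A.length B.length := by
  obtain ⟨h1, h2, h3, h4, h5, h6, -⟩ := h
  exact key_lt_numKeys (by omega) (by omega) (by omega) h6 (by omega)

theorem IsNode.key_eq_iff {w : Vertex} (h : IsNode A B w) {i j d : ℕ} (hj : j ≤ B.length)
    (hd : d < A.length + B.length) :
    key A.length B.length w = (i * (B.length + 1) + j) * (A.length + B.length) + d ↔
      w.2.1 = i ∧ w.2.2 = j ∧ w.1.2 + A.length = d + w.1.1 := by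
  obtain ⟨h1, h2, h3, h4, h5, h6, -⟩ := h
  rw [key, indexOf_inj (by omega) (by omega) hj hd]
  omega

/-- Given `b` and the diagonal of `a`, sharing the first or the second coordinate with `b` each
determines `a`; if both options occur, then `b ≤ a` makes them coincide. -/
theorem key_injOn : Set.InjOn (key A.length B.length) {w | IsNode A B w} := by
  intro w hw w' hw' h
  obtain ⟨h1, h2, h3, h4, h5, h6, h7⟩ := id hw'
  have h := h.symm
  rw [key, eq_comm, hw.key_eq_iff (by omega) (by omega)] at h
  obtain ⟨k1, k2, k3, k4, k5, k6, k7⟩ := hw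
  ext
  all_goals omega

/-- The keys of the endpoints of the edges. -/
def edgeKeys (A B : List ℕ) (es : List (Vertex × Vertex)) : List (ℕ × ℕ) :=
  es.map fun e => (key A.length B.length e.1, key A.length B.length e.2)

theorem mem_edgeKeys {es : List (Vertex × Vertex)} {k l : ℕ} :
    (k, l) ∈ edgeKeys A B es ↔
      ∃ p q, (p, q) ∈ es ∧ key A.length B.length p = k ∧ key A.length B.length q = l := by
  simp only [edgeKeys, List.mem_map, Prod.mk.injEq, Prod.exists]

/-- Injectivity of the keys on nodes lets a walk through keys be lifted edge by edge to a walk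
through vertices. -/
theorem reflTransGen_keys {es : List (Vertex × Vertex)}
    (hes : ∀ e ∈ es, IsNode A B e.1 ∧ IsNode A B e.2) {p q : Vertex} (hp : IsNode A B p)
    (hq : IsNode A B q) :
    Relation.ReflTransGen (fun k l => (k, l) ∈ edgeKeys A B es) (key A.length B.length p)
        (key A.length B.length q) ↔ Relation.ReflTransGen (fun p q => (p, q) ∈ es) p q := by
  constructor
  · intro h
    have : ∀ k, Relation.ReflTransGen (fun k l => (k, l) ∈ edgeKeys A B es)
        (key A.length B.length p) k → ∃ q, IsNode A B q ∧ key A.length B.length q = k ∧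
          Relation.ReflTransGen (fun p q => (p, q) ∈ es) p q := by
      intro k hk
      induction hk with
      | refl => exact ⟨p, hp, rfl, .refl⟩
      | tail _ h ih =>
        obtain ⟨a, ha1, ha2, ha3⟩ := ih
        obtain ⟨b, c, hbc, rfl, rfl⟩ := mem_edgeKeys.1 h
        obtain rfl : a = b := key_injOn ha1 (hes _ hbc).1 ha2
        exact ⟨c, (hes _ hbc).2, rfl, ha3.tail hbc⟩
    obtain ⟨q', h1, h2, h3⟩ := this _ h
    obtain rfl : q' = q := key_injOn h1 hq h2
    exact h3
  · exact fun h => h.lift _ fun a b hab => mem_edgeKeys.2 ⟨a, b, hab, rfl, rfl⟩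

theorem HasEdges.getElem_edgeKeys {es : List (Vertex × Vertex)} {s : State Var Arr}
    (h : HasEdges A.length B.length es s) (e : ℕ) (he : e < (edgeKeys A B es).length) :
    s.mem Arr.src e = (edgeKeys A B es)[e].1 ∧ s.mem Arr.dst e = (edgeKeys A B es)[e].2 := by
  have he' : e < es.length := by simpa [edgeKeys] using he
  simp [edgeKeys, h.src e he', h.dst e he']

theorem length_edgeKeys (es : List (Vertex × Vertex)) : (edgeKeys A B es).length = es.length :=
  List.length_map _

/-- The list `es'` need not be the one in memory: with the roles of `src` and `dst` exchanged it is
the list of reversed edges. -/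
theorem buildSeqs_edges_spec {s : State Var Arr} (key' val offs seqs : Arr)
    (es' : List (Vertex × Vertex))
    (h1 : key' ∉ [offs, seqs, Arr.cur]) (h2 : val ∉ [offs, seqs, Arr.cur]) (h3 : offs ≠ seqs)
    (h4 : offs ≠ Arr.cur) (h5 : seqs ≠ Arr.cur)
    (hK : s.reg K = numKeys A.length B.length) (hE : s.reg E = es'.length)
    (hes : ∀ e ∈ es', IsNode A B e.1 ∧ IsNode A B e.2)
    (hkv : ∀ e (h : e < (edgeKeys A B es').length), s.mem key' e = (edgeKeys A B es')[e].1 ∧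
      s.mem val e = (edgeKeys A B es')[e].2)
    (hM : numKeys A.length B.length < M) (hW : numKeys A.length B.length < W)
    (hl : es'.length ≤ numKeys A.length B.length) :
    WP M W (buildSeqs key' val offs seqs) (fun s' =>
      s'.clock ≤ s.clock + 300 * numKeys A.length B.length + 100 ∧
      StoresSeqs (numKeys A.length B.length) (edgeKeys A B es') (s'.mem offs) (s'.mem seqs)) s := by
  have hlen := length_edgeKeys (A := A) (B := B) es'
  have hlt : ∀ e ∈ edgeKeys A B es', e.1 < numKeys A.length B.length ∧
      e.2 < numKeys A.length B.length := by
    intro e he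
    obtain ⟨e', he', rfl⟩ := List.mem_map.1 he
    exact ⟨(hes _ he').1.key_lt, (hes _ he').2.key_lt⟩
  refine (buildSeqs_spec key' val offs seqs _ (edgeKeys A B es') h1 h2 h3 h4 h5 hK (by rw [hlen, hE])
    (fun e h => (hkv e h).1) (fun e h => (hkv e h).2) (fun e he => (hlt e he).1)
    (fun e he => by have := (hlt e he).2; omega) hM hW (by omega) (by omega)).mono ?_
  rintro s' ⟨hc, hS⟩
  exact ⟨by omega, hS⟩

theorem bfs_edges_spec {s : State Var Arr} {offs seqs : Arr} {start : Expr Var Arr}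
    {es : List (Vertex × Vertex)} {st : Vertex}
    (h1 : offs ∉ [mark, queue]) (h2 : seqs ∉ [mark, queue])
    (hS : StoresSeqs (numKeys A.length B.length) (edgeKeys A B es) (s.mem offs) (s.mem seqs))
    (hes : ∀ e ∈ es, IsNode A B e.1 ∧ IsNode A B e.2) (hst : IsNode A B st)
    (hK : s.reg K = numKeys A.length B.length)
    (hM : numKeys A.length B.length < M) (hW : numKeys A.length B.length < W)
    (hl : es.length ≤ numKeys A.length B.length) (hc : start.cost ≤ 50)
    (hstart : ∀ s' : State Var Arr, s'.reg lx = s.reg lx → s'.reg ly = s.reg ly →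
      start.InBounds M s' ∧ start.eval s' = key A.length B.length st) :
    WP M W (bfs offs seqs start) (fun s' =>
      s'.clock ≤ s.clock + 600 * numKeys A.length B.length + 300 ∧
      ∀ w, IsNode A B w → (s'.mem mark (key A.length B.length w) = 1 ↔
        Relation.ReflTransGen (fun p q => (p, q) ∈ es) st w)) s := by
  have hlen := length_edgeKeys (A := A) (B := B) es
  refine (bfs_spec h1 h2 hS ?_ hst.key_lt hM hW (by omega) (by omega) hK hc hstart).mono ?_
  · intro e he
    obtain ⟨e', he', rfl⟩ := List.mem_map.1 he
    exact (hes _ he').2.key_lt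
  · rintro s' ⟨hc', hm⟩
    rw [hlen] at hc'
    refine ⟨by linarith, fun w hw => ?_⟩
    rw [hm _ hw.key_lt, reflTransGen_keys hes hst hw]

theorem sourceKey_eval {s : State Var Arr} (hlx : s.reg lx = A.length) (hly : s.reg ly = B.length) :
    sourceKey.InBounds M s ∧ sourceKey.eval s = key A.length B.length source := by
  simp [sourceKey, keyOf, indexOf, key, source, hlx, hly]

theorem sinkKey_eval {s : State Var Arr} (hlx : s.reg lx = A.length) (hly : s.reg ly = B.length) :
    sinkKey.InBounds M s ∧ sinkKey.eval s = key A.length B.length (sink A B) := by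
  simp [sinkKey, keyOf, indexOf, key, sink, hlx, hly]

/-- The part of the preprocessing that constructs the graphs. -/
def constructGraphs : Cmd Var Arr :=
  listEdges ;;
  buildSeqs src dst G seqG ;;
  bfs G seqG sourceKey ;;
  filterEdges src ;;
  buildSeqs dst src G1 seqG1 ;;
  bfs G1 seqG1 sinkKey ;;
  filterEdges dst ;;
  buildSeqs src dst G2 seqG2

/-- The arrays of sequences `G2` and `seqG2` hold the edges `es` of the all-MCS graph. -/
structure StoresGraph (A B : List ℕ) (es : List (Vertex × Vertex)) (s : State Var Arr) : Prop where
  nodup : es.Nodup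
  mem_iff : ∀ e, e ∈ es ↔ AllMCSEdge A B e.1 e.2
  length_le : es.length ≤ numKeys A.length B.length
  seqs : StoresSeqs (numKeys A.length B.length) (edgeKeys A B es) (s.mem G2) (s.mem seqG2)

/-- A walk of `G` that starts in a reachable vertex stays among reachable vertices, so all its edges
survived the first filter. Searching backward in the filtered graph is therefore as good as in `G`.
-/
theorem coreachable_of_reachable {es : List (Vertex × Vertex)} {a b t : Vertex}
    (hes : ∀ e, e ∈ es ↔ EdgeG A B e.1 e.2 ∧ Relation.ReflTransGen (EdgeG A B) a e.1)
    (hab : Relation.ReflTransGen (EdgeG A B) a b) :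
    Relation.ReflTransGen (fun p q => (q, p) ∈ es) t b ↔
      Relation.ReflTransGen (EdgeG A B) b t := by
  constructor
  · intro h
    rw [← Relation.reflTransGen_swap] at h
    exact Relation.ReflTransGen.mono (fun p q hpq => ((hes (p, q)).1 hpq).1) _ _ h
  · intro h
    induction h using Relation.ReflTransGen.head_induction_on with
    | refl => exact .refl
    | head h _ ih => exact (ih (hab.tail h)).tail ((hes (_, _)).2 ⟨h, hab⟩)

-- Classical decidability is used only to name the filtered lists by their meaning; the program
-- itself tests marks.
open Classical in
theorem constructGraphs_spec (hf : Fits M W A B σ) {s : State Var Arr} (hT : HasTables A B σ s)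
    (hK : s.reg K = numKeys A.length B.length) :
    WP M W constructGraphs (fun s' =>
      s'.clock ≤ s.clock + 6000 * numKeys A.length B.length ∧
      ∃ es, StoresGraph A B es s') s := by
  have hM := hf.keys_lt
  have hW := hf.keys_le
  have hNK := length_add_length_le A.length B.length
  have hA := hf.lenA
  have hB := hf.lenB
  have nsrc := isNode_source hA hB
  have nsnk := isNode_sink hA hB
  unfold constructGraphs
  refine WP.seq_mono (listEdges_spec hf hT) ?_
  rintro s1 hF1 ⟨hc1, es, hnd, hmem, hl, hE1⟩
  have hT1 : s1.reg lx = A.length ∧ s1.reg ly = B.length :=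
    ⟨(hF1.reg _ (by simp [listEdges, findEdges, listEdge])).trans hT.lx,
      (hF1.reg _ (by simp [listEdges, findEdges, listEdge])).trans hT.ly⟩
  have hK1 : s1.reg K = numKeys A.length B.length :=
    (hF1.reg _ (by simp [listEdges, findEdges, listEdge])).trans hK
  have hnode : ∀ e ∈ es, IsNode A B e.1 ∧ IsNode A B e.2 := fun e he => isNode_of_edgeG ((hmem e).1 he)
  refine WP.seq_mono (buildSeqs_edges_spec (A := A) (B := B) src dst G seqG es (by simp) (by simp)
    (by simp) (by simp) (by simp) hK1 hE1.E hnode hE1.getElem_edgeKeys hM hW hl) ?_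
  rintro s2 hF2 ⟨hc2, hS2⟩
  have hT2 : s2.reg lx = A.length ∧ s2.reg ly = B.length :=
    ⟨(hF2.reg _ (by simp [buildSeqs])).trans hT1.1, (hF2.reg _ (by simp [buildSeqs])).trans hT1.2⟩
  have hK2 := (hF2.reg _ (by simp [buildSeqs])).trans hK1
  have hE2 := hE1.frame hF2 (by simp [buildSeqs]) (by simp [buildSeqs]) (by simp [buildSeqs])
  refine WP.seq_mono (bfs_edges_spec (by simp) (by simp) hS2 hnode nsrc hK2 hM hW hl
    (by simp [sourceKey, keyOf, indexOf])
    (fun s' h1 h2 => sourceKey_eval (h1.trans hT2.1) (h2.trans hT2.2))) ?_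
  rintro s3 hF3 ⟨hc3, hm3⟩
  have hT3 : s3.reg lx = A.length ∧ s3.reg ly = B.length :=
    ⟨(hF3.reg _ (by simp [bfs])).trans hT2.1, (hF3.reg _ (by simp [bfs])).trans hT2.2⟩
  have hK3 := (hF3.reg _ (by simp [bfs])).trans hK2
  have hE3 := hE2.frame hF3 (by simp [bfs]) (by simp [bfs]) (by simp [bfs])
  have hrel : (fun p q => (p, q) ∈ es) = EdgeG A B := by
    ext p q; exact hmem (p, q)
  rw [hrel] at hm3
  refine WP.seq_mono (filterEdges_spec src (fun e => e.1)
    (fun e => decide (Relation.ReflTransGen (EdgeG A B) source e.1)) (fun s' e h k1 k2 => k1) hE3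
    (fun e he => by rw [hm3 _ (hnode e he).1, decide_eq_true_eq])
    (fun e he => (hnode e he).1.key_lt.trans hM) (fun e he => ((hnode e he).1.key_lt.trans hW).le)
    (fun e he => ((hnode e he).2.key_lt.trans hW).le) (by omega) (by omega)) ?_
  rintro s4 hF4 ⟨hc4, hE4⟩
  generalize hes1 : es.filter _ = es1 at hE4
  have hmem1 : ∀ e, e ∈ es1 ↔ EdgeG A B e.1 e.2 ∧ Relation.ReflTransGen (EdgeG A B) source e.1 := by
    intro e
    rw [← hes1, List.mem_filter, hmem, decide_eq_true_eq]
  have hnd1 : es1.Nodup := hes1 ▸ hnd.filter _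
  have hl1 : es1.length ≤ numKeys A.length B.length := by
    rw [← hes1]; exact (List.length_filter_le _ _).trans hl
  clear hes1
  have hnode1 : ∀ e ∈ es1, IsNode A B e.1 ∧ IsNode A B e.2 := fun e he => isNode_of_edgeG ((hmem1 e).1 he).1
  have hT4 : s4.reg lx = A.length ∧ s4.reg ly = B.length :=
    ⟨(hF4.reg _ (by simp [filterEdges])).trans hT3.1, (hF4.reg _ (by simp [filterEdges])).trans hT3.2⟩
  have hK4 := (hF4.reg _ (by simp [filterEdges])).trans hK3
  -- The second search runs from the sink along reversed edges, that is, on the sequences keyed by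
  -- the heads.
  have hsw : ∀ e ∈ es1.map Prod.swap, IsNode A B e.1 ∧ IsNode A B e.2 := by
    intro e he
    obtain ⟨e', he', rfl⟩ := List.mem_map.1 he
    exact (hnode1 e' he').symm
  refine WP.seq_mono (buildSeqs_edges_spec (A := A) (B := B) dst src G1 seqG1 (es1.map Prod.swap)
    (by simp) (by simp) (by simp) (by simp) (by simp) hK4 (by rw [List.length_map]; exact hE4.E)
    hsw ?_ hM hW (by simpa using hl1)) ?_
  · intro e he
    have he' : e < es1.length := by simpa [edgeKeys] using he
    simp [edgeKeys, hE4.src e he', hE4.dst e he']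
  rintro s5 hF5 ⟨hc5, hS5⟩
  have hT5 : s5.reg lx = A.length ∧ s5.reg ly = B.length :=
    ⟨(hF5.reg _ (by simp [buildSeqs])).trans hT4.1, (hF5.reg _ (by simp [buildSeqs])).trans hT4.2⟩
  have hK5 := (hF5.reg _ (by simp [buildSeqs])).trans hK4
  have hE5 := hE4.frame hF5 (by simp [buildSeqs]) (by simp [buildSeqs]) (by simp [buildSeqs])
  refine WP.seq_mono (bfs_edges_spec (by simp) (by simp) hS5 hsw nsnk hK5 hM hW (by simpa using hl1)
    (by simp [sinkKey, keyOf, indexOf])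
    (fun s' h1 h2 => sinkKey_eval (h1.trans hT5.1) (h2.trans hT5.2))) ?_
  rintro s6 hF6 ⟨hc6, hm6⟩
  have hT6 : s6.reg lx = A.length ∧ s6.reg ly = B.length :=
    ⟨(hF6.reg _ (by simp [bfs])).trans hT5.1, (hF6.reg _ (by simp [bfs])).trans hT5.2⟩
  have hK6 := (hF6.reg _ (by simp [bfs])).trans hK5
  have hE6 := hE5.frame hF6 (by simp [bfs]) (by simp [bfs]) (by simp [bfs])
  have hrel1 : (fun p q => (p, q) ∈ es1.map Prod.swap) = fun p q => (q, p) ∈ es1 := by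
    ext p q
    simp
  rw [hrel1] at hm6
  refine WP.seq_mono (filterEdges_spec dst (fun e => e.2)
    (fun e => decide (Relation.ReflTransGen (EdgeG A B) e.2 (sink A B))) (fun s' e h k1 k2 => k2) hE6
    (fun e he => by
      have h1 := (hmem1 e).1 he
      rw [hm6 _ (hnode1 e he).2, decide_eq_true_eq, coreachable_of_reachable hmem1 (h1.2.tail h1.1)])
    (fun e he => (hnode1 e he).2.key_lt.trans hM) (fun e he => ((hnode1 e he).1.key_lt.trans hW).le)
    (fun e he => ((hnode1 e he).2.key_lt.trans hW).le) (by omega) (by omega)) ?_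
  rintro s7 hF7 ⟨hc7, hE7⟩
  generalize hes2 : es1.filter _ = es2 at hE7
  have hmem2 : ∀ e, e ∈ es2 ↔ AllMCSEdge A B e.1 e.2 := by
    intro e
    rw [← hes2, List.mem_filter, hmem1, decide_eq_true_eq, and_assoc]
    rfl
  have hnd2 : es2.Nodup := hes2 ▸ hnd1.filter _
  have hl2 : es2.length ≤ numKeys A.length B.length := by
    rw [← hes2]; exact (List.length_filter_le _ _).trans hl1
  clear hes2
  have hK7 := (hF7.reg _ (by simp [filterEdges])).trans hK6
  refine (buildSeqs_edges_spec (A := A) (B := B) src dst G2 seqG2 es2 (by simp) (by simp)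
    (by simp) (by simp) (by simp) hK7 hE7.E (fun e he => isNode_of_edgeG ((hmem2 e).1 he).1)
    hE7.getElem_edgeKeys hM hW hl2).mono ?_
  rintro s8 ⟨hc8, hS8⟩
  exact ⟨by omega, es2, hnd2, hmem2, hl2, hS8⟩

theorem StoresSeqs.storedSeq_eq {n k : ℕ} {kvs : List (ℕ × ℕ)} {s : State Var Arr}
    (h : StoresSeqs n kvs (s.mem G2) (s.mem seqG2)) (hk : k < n) :
    storedSeq s k = (kvs.filter (fun e => e.1 = k)).map Prod.snd := by
  rw [storedSeq, h.offs k hk.le, h.offs (k + 1) hk, keyOffset_succ, Nat.add_sub_cancel_left]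
  exact h.seqs k hk

/-- The heads of the edges whose tails have the key `k`. -/
def headsOf (A B : List ℕ) (es : List (Vertex × Vertex)) (k : ℕ) : List Vertex :=
  (es.filter (fun e => key A.length B.length e.1 = k)).map Prod.snd

namespace StoresGraph

variable {es : List (Vertex × Vertex)} {s : State Var Arr}

theorem isNode (h : StoresGraph A B es s) {e : Vertex × Vertex} (he : e ∈ es) :
    IsNode A B e.1 ∧ IsNode A B e.2 := isNode_of_edgeG ((h.mem_iff e).1 he).1

theorem storedSeq_eq (h : StoresGraph A B es s) {k : ℕ} (hk : k < numKeys A.length B.length) :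
    storedSeq s k = (headsOf A B es k).map (key A.length B.length) := by
  rw [h.seqs.storedSeq_eq hk, edgeKeys, headsOf, List.filter_map, List.map_map, List.map_map]
  rfl

/-- Edges whose tails have the same key have the same tail, so distinct ones among them have
distinct heads. -/
theorem nodup_headsOf (h : StoresGraph A B es s) (k : ℕ) : (headsOf A B es k).Nodup := by
  refine (h.nodup.filter _).map_on ?_
  intro e he e' he' heq
  simp only [List.mem_filter, decide_eq_true_eq] at he he'
  exact Prod.ext (key_injOn (h.isNode he.1).1 (h.isNode he'.1).1 (he.2.trans he'.2.symm)) heq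

theorem storesAllMCSGraph (h : StoresGraph A B es s) : StoresAllMCSGraph A B s := by
  intro i j d hi1 hi2 hj1 hj2 hd1 hd2
  have hd : (d + A.length).toNat < A.length + B.length := by omega
  refine ⟨headsOf A B es _, h.nodup_headsOf _, fun q => ?_, h.storedSeq_eq (indexOf_lt hi2 hj2 hd)⟩
  simp only [headsOf, List.mem_map, List.mem_filter, decide_eq_true_eq]
  constructor
  · rintro ⟨⟨⟨v', u⟩, q⟩, ⟨he, hk⟩, rfl⟩
    rw [(h.isNode he).1.key_eq_iff hj2 hd] at hk
    obtain ⟨rfl, rfl, hk⟩ := hk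
    exact ⟨v', by simp only at hk; omega, (h.mem_iff _).1 he⟩
  · rintro ⟨v', hv', he⟩
    refine ⟨((v', (i, j)), q), ⟨(h.mem_iff _).2 he, ?_⟩, rfl⟩
    rw [(isNode_of_edgeG he.1).1.key_eq_iff hj2 hd]
    exact ⟨rfl, rfl, by simp only; omega⟩

theorem arraySize_le (h : StoresGraph A B es s) :
    arraySize A B s ≤ 2 * numKeys A.length B.length + 1 := by
  have h1 := h.seqs.offs _ le_rfl
  have h2 := keyOffset_le_length (edgeKeys A B es) (numKeys A.length B.length)
  rw [length_edgeKeys] at h2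
  have := h.length_le
  rw [arraySize, h1]
  omega

end StoresGraph

end Enum331

end MCS

namespace MCS

/-! ### Depth-first enumeration of the paths to a target. -/

section DepthFirst

variable {V : Type*} [DecidableEq V] (succ : V → List V) (t : V)

/-- The paths from a vertex to `t` with at most `f` vertices, in depth-first order. -/
def enumPaths : ℕ → V → List (List V)
  | 0, _ => []
  | f + 1, v => if v = t then [[v]] else
      (succ v).flatMap fun w => (enumPaths f w).map (v :: ·)

variable {succ t}

theorem head?_of_mem_enumPaths {f : ℕ} {v : V} {P : List V} (h : P ∈ enumPaths succ t f v) :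
    P.head? = some v := by
  cases f with
  | zero => simp [enumPaths] at h
  | succ f =>
    rw [enumPaths] at h
    split_ifs at h with hv
    · rw [List.mem_singleton] at h; rw [h]; rfl
    · simp only [List.mem_flatMap, List.mem_map] at h
      obtain ⟨w, -, Q, -, rfl⟩ := h
      rfl

/-- Paths obtained through different successors differ in their second vertex. -/
theorem nodup_enumPaths (hs : ∀ v, (succ v).Nodup) (f : ℕ) (v : V) :
    (enumPaths succ t f v).Nodup := by
  induction f generalizing v with
  | zero => simp [enumPaths]
  | succ f ih =>
    rw [enumPaths]
    split_ifs with hv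
    · simp
    · rw [List.nodup_flatMap]
      refine ⟨fun w _ => (ih w).map fun P Q h => List.tail_eq_of_cons_eq h, ?_⟩
      refine (hs v).imp fun {a b} hab => ?_
      simp only [Function.onFun, List.Disjoint, List.mem_map]
      rintro _ ⟨P, hP, rfl⟩ ⟨Q, hQ, h⟩
      obtain rfl := List.tail_eq_of_cons_eq h
      have h1 := head?_of_mem_enumPaths hP
      have h2 := head?_of_mem_enumPaths hQ
      exact hab (Option.some.inj (h1.symm.trans h2))

/-- The rank decreases along edges, so fuel beyond the rank of the starting vertex is never
consumed. This removes the fuel from the recursion in `enumPaths_rank`. -/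
theorem enumPaths_succ_eq {rank : V → ℕ} (hr : ∀ v, ∀ w ∈ succ v, rank w < rank v) {f : ℕ} {v : V}
    (h : rank v < f) : enumPaths succ t f v = enumPaths succ t (rank v + 1) v := by
  induction f using Nat.strong_induction_on generalizing v with
  | _ f ih =>
    obtain ⟨f, rfl⟩ : ∃ g, f = g + 1 := ⟨f - 1, by omega⟩
    rw [enumPaths, enumPaths]
    split_ifs
    · rfl
    · refine List.flatMap_congr fun w hw => ?_
      have := hr v w hw
      rw [ih f (by omega) (by omega)]
      by_cases hf : f = rank v
      · rw [← hf, ih f (by omega) (by omega)]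
      · rw [ih (rank v) (by omega) (by omega)]

theorem enumPaths_rank {rank : V → ℕ} (hr : ∀ v, ∀ w ∈ succ v, rank w < rank v) (v : V) :
    enumPaths succ t (rank v + 1) v = if v = t then [[v]] else
      (succ v).flatMap fun w => (enumPaths succ t (rank w + 1) w).map (v :: ·) := by
  rw [enumPaths]
  split_ifs
  · rfl
  · refine List.flatMap_congr fun w hw => ?_
    rw [enumPaths_succ_eq hr (hr v w hw)]

/-- The enumeration stops as soon as it meets `t`; by `ht` no path that passes through `t` and goes
on is missed. -/
theorem mem_enumPaths {rank : V → ℕ} (hr : ∀ v, ∀ w ∈ succ v, rank w < rank v)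
    (ht : succ t = []) {f : ℕ} {v : V} {P : List V} (hf : rank v < f) :
    P ∈ enumPaths succ t f v ↔
      P.head? = some v ∧ P.getLast? = some t ∧ P.IsChain (fun a b => b ∈ succ a) := by
  induction f generalizing v P with
  | zero => omega
  | succ f ih =>
    rw [enumPaths]
    rcases P with _ | ⟨v', P⟩
    · split_ifs <;> simp
    rcases P with _ | ⟨w, P⟩
    · split_ifs with hv
      · subst hv; simp
      · have : ∀ w, [] ∉ enumPaths succ t f w := fun w h => by
          simpa using head?_of_mem_enumPaths h
        simp [this]
        rintro rfl; exact hv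
    · split_ifs with hv
      · subst hv
        simp
        rintro rfl - h
        simp [ht] at h
      · simp only [List.mem_flatMap, List.mem_map, List.cons.injEq, List.head?_cons,
          Option.some.injEq, List.getLast?_cons_cons, List.isChain_cons_cons]
        constructor
        · rintro ⟨w', hw, Q, hQ, rfl, rfl⟩
          have := hr _ _ hw
          obtain ⟨h1, h2, h3⟩ := (ih (by omega)).1 hQ
          obtain rfl : w = w' := by simpa using h1
          exact ⟨rfl, h2, hw, h3⟩
        · rintro ⟨rfl, h2, hw, h3⟩
          have := hr _ _ hw
          exact ⟨w, hw, _, (ih (by omega)).2 ⟨rfl, h2, h3⟩, rfl, rfl⟩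

end DepthFirst

/-! ### The list of paths still to be output, and how it evolves. -/

section Trails

variable {V : Type*} (succ : V → List V)

/-- The vertices of a trail, which is a list of vertices with positions of edges that leave them,
the last one first. -/
def trailPrefix (tr : List (V × ℕ)) : List V := (tr.map Prod.fst).reverse

/-- The paths that come after those with the edges of the trail. -/
def laterPaths (paths : V → List (List V)) : List (V × ℕ) → List (List V)
  | [] => []
  | (u, r) :: tr => ((succ u).drop (r + 1)).flatMap
      (fun w => (paths w).map (trailPrefix ((u, r) :: tr) ++ ·)) ++ laterPaths paths tr

/-- The trail leads from `a` to `v`. -/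
def IsTrail (a : V) : V → List (V × ℕ) → Prop
  | v, [] => v = a
  | v, (u, r) :: tr => (succ u)[r]? = some v ∧ IsTrail a u tr

/-- The paths to be output when the trail leads to `v`. -/
def remainingPaths (paths : V → List (List V)) (v : V) (tr : List (V × ℕ)) : List (List V) :=
  (paths v).map (trailPrefix tr ++ ·) ++ laterPaths succ paths tr

variable {succ}

theorem trailPrefix_cons (u : V) (r : ℕ) (tr : List (V × ℕ)) :
    trailPrefix ((u, r) :: tr) = trailPrefix tr ++ [u] := by
  simp [trailPrefix]

theorem length_trailPrefix (tr : List (V × ℕ)) : (trailPrefix tr).length = tr.length := by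
  simp [trailPrefix]

variable {paths : V → List (List V)}

/-- Going along the first edge only regroups the list: the paths through the other successors become
later paths of the longer trail. This and the next three identities mirror the steps of the program;
only arrival at the target takes a path off the list. -/
theorem remainingPaths_extend [DecidableEq V] {t : V}
    (hp : ∀ v, paths v = if v = t then [[v]] else (succ v).flatMap fun w => (paths w).map (v :: ·))
    {v w : V} (hv : v ≠ t) (hw : (succ v)[0]? = some w)
    (tr : List (V × ℕ)) :
    remainingPaths succ paths v tr = remainingPaths succ paths w ((v, 0) :: tr) := by
  obtain ⟨ws, hs⟩ : ∃ ws, succ v = w :: ws := by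
    cases h : succ v with
    | nil => simp [h] at hw
    | cons x xs => exact ⟨xs, by simp_all⟩
  simp only [remainingPaths]
  rw [hp v, if_neg hv, laterPaths, hs]
  simp only [trailPrefix_cons, List.flatMap_cons, List.map_append, List.drop_succ_cons,
    List.drop_zero, List.append_assoc, List.map_map, List.map_flatMap, zero_add]
  simp [Function.comp_def]

theorem remainingPaths_target [DecidableEq V] {t : V}
    (hp : ∀ v, paths v = if v = t then [[v]] else (succ v).flatMap fun w => (paths w).map (v :: ·))
    (tr : List (V × ℕ)) :
    remainingPaths succ paths t tr = (trailPrefix tr ++ [t]) :: laterPaths succ paths tr := by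
  rw [remainingPaths, hp, if_pos rfl]
  rfl

theorem laterPaths_pop {u : V} {r : ℕ} (h : (succ u).length ≤ r + 1) (tr : List (V × ℕ)) :
    laterPaths succ paths ((u, r) :: tr) = laterPaths succ paths tr := by
  rw [laterPaths, List.drop_of_length_le h]
  rfl

theorem laterPaths_advance {u w : V} {r : ℕ} (h : (succ u)[r + 1]? = some w)
    (tr : List (V × ℕ)) :
    laterPaths succ paths ((u, r) :: tr) = remainingPaths succ paths w ((u, r + 1) :: tr) := by
  obtain ⟨hl, rfl⟩ := List.getElem?_eq_some_iff.1 h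
  rw [laterPaths, remainingPaths, laterPaths, List.drop_eq_getElem_cons hl, List.flatMap_cons,
    List.append_assoc]
  simp [trailPrefix_cons]

end Trails

/-! ### Successor lists of the stored graph. -/

namespace Enum331

variable {A B : List ℕ} {es : List (Vertex × Vertex)} {s : State Var Arr}

/-- The heads of the edges with tail `v`. -/
def succs (es : List (Vertex × Vertex)) (v : Vertex) : List Vertex :=
  (es.filter (fun e => e.1 = v)).map Prod.snd

namespace StoresGraph

theorem mem_succs (h : StoresGraph A B es s) {v w : Vertex} :
    w ∈ succs es v ↔ AllMCSEdge A B v w := by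
  simp only [succs, List.mem_map, List.mem_filter, decide_eq_true_eq]
  constructor
  · rintro ⟨e, ⟨he, rfl⟩, rfl⟩
    exact (h.mem_iff e).1 he
  · exact fun hpq => ⟨(v, w), ⟨(h.mem_iff (v, w)).2 hpq, rfl⟩, rfl⟩

theorem nodup_succs (h : StoresGraph A B es s) (v : Vertex) : (succs es v).Nodup := by
  refine (h.nodup.filter _).map_on ?_
  intro e he e' he' heq
  simp only [List.mem_filter, decide_eq_true_eq] at he he'
  exact Prod.ext (he.2.trans he'.2.symm) heq

theorem headsOf_key (h : StoresGraph A B es s) {v : Vertex} (hv : IsNode A B v) :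
    headsOf A B es (key A.length B.length v) = succs es v := by
  rw [headsOf, succs]
  congr 1
  refine List.filter_congr fun e he => ?_
  rw [decide_eq_decide]
  exact ⟨fun hk => key_injOn (h.isNode he).1 hv hk, fun hk => by rw [hk]⟩

/-- The second match climbs strictly and stays within `A`, so the truncated difference really
decreases. -/
theorem rank_lt (h : StoresGraph A B es s) (v : Vertex) :
    ∀ w ∈ succs es v, A.length - w.2.1 < A.length - v.2.1 := by
  intro w hw
  have h1 := (h.mem_succs.1 hw).1
  have h2 := h1.below.1
  have h3 := (isNode_of_edgeG h1).2.fst_le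
  have h4 := (isNode_of_edgeG h1).2.fst_le_fst
  omega

theorem succs_sink (h : StoresGraph A B es s) : succs es (sink A B) = [] := by
  rw [List.eq_nil_iff_forall_not_mem]
  intro w hw
  have h1 := (h.mem_succs.1 hw).1
  have h2 := h1.below.1
  have h3 := (isNode_of_edgeG h1).2.fst_le
  have h4 := (isNode_of_edgeG h1).2.fst_le_fst
  simp only [sink] at h2
  omega

end StoresGraph

/-- The paths of the all-MCS graph from `v` to the sink, in the order of the algorithm. -/
def pathsToSink (A B : List ℕ) (es : List (Vertex × Vertex)) (v : Vertex) : List (List Vertex) :=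
  enumPaths (succs es) (sink A B) (A.length - v.2.1 + 1) v

namespace StoresGraph

theorem pathsToSink_eq (h : StoresGraph A B es s) (v : Vertex) :
    pathsToSink A B es v = if v = sink A B then [[v]] else
      (succs es v).flatMap fun w => (pathsToSink A B es w).map (v :: ·) :=
  enumPaths_rank (rank := fun w : Vertex => A.length - w.2.1) h.rank_lt v

theorem nodup_pathsToSink (h : StoresGraph A B es s) (v : Vertex) :
    (pathsToSink A B es v).Nodup := nodup_enumPaths h.nodup_succs _ _

theorem mem_pathsToSink (h : StoresGraph A B es s) {P : List Vertex} :
    P ∈ pathsToSink A B es source ↔ IsSourceSinkPath A B P := by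
  have : (fun a b => b ∈ succs es a) = AllMCSEdge A B := by
    ext a b; exact h.mem_succs
  rw [pathsToSink, mem_enumPaths (rank := fun w : Vertex => A.length - w.2.1) h.rank_lt
    h.succs_sink (by simp), this]
  rfl

theorem offset (h : StoresGraph A B es s) {v : Vertex} (hv : IsNode A B v) :
    s.mem .G2 (key A.length B.length v) =
        keyOffset (edgeKeys A B es) (key A.length B.length v) ∧
      s.mem .G2 (key A.length B.length v + 1) =
        keyOffset (edgeKeys A B es) (key A.length B.length v) + (succs es v).length := by
  have h1 := h.seqs.offs _ hv.key_lt.le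
  have h2 := h.seqs.offs _ hv.key_lt
  have h3 := h.storedSeq_eq hv.key_lt
  have h4 := congrArg List.length h3
  rw [storedSeq, h.headsOf_key hv, List.length_map, List.length_range', List.length_map, h1, h2,
    keyOffset_succ] at h4
  exact ⟨h1, by rw [h2, keyOffset_succ]; omega⟩

theorem seqG2_eq (h : StoresGraph A B es s) {v w : Vertex} (hv : IsNode A B v) {r : ℕ}
    (hr : (succs es v)[r]? = some w) :
    s.mem .seqG2 (keyOffset (edgeKeys A B es) (key A.length B.length v) + r) =
      key A.length B.length w := by
  obtain ⟨hl, rfl⟩ := List.getElem?_eq_some_iff.1 hr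
  have h3 := h.storedSeq_eq hv.key_lt
  rw [storedSeq, h.headsOf_key hv, (h.offset hv).1, (h.offset hv).2, Nat.add_sub_cancel_left] at h3
  have h4 : ((List.range' (keyOffset (edgeKeys A B es) (key A.length B.length v))
      (succs es v).length).map (s.mem .seqG2))[r]? =
      ((succs es v).map (key A.length B.length))[r]? := by rw [h3]
  rw [List.getElem?_map, List.getElem?_map, List.getElem?_range' (by simpa using hl),
    List.getElem?_eq_getElem hl] at h4
  simpa using h4

theorem offset_le (h : StoresGraph A B es s) {v : Vertex} (hv : IsNode A B v) :
    keyOffset (edgeKeys A B es) (key A.length B.length v) + (succs es v).length ≤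
      numKeys A.length B.length := by
  rw [← (h.offset hv).2, h.seqs.offs _ hv.key_lt]
  have := keyOffset_le_length (edgeKeys A B es) (key A.length B.length v + 1)
  rw [length_edgeKeys] at this
  exact this.trans h.length_le

end StoresGraph

end Enum331

end MCS

namespace MCS

/-! ### The enumeration phase and its delay. -/

namespace Enum331

open Var Arr

variable {M W : ℕ} {A B cs : List ℕ} {es : List (Vertex × Vertex)} {s : State Var Arr}

/-- Everything that the enumeration needs is in memory. -/
structure Ready (A B cs : List ℕ) (es : List (Vertex × Vertex)) (s : State Var Arr) : Prop where
  lx : s.reg lx = A.length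
  ly : s.reg ly = B.length
  X : ∀ i, 1 ≤ i → i ≤ A.length → s.mem X i = charAt A i
  row : ∀ i j d, i ≤ A.length → j ≤ B.length → d < A.length + B.length →
    s.mem row ((i * (B.length + 1) + j) * (A.length + B.length) + d) = i
  cat : ∀ i < cs.length, s.mem cat i = cs.getD i 0
  graph : StoresGraph A B es s

theorem Ready.congr {s' : State Var Arr} (h : Ready A B cs es s)
    (hr : ∀ x ∈ [Var.lx, Var.ly], s'.reg x = s.reg x)
    (ha : ∀ a ∈ [Arr.X, Arr.row, Arr.cat, Arr.G2, Arr.seqG2], s'.mem a = s.mem a) :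
    Ready A B cs es s' := by
  simp only [List.mem_cons, List.not_mem_nil, or_false, forall_eq_or_imp, forall_eq] at hr ha
  obtain ⟨r1, r2⟩ := hr
  obtain ⟨a1, a2, a3, a4, a5⟩ := ha
  constructor
  · rw [r1]; exact h.lx
  · rw [r2]; exact h.ly
  · rw [a1]; exact h.X
  · rw [a2]; exact h.row
  · rw [a3]; exact h.cat
  · exact ⟨h.graph.nodup, h.graph.mem_iff, h.graph.length_le, by rw [a4, a5]; exact h.graph.seqs⟩

theorem Ready.row_key (h : Ready A B cs es s) {w : Vertex} (hw : IsNode A B w) :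
    s.mem Arr.row (key A.length B.length w) = w.2.1 := by
  obtain ⟨h1, h2, h3, h4, h5, h6, -⟩ := hw
  exact h.row _ _ _ (by omega) (by omega) (by omega)

/-- The vertices and edges of the trail are on the stack. -/
def OnStack (A B : List ℕ) (es : List (Vertex × Vertex)) (mem : Arr → ℕ → ℕ) :
    List (Vertex × ℕ) → Prop
  | [] => True
  | (u, i) :: tr => mem vert tr.length = key A.length B.length u ∧
      mem ptr tr.length = keyOffset (edgeKeys A B es) (key A.length B.length u) + i ∧
      OnStack A B es mem tr

theorem OnStack.congr {mem mem' : Arr → ℕ → ℕ} {tr : List (Vertex × ℕ)}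
    (h : OnStack A B es mem tr)
    (hm : ∀ i < tr.length, mem' vert i = mem vert i ∧ mem' ptr i = mem ptr i) :
    OnStack A B es mem' tr := by
  induction tr with
  | nil => trivial
  | cons e tr ih =>
    obtain ⟨h1, h2, h3⟩ := h
    have := hm tr.length (by simp)
    exact ⟨this.1.trans h1, this.2.trans h2, ih h3 fun i hi => hm i (by simp; omega)⟩

theorem OnStack.vert_eq {mem : Arr → ℕ → ℕ} {tr : List (Vertex × ℕ)} (h : OnStack A B es mem tr)
    {k : ℕ} (hk : k < tr.length) :
    mem vert k = key A.length B.length ((trailPrefix tr)[k]'(by rwa [length_trailPrefix])) := by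
  induction tr with
  | nil => simp at hk
  | cons e tr ih =>
    obtain ⟨u, r⟩ := e
    obtain ⟨h1, h2, h3⟩ := h
    simp only [List.length_cons] at hk
    simp only [trailPrefix_cons]
    by_cases hkl : k = tr.length
    · subst hkl
      rw [h1, List.getElem_append_right (by rw [length_trailPrefix])]
      simp
    · rw [List.getElem_append_left (by rw [length_trailPrefix]; omega)]
      exact ih h3 (by omega)

/-- The current path is the trail to `v`. -/
structure AtVertex (A B : List ℕ) (es : List (Vertex × Vertex)) (v : Vertex)
    (tr : List (Vertex × ℕ)) (s : State Var Arr) : Prop where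
  trail : IsTrail (succs es) source v tr
  len : s.reg len = tr.length
  vert : s.mem vert tr.length = key A.length B.length v
  stack : OnStack A B es s.mem tr

/-- The vertex lies on a path from the source to the sink. -/
structure OnPath (A B : List ℕ) (v : Vertex) : Prop where
  isNode : IsNode A B v
  reach : Relation.ReflTransGen (EdgeG A B) source v
  coreach : Relation.ReflTransGen (EdgeG A B) v (sink A B)

/-- A trail starts at coordinate 1 and every edge adds at least one, so its length is below `v.2.1`;
this bounds the stack as well as the time. -/
theorem onPath_of_isTrail (hG : StoresGraph A B es s) (h0 : OnPath A B source) {v : Vertex}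
    {tr : List (Vertex × ℕ)} (h : IsTrail (succs es) source v tr) :
    OnPath A B v ∧ tr.length < v.2.1 ∧ ∀ u ∈ trailPrefix tr, OnPath A B u := by
  induction tr generalizing v with
  | nil =>
    obtain rfl : v = source := h
    exact ⟨h0, by simp [source], by simp [trailPrefix]⟩
  | cons e tr ih =>
    obtain ⟨u, r⟩ := e
    obtain ⟨h1, h2⟩ := h
    obtain ⟨h3, h4, h5⟩ := ih h2
    have h6 := hG.mem_succs.1 (List.mem_of_getElem? h1)
    have h7 := h6.1.below.1
    refine ⟨⟨(isNode_of_edgeG h6.1).2, h6.2.1.tail h6.1, h6.2.2⟩, by simp; omega, ?_⟩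
    intro w hw
    rw [trailPrefix_cons, List.mem_append, List.mem_singleton] at hw
    rcases hw with hw | rfl
    · exact h5 w hw
    · exact h3

/-- There are no dead ends: the first edge of a walk to the sink is itself an edge of the all-MCS
graph. -/
theorem exists_succs_of_onPath (hG : StoresGraph A B es s) {v : Vertex} (hv : OnPath A B v)
    (hne : v ≠ sink A B) : ∃ w, (succs es v)[0]? = some w := by
  rcases hv.coreach.cases_head with h | ⟨w, h1, h2⟩
  · exact absurd h hne
  · have : w ∈ succs es v := hG.mem_succs.2 ⟨h1, hv.reach, h2⟩
    have := List.length_pos_of_mem this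
    exact ⟨_, List.getElem?_eq_getElem this⟩

theorem key_eq_sink_iff {v : Vertex} (hv : IsNode A B v) (hA : 2 ≤ A.length) (hB : 2 ≤ B.length) :
    key A.length B.length v = key A.length B.length (sink A B) ↔ v = sink A B :=
  ⟨fun h => key_injOn hv (isNode_sink hA hB) h, fun h => by rw [h]⟩

theorem extendPath_spec (hA : 2 ≤ A.length) (hB : 2 ≤ B.length) (h0 : OnPath A B source)
    (hM : numKeys A.length B.length < M) (hW : numKeys A.length B.length < W)
    (hR : Ready A B cs es s) {v : Vertex} {tr : List (Vertex × ℕ)} (hv : AtVertex A B es v tr s) :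
    WP M W extendPath (fun s' => s'.clock ≤ s.clock + 60 * (A.length + 1) ∧
      ∃ tr' : List (Vertex × ℕ), AtVertex A B es (sink A B) tr' s' ∧
        remainingPaths (succs es) (pathsToSink A B es) v tr =
          remainingPaths (succs es) (pathsToSink A B es) (sink A B) tr') s := by
  have hNK := length_add_length_le A.length B.length
  unfold extendPath
  -- Time is charged to the length of the whole trail, which is less than `|A|`, although only the
  -- new edges cost anything.
  refine WP.loop (fun s' => Ready A B cs es s' ∧ ∃ v' tr', AtVertex A B es v' tr' s' ∧
      remainingPaths (succs es) (pathsToSink A B es) v tr =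
        remainingPaths (succs es) (pathsToSink A B es) v' tr' ∧
      s'.clock ≤ s.clock + 60 * tr'.length) (fun s' => A.length - s'.reg len)
    ⟨hR, v, tr, hv, rfl, by omega⟩ ?_ ?_ ?_
  · rintro s' ⟨hR', v', tr', hv', -, -⟩
    obtain ⟨hp, hl, -⟩ := onPath_of_isTrail hR'.graph h0 hv'.trail
    have := hp.isNode.fst_le
    have := hp.isNode.fst_le_fst
    have hk := (sinkKey_eval (M := M) hR'.lx hR'.ly).1
    simp only [Test.InBounds, Expr.InBounds, Expr.eval, hv'.len]
    exact ⟨⟨trivial, by omega⟩, hk⟩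
  · rintro s' ⟨hR', v', tr', hv', hrem, hc⟩ ht
    obtain ⟨hp, hl, -⟩ := onPath_of_isTrail hR'.graph h0 hv'.trail
    have a1 := hp.isNode.fst_le
    have a2 := hp.isNode.fst_le_fst
    have hne : v' ≠ sink A B := by
      intro h
      apply ht
      simp only [Test.Holds, Expr.eval, hv'.len, hv'.vert, (sinkKey_eval (M := M) hR'.lx hR'.ly).2]
      rw [h]
    obtain ⟨w, hw⟩ := exists_succs_of_onPath hR'.graph hp hne
    have hoff := (hR'.graph.offset hp.isNode).1
    have hoff2 := hR'.graph.offset_le hp.isNode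
    have hseq := hR'.graph.seqG2_eq hp.isNode hw
    have hpos : 0 < (succs es v').length := (List.getElem?_eq_some_iff.1 hw).1
    have hkv := hp.isNode.key_lt
    have htr' : IsTrail (succs es) source w ((v', 0) :: tr') := ⟨hw, hv'.trail⟩
    obtain ⟨hpw, hlw, -⟩ := onPath_of_isTrail hR'.graph h0 htr'
    have hkw := hpw.isNode.key_lt
    have a3 := hpw.isNode.fst_le
    have a4 := hpw.isNode.fst_le_fst
    simp only [List.length_cons] at hlw
    rw [add_zero] at hseq
    have hlen := hv'.len
    have hvert := hv'.vert
    simp only [WP.seq_iff, WP.store_iff, WP.assign_iff, Expr.add_def, Expr.ofNat_def,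
      Expr.InBounds, Expr.eval, Expr.cost, State.tick_reg, State.tick_mem, State.tick_clock,
      State.setMem_reg, State.setMem_mem, State.setMem_clock, State.setReg_reg,
      State.setReg_clock, reduceCtorEq, if_true, if_false, hlen, hvert, hoff, hseq, and_true,
      true_and]
    refine ⟨⟨by omega, by omega⟩, by omega, by omega, ⟨by omega, by omega⟩, by omega, by omega,
      by omega, ⟨hR'.congr (by simp) ?_, w, (v', 0) :: tr', ⟨htr', by simp, ?_, ?_⟩, ?_, ?_⟩,
      by omega⟩
    · simp only [List.mem_cons, List.not_mem_nil, or_false, forall_eq_or_imp, forall_eq]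
      refine ⟨?_, ?_, ?_, ?_, ?_⟩ <;> ext <;> simp
    · simp
    · refine ⟨?_, ?_, hv'.stack.congr fun i hi => ?_⟩
      · simp [hvert]
      · simp
      · have h1 : i ≠ tr'.length := by omega
        have h2 : i ≠ tr'.length + 1 := by omega
        simp [h1, h2]
    · rw [hrem, remainingPaths_extend hR'.graph.pathsToSink_eq hne hw]
    · have : (sinkKey : Expr Var Arr).cost = 17 := by simp [sinkKey, keyOf, indexOf]
      simp only [Test.cost, Expr.cost, this, List.length_cons]
      omega
  · rintro s' ⟨hR', v', tr', hv', hrem, hc⟩ ht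
    obtain ⟨hp, hl, -⟩ := onPath_of_isTrail hR'.graph h0 hv'.trail
    have a1 := hp.isNode.fst_le
    have a2 := hp.isNode.fst_le_fst
    have hv : v' = sink A B := by
      simp only [Test.Holds, Expr.eval, hv'.len, hv'.vert, (sinkKey_eval (M := M) hR'.lx hR'.ly).2,
        not_not] at ht
      exact (key_eq_sink_iff hp.isNode hA hB).1 ht
    subst hv
    refine ⟨?_, tr', ⟨hv'.trail, hv'.len, hv'.vert, hv'.stack⟩, hrem⟩
    have : (sinkKey : Expr Var Arr).cost = 17 := by simp [sinkKey, keyOf, indexOf]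
    simp only [Test.cost, Expr.cost, this, State.tick_clock]
    omega

theorem advancePath_spec (h0 : OnPath A B source)
    (hM : numKeys A.length B.length < M) (hW : numKeys A.length B.length < W)
    (hR : Ready A B cs es s) {v : Vertex} {tr : List (Vertex × ℕ)} (hv : AtVertex A B es v tr s) :
    WP M W advancePath (fun s' => s'.clock ≤ s.clock + 60 * (A.length + 1) ∧
      ((s'.reg run = s.reg run ∧ ∃ v' tr', AtVertex A B es v' tr' s' ∧
        laterPaths (succs es) (pathsToSink A B es) tr =
          remainingPaths (succs es) (pathsToSink A B es) v' tr') ∨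
        (s'.reg run = 0 ∧ laterPaths (succs es) (pathsToSink A B es) tr = []))) s := by
  have hNK := length_add_length_le A.length B.length
  obtain ⟨-, hl0, -⟩ := onPath_of_isTrail hR.graph h0 hv.trail
  have hpv := (onPath_of_isTrail hR.graph h0 hv.trail).1
  have b1 := hpv.isNode.fst_le
  have b2 := hpv.isNode.fst_le_fst
  unfold advancePath
  rw [WP.seq_iff]
  -- The length of the trail is the potential: each removed edge pays 30 for its iteration.
  refine WP.loop (fun s' => Ready A B cs es s' ∧ s'.reg run = s.reg run ∧
      ∃ v' tr', AtVertex A B es v' tr' s' ∧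
        laterPaths (succs es) (pathsToSink A B es) tr =
          laterPaths (succs es) (pathsToSink A B es) tr' ∧
        s'.clock + 30 * tr'.length ≤ s.clock + 30 * tr.length) (fun s' => s'.reg len)
    ⟨hR, rfl, v, tr, hv, rfl, le_rfl⟩ ?_ ?_ ?_
  · rintro s' ⟨hR', -, v', tr', hv', -, -⟩
    obtain ⟨hp, hl, -⟩ := onPath_of_isTrail hR'.graph h0 hv'.trail
    have a1 := hp.isNode.fst_le
    have a2 := hp.isNode.fst_le_fst
    have hlen := hv'.len
    -- The conjunction in the test is not evaluated lazily, so its cells must be in bounds for the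
    -- empty trail too. Truncated subtraction then reads cell 0, which holds the key of the current
    -- vertex.
    have hvk : s'.mem vert (tr'.length - 1) < numKeys A.length B.length := by
      cases tr' with
      | nil => rw [List.length_nil, Nat.zero_sub]; exact hv'.vert ▸ hp.isNode.key_lt
      | cons e tr' =>
        obtain ⟨u, r⟩ := e
        rw [List.length_cons, Nat.add_sub_cancel, hv'.stack.1]
        exact (onPath_of_isTrail hR'.graph h0 hv'.trail.2).1.isNode.key_lt
    simp only [Test.InBounds, Expr.InBounds, Expr.sub_def, Expr.ofNat_def, Expr.eval,
      hlen, and_true, true_and]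
    omega
  · rintro s' ⟨hR', hrun, v', tr', hv', hlat, hc⟩ ht
    rcases tr' with _ | ⟨⟨u, r⟩, tr'⟩
    · simp [hv'.len] at ht
    obtain ⟨hpu, -, -⟩ := onPath_of_isTrail hR'.graph h0 hv'.trail.2
    have hlen := hv'.len
    obtain ⟨k1, k2, k3⟩ := hv'.stack
    rw [List.length_cons] at hlen
    have hoff := (hR'.graph.offset hpu.isNode).2
    simp only [Test.Holds, Expr.sub_def, Expr.ofNat_def, Expr.eval, hlen,
      Nat.add_sub_cancel, k1, k2, hoff] at ht
    simp only [WP.assign_iff, Expr.sub_def, Expr.ofNat_def, Expr.InBounds, Expr.eval,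
      Expr.cost, Test.cost, State.tick_reg, State.tick_clock, State.setReg_reg, State.setReg_clock,
      hlen, if_true, and_true, true_and]
    have hl1 := (onPath_of_isTrail hR'.graph h0 hv'.trail.2).2.1
    have a1 := hpu.isNode.fst_le
    have a2 := hpu.isNode.fst_le_fst
    refine ⟨by omega, ⟨hR'.congr (by simp) (by simp), by simpa using hrun, u, tr',
      ⟨hv'.trail.2, by simp, by simpa using k1, k3⟩, ?_, ?_⟩, by omega⟩
    · rw [hlat, laterPaths_pop]
      omega
    · simp only [List.length_cons] at hc
      omega
  · rintro s' ⟨hR', hrun, v', tr', hv', hlat, hc⟩ ht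
    rw [WP.ite_iff]
    have hlen := hv'.len
    rcases tr' with _ | ⟨⟨u, r⟩, tr'⟩
    · simp only [List.length_nil] at hlen hc
      refine ⟨by simp, fun _ => ?_, fun h => ?_⟩
      · rw [WP.assign_iff]
        refine ⟨by simp, by simp, ?_, .inr ⟨by simp, by rw [hlat]; rfl⟩⟩
        simp
        omega
      · simp [hlen] at h
    · obtain ⟨hpu, -, -⟩ := onPath_of_isTrail hR'.graph h0 hv'.trail.2
      obtain ⟨k1, k2, k3⟩ := hv'.stack
      rw [List.length_cons] at hlen
      have hoff := (hR'.graph.offset hpu.isNode).2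
      have hoff2 := hR'.graph.offset_le hpu.isNode
      simp only [Test.Holds, Expr.sub_def, Expr.ofNat_def, Expr.eval, hlen,
        Nat.add_sub_cancel, k1, k2, hoff] at ht
      have hr : r < (succs es u).length := (List.getElem?_eq_some_iff.1 hv'.trail.1).1
      have hr1 : r + 1 < (succs es u).length := by omega
      have hw := List.getElem?_eq_getElem hr1
      generalize (succs es u)[r + 1] = w at hw
      have htr : IsTrail (succs es) source w ((u, r + 1) :: tr') := ⟨hw, hv'.trail.2⟩
      obtain ⟨hpw, hlw, -⟩ := onPath_of_isTrail hR'.graph h0 htr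
      have hkw := hpw.isNode.key_lt
      have a3 := hpw.isNode.fst_le
      have a4 := hpw.isNode.fst_le_fst
      have hseq := hR'.graph.seqG2_eq hpu.isNode hw
      simp only [List.length_cons] at hlw hc
      refine ⟨by simp, fun h => ?_, fun _ => ?_⟩
      · simp [hlen] at h
      rw [← add_assoc] at hseq
      simp only [WP.seq_iff, WP.store_iff, Expr.add_def, Expr.sub_def, Expr.ofNat_def,
        Expr.InBounds, Expr.eval, Expr.cost, Test.cost, State.tick_reg, State.tick_mem,
        State.tick_clock, State.setMem_reg, State.setMem_mem, State.setMem_clock, reduceCtorEq,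
        if_true, if_false, hlen, Nat.add_sub_cancel, k2, hseq, and_true, true_and]
      refine ⟨by omega, by omega, by omega, ⟨by omega, by omega⟩, by omega, by omega, by omega,
        .inl ⟨hrun, w, (u, r + 1) :: tr', ⟨htr, by simpa using hlen, by simp, ?_⟩, ?_⟩⟩
      · refine ⟨?_, ?_, k3.congr fun i hi => ?_⟩
        · simp [k1]
        · simp [add_assoc]
        · have h1 : i ≠ tr'.length := by omega
          have h2 : i ≠ tr'.length + 1 := by omega
          simp [h1, h2]
      · rw [hlat, laterPaths_advance hw]

variable {X Y Z : List ℕ}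

/-- The shift by one comes from the source, which carries the first sentinel. -/
theorem charAt_path {P : List Vertex}
    (hP : pathString (normalize X Y X) P = normalize X Y Z) {k : ℕ} (h1 : 1 ≤ k)
    (h2 : k + 1 < P.length) :
    ∃ h : k - 1 < Z.length, charAt (normalize X Y X) (P[k]).2.1 = rename X Y Z[k - 1] := by
  have hl : P.length = Z.length + 2 := by
    have := congrArg List.length hP
    simpa [pathString, normalize] using this
  refine ⟨by omega, ?_⟩
  have h3 : (pathString (normalize X Y X) P)[k]? = (normalize X Y Z)[k]? := by rw [hP]
  obtain ⟨k, rfl⟩ : ∃ j, k = j + 1 := ⟨k - 1, by omega⟩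
  rw [pathString, List.getElem?_map, List.getElem?_eq_getElem (by omega), normalize_eq Z,
    List.cons_append, List.getElem?_cons_succ, List.getElem?_append_left (by simp; omega),
    List.getElem?_map, List.getElem?_eq_getElem (by omega)] at h3
  simpa [matchChar] using h3

theorem outputPath_spec (h0 : OnPath (normalize X Y X) (normalize X Y Y) source)
    (hM : numKeys (normalize X Y X).length (normalize X Y Y).length < M)
    (hW : numKeys (normalize X Y X).length (normalize X Y Y).length < W)
    (hXW : ∀ c ∈ X ++ Y, c ≤ W) (hZ : ∀ c ∈ Z, c ∈ X ++ Y)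
    (hR : Ready (normalize X Y X) (normalize X Y Y) (X ++ Y) es s) {tr : List (Vertex × ℕ)}
    {v : Vertex} (hv : AtVertex (normalize X Y X) (normalize X Y Y) es v tr s)
    (hP : pathString (normalize X Y X) (trailPrefix tr ++ [v]) = normalize X Y Z)
    (hbuf : s.buf = []) :
    WP M W outputPath (fun s' =>
      s'.clock ≤ s.clock + 60 * ((normalize X Y X).length + 1) ∧
      s'.buf = [] ∧ s'.out = s.out ++ [(Z, s'.clock)]) s := by
  obtain ⟨hp, hlv, hpre⟩ := onPath_of_isTrail hR.graph h0 hv.trail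
  have hch : ∀ k, 1 ≤ k → k < tr.length → ∃ h : k - 1 < Z.length,
      s.mem vert k < M ∧ s.mem row (s.mem vert k) < M ∧
      s.mem Arr.X (s.mem row (s.mem vert k)) = rename X Y Z[k - 1] := by
    intro k h1 h2
    have hlP : (trailPrefix tr).length = tr.length := length_trailPrefix tr
    obtain ⟨h, h3⟩ := charAt_path hP h1 (by simp [length_trailPrefix]; omega)
    rw [List.getElem_append_left (by omega)] at h3
    have h4 := hpre _ (List.getElem_mem (by omega : k < (trailPrefix tr).length))
    have h5 := hv.stack.vert_eq h2
    have h6 := h4.isNode.key_lt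
    have h7 := hR.row_key h4.isNode
    have h8 := h4.isNode.fst_le
    have h9 := h4.isNode.fst_le_fst
    have h10 := length_add_length_le (normalize X Y X).length (normalize X Y Y).length
    rw [h5, h7]
    refine ⟨h, by omega, by omega, ?_⟩
    rw [hR.X _ h4.isNode.one_le_fst (by omega), h3]
  have hlP : tr.length = Z.length + 1 := by
    have := congrArg List.length hP
    simpa [pathString, normalize, length_trailPrefix] using this
  have hlA := hp.isNode.fst_le
  have hlA' := hp.isNode.fst_le_fst
  have hNK := length_add_length_le (normalize X Y X).length (normalize X Y Y).length
  have hXY : (X ++ Y).length + 2 ≤ (normalize X Y X).length + (normalize X Y Y).length := by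
    simp [normalize]; omega
  have hlen := hv.len
  unfold outputPath
  rw [WP.seq_iff]
  -- Vertex 0 is skipped as the first sentinel, and vertex `tr.length` as the last one. The
  -- invariant speaks of the buffer, so the loop rule over full states is needed.
  refine WP.forRange 1 tr.length (fun i s' => s'.buf = Z.take (i - 1) ∧ s'.out = s.out ∧
    s'.clock ≤ s.clock + 30 * i) (by simp) (by simp) (by omega) (by omega) ?_ ?_ ?_ ?_
  · simp [hbuf]
  · intro i s' hF _ _ _ _
    have := hF.reg len (by simp)
    simp [this, hlen]
  · rintro i s' hF hi h1 h2 ⟨hb, ho, hc⟩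
    obtain ⟨h3, h4, h5, h6⟩ := hch i h1 h2
    have hmem : s'.mem = s.mem := by ext a : 1; exact hF.mem a (by simp)
    have hZm := hZ _ (List.getElem_mem h3)
    have hidx := List.idxOf_lt_length_iff.2 hZm
    have hcat : s.mem cat (rename X Y Z[i - 1] - 2) = Z[i - 1] := by
      rw [rename, Nat.add_sub_cancel, hR.cat _ hidx]
      have := restore_rename hZm
      rwa [restore, rename, Nat.add_sub_cancel] at this
    have hr : rename X Y Z[i - 1] - 2 < M := by
      rw [rename, Nat.add_sub_cancel]; omega
    simp only [WP.emit_iff, Expr.sub_def, Expr.ofNat_def, Expr.InBounds, Expr.eval, Expr.cost,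
      State.tick_reg, State.tick_mem, hi, hmem, h6, hcat, and_true, true_and]
    refine ⟨⟨⟨⟨by omega, h4⟩, h5⟩, hr⟩, hXW _ hZm, ?_, ?_, ?_⟩
    · have : i + 1 - 1 = (i - 1) + 1 := by omega
      rw [this, List.take_succ_eq_append_getElem h3]
      simp [hb]
    · simpa using ho
    · simp; omega
  · rintro s' hF hi ⟨hb, ho, hc⟩
    rw [WP.finish_iff]
    rw [hlP, Nat.add_sub_cancel, List.take_length] at hb
    simp [hb, ho]
    omega

/-- An upper bound for the time between two outputs. -/
def delayBound (A : List ℕ) : ℕ := 300 * (A.length + 1)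

theorem enumeration_spec (h0 : OnPath (normalize X Y X) (normalize X Y Y) source)
    (hM : numKeys (normalize X Y X).length (normalize X Y Y).length < M)
    (hW : numKeys (normalize X Y X).length (normalize X Y Y).length < W)
    (hXW : ∀ c ∈ X ++ Y, c ≤ W)
    (hR : Ready (normalize X Y X) (normalize X Y Y) (X ++ Y) es s) (hbuf : s.buf = [])
    (hout : s.out = []) :
    WP M W enumeration (fun s' => s'.buf = [] ∧
      (pathsToSink (normalize X Y X) (normalize X Y Y) es source).map
        (pathString (normalize X Y X)) = s'.out.map (fun o => normalize X Y o.1) ∧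
      (∀ o ∈ s'.out, (∀ c ∈ o.1, c ∈ X ++ Y) ∧ IsMCS X Y o.1) ∧
      (s.clock :: s'.out.map Prod.snd ++ [s'.clock]).IsChain
        (fun t t' => t' ≤ t + delayBound (normalize X Y X))) s := by
  have hNK := length_add_length_le (normalize X Y X).length (normalize X Y Y).length
  have hA : 2 ≤ (normalize X Y X).length := by simp [normalize]
  have hB : 2 ≤ (normalize X Y Y).length := by simp [normalize]
  have hG := hR.graph
  have hpaths := fun P => hG.mem_pathsToSink (P := P)
  have hk0 := h0.isNode.key_lt
  obtain ⟨i1, i2⟩ := sourceKey_eval (M := M) (s := (s.setReg len 0).tick 2) hR.lx hR.ly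
  have hcost : (sourceKey : Expr Var Arr).cost = 17 := by simp [sourceKey, keyOf, indexOf]
  unfold enumeration
  rw [WP.seq_iff, WP.assign_iff, WP.seq_iff, WP.store_iff, WP.seq_iff, WP.assign_iff]
  refine ⟨by simp, by simp, by simp, i1, by simp; omega, by
    rw [show Expr.cost (0 : Expr Var Arr) + 1 = 2 from rfl]
    exact i2.le.trans (by omega), by simp, by simp; omega, ?_⟩
  generalize hs0 : State.tick _ _ = s0
  have hv0 : AtVertex (normalize X Y X) (normalize X Y Y) es source [] s0 := by
    subst hs0
    refine ⟨rfl, by simp, ?_, trivial⟩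
    simpa using i2
  have hR0 : Ready (normalize X Y X) (normalize X Y Y) (X ++ Y) es s0 := by
    subst hs0
    refine hR.congr (by simp) ?_
    simp only [List.mem_cons, List.not_mem_nil, or_false, forall_eq_or_imp, forall_eq]
    refine ⟨?_, ?_, ?_, ?_, ?_⟩ <;> ext <;> simp
  have hc0 : s0.clock ≤ s.clock + 30 := by subst hs0; simp [hcost]
  have hb0 : s0.buf = [] := by subst hs0; simpa using hbuf
  have ho0 : s0.out = [] := by subst hs0; simpa using hout
  have hr0 : s0.reg run = 1 := by subst hs0; simp
  clear hs0 i1 i2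
  generalize hN : (normalize X Y X).length + 1 = N
  have hD : delayBound (normalize X Y X) = 300 * N := by rw [delayBound, hN]
  rw [hD]
  -- The paths already output followed by `remainingPaths` always make up the complete enumeration.
  -- At the head of the loop at most `100 * N` units have passed since the last output or the end of
  -- the preprocessing; extension and output take at most `60 * N` each, which with the test fits
  -- into `300 * N`.
  refine WP.loop (fun s' => Ready (normalize X Y X) (normalize X Y Y) (X ++ Y) es s' ∧
    s'.buf = [] ∧ (∀ o ∈ s'.out, (∀ c ∈ o.1, c ∈ X ++ Y) ∧ IsMCS X Y o.1) ∧
    (s.clock :: s'.out.map Prod.snd).IsChain (fun t t' => t' ≤ t + 300 * N) ∧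
    (∃ a, (s.clock :: s'.out.map Prod.snd).getLast? = some a ∧ s'.clock ≤ a + 100 * N) ∧
    ∃ done : List (List Vertex), done.map (pathString (normalize X Y X)) =
        s'.out.map (fun o => normalize X Y o.1) ∧
      ((s'.reg run = 1 ∧ ∃ v tr, AtVertex (normalize X Y X) (normalize X Y Y) es v tr s' ∧
          pathsToSink (normalize X Y X) (normalize X Y Y) es source = done ++
            remainingPaths (succs es) (pathsToSink (normalize X Y X) (normalize X Y Y) es) v tr) ∨
        (s'.reg run = 0 ∧
          pathsToSink (normalize X Y X) (normalize X Y Y) es source = done)))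
    (fun s' => (pathsToSink (normalize X Y X) (normalize X Y Y) es source).length - s'.out.length)
    ?_ ?_ ?_ ?_
  · refine ⟨hR0, hb0, by simp [ho0], by simp [ho0], ⟨s.clock, by simp [ho0], by omega⟩, [],
      by simp [ho0], .inl ⟨hr0, source, [], hv0, ?_⟩⟩
    simp [remainingPaths, laterPaths, trailPrefix]
  · intro s' _; simp
  · rintro s' ⟨hR', hb', hmcs, hch, ⟨a, ha, hca⟩, done, hd, hrun⟩ ht
    rcases hrun with ⟨hr1, v, tr, hv, hall⟩ | ⟨hr1, -⟩
    swap
    · simp [hr1] at ht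
    have hRt : Ready (normalize X Y X) (normalize X Y Y) (X ++ Y) es
        (s'.tick ((Test.lt (0 : Expr Var Arr) run).cost + 1)) := hR'.congr (by simp) (by simp)
    refine WP.seq_mono (extendPath_spec hA hB h0 hM hW hRt
      ⟨hv.trail, hv.len, hv.vert, hv.stack⟩) ?_
    rintro s1 hF1 ⟨hc1, tr1, hv1, hrem⟩
    rw [hrem, remainingPaths_target hG.pathsToSink_eq] at hall
    have hR1 : Ready (normalize X Y X) (normalize X Y Y) (X ++ Y) es s1 :=
      hRt.congr (fun x hx => hF1.reg x (by revert x; simp [extendPath]))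
        (fun x hx => hF1.mem x (by revert x; simp [extendPath]))
    -- The completed path is the next one in the enumeration, hence a source-to-sink path, hence the
    -- path of some MCS `Z`.
    have hP := (hpaths (trailPrefix tr1 ++ [sink (normalize X Y X) (normalize X Y Y)])).1 (by
      rw [hall]; simp)
    obtain ⟨Z, hZ, hPZ, hZm⟩ := exists_eq_normalize_of_path hP
    obtain ⟨o1, o2⟩ := hF1.out (by simp [extendPath])
    refine WP.seq_mono (outputPath_spec h0 hM hW hXW hZ hR1 hv1 hPZ (o2.trans hb')) ?_
    rintro s2 hF2 ⟨hc2, hb2, hout2⟩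
    have hmem2 : s2.mem = s1.mem := by ext x : 1; exact hF2.mem x (by simp [outputPath])
    have hR2 : Ready (normalize X Y X) (normalize X Y Y) (X ++ Y) es s2 :=
      hR1.congr (fun x hx => hF2.reg x (by revert x; simp [outputPath]))
        (fun x hx => by rw [hmem2])
    have hv2 : AtVertex (normalize X Y X) (normalize X Y Y) es
        (sink (normalize X Y X) (normalize X Y Y)) tr1 s2 :=
      ⟨hv1.trail, (hF2.reg _ (by simp [outputPath])).trans hv1.len, by rw [hmem2]; exact hv1.vert,
        by rw [hmem2]; exact hv1.stack⟩
    refine (advancePath_spec h0 hM hW hR2 hv2).mono_frame ?_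
    rintro s3 hF3 ⟨hc3, hrun3⟩
    have hR3 : Ready (normalize X Y X) (normalize X Y Y) (X ++ Y) es s3 :=
      hR2.congr (fun x hx => hF3.reg x (by revert x; simp [advancePath]))
        (fun x hx => hF3.mem x (by revert x; simp [advancePath]))
    obtain ⟨o3, o4⟩ := hF3.out (by simp [advancePath])
    have hout3 : s3.out = s'.out ++ [(Z, s2.clock)] := by rw [o3, hout2, o1]; rfl
    have hrun2 : s2.reg run = 1 := by
      rw [hF2.reg _ (by simp [outputPath]), hF1.reg _ (by simp [extendPath])]; exact hr1
    rw [hN] at hc1 hc2 hc3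
    simp only [Test.cost, Expr.cost, State.tick_clock] at hc1
    have hNpos : 1 ≤ N := by omega
    refine ⟨⟨hR3, o4.trans hb2, ?_, ?_, ⟨s2.clock, ?_, by omega⟩,
      done ++ [trailPrefix tr1 ++ [sink (normalize X Y X) (normalize X Y Y)]], ?_, ?_⟩, ?_⟩
    · intro o ho
      rw [hout3, List.mem_append, List.mem_singleton] at ho
      rcases ho with ho | rfl
      · exact hmcs o ho
      · exact ⟨hZ, hZm⟩
    · rw [hout3, List.map_append, ← List.cons_append]
      refine hch.append (by simp) fun x hx y hy => ?_
      rw [ha, Option.mem_some_iff] at hx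
      obtain rfl : s2.clock = y := by simpa using hy
      omega
    · rw [hout3, List.map_append, ← List.cons_append]
      exact List.getLast?_concat
    · rw [hout3, List.map_append, List.map_append, hd]
      simp [hPZ]
    · rcases hrun3 with ⟨h1, v', tr', h2, h3⟩ | ⟨h1, h2⟩
      · exact .inl ⟨h1.trans hrun2, v', tr', h2, by rw [hall, h3]; simp⟩
      · exact .inr ⟨h1, by rw [hall, h2]⟩
    · have hl := congrArg List.length hall
      have hl2 := congrArg List.length hd
      simp only [List.length_append, List.length_cons, List.length_map] at hl hl2
      rw [hout3, List.length_append, List.length_singleton]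
      omega
  · rintro s' ⟨hR', hb', hmcs, hch, ⟨a, ha, hca⟩, done, hd, hrun⟩ ht
    rcases hrun with ⟨hr1, -⟩ | ⟨-, hall⟩
    · simp [hr1] at ht
    refine ⟨hb', by rw [hall]; exact hd, hmcs, ?_⟩
    refine hch.append (by simp) fun x hx y hy => ?_
    rw [ha, Option.mem_some_iff] at hx
    simp only [List.head?_cons, Option.mem_some_iff, State.tick_clock, Test.cost, Expr.cost] at hy
    omega

end Enum331

end MCS

/-! ### Assembling the bounds for complete runs. -/

namespace MCS

/-- Otherwise every common subsequence could be lengthened forever. Existence matters because it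
puts the source on a path to the sink, so that the first extension of the traversal cannot get
stuck. -/
theorem exists_isMCS {α : Type*} (X Y : List α) : ∃ Z, IsMCS X Y Z := by
  by_contra! h
  have h1 : ∀ n, ∃ Z, IsCommonSubseq X Y Z ∧ n ≤ Z.length := by
    intro n
    induction n with
    | zero => exact ⟨[], ⟨List.nil_sublist _, List.nil_sublist _⟩, by simp⟩
    | succ n ih =>
      obtain ⟨Z, h2, h3⟩ := ih
      have h4 := h Z
      simp only [IsMCS, not_and, not_forall, not_not] at h4
      obtain ⟨P, Q, c, rfl, h5⟩ := h4 h2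
      exact ⟨_, h5, by simp at h3 ⊢; omega⟩
  obtain ⟨Z, h2, h3⟩ := h1 (X.length + 1)
  have := h2.1.length_le
  omega

theorem reflTransGen_of_isSourceSinkPath {A B : List ℕ} {P : List Vertex}
    (h : IsSourceSinkPath A B P) : Relation.ReflTransGen (EdgeG A B) source (sink A B) := by
  rw [isSourceSinkPath_iff] at h
  obtain ⟨h1, h2, h3⟩ := h
  rcases P with _ | ⟨p, l⟩
  · simp at h1
  · obtain rfl : p = source := by simpa using h1
    refine List.relationReflTransGen_of_exists_isChain_cons l h3 ?_
    rw [List.getLast?_eq_some_getLast (by simp)] at h2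
    exact Option.some.inj h2

theorem mem_normalize_le {X Y Z : List ℕ} (hZ : ∀ c ∈ Z, c ∈ X ++ Y) :
    ∀ c ∈ normalize X Y Z, 1 ≤ c ∧ c ≤ X.length + Y.length + 2 := by
  intro c hc
  rw [normalize_eq, List.mem_append, List.mem_cons, List.mem_map, List.mem_singleton] at hc
  rcases hc with (rfl | ⟨d, hd, rfl⟩) | rfl
  · omega
  · have := List.idxOf_lt_length_iff.2 (hZ d hd)
    rw [List.length_append] at this
    unfold rename
    omega
  · omega

theorem length_normalize (X Y Z : List ℕ) : (normalize X Y Z).length = Z.length + 2 := by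
  simp [normalize]

namespace Enum331

open Var Arr

variable {M W : ℕ} {X Y : List ℕ}

theorem numKeys_le (n m : ℕ) : numKeys (n + 2) (m + 2) ≤ (n + m + 4) ^ 3 := by
  unfold numKeys
  calc (n + 2 + 1) * (m + 2 + 1) * (n + 2 + (m + 2))
      ≤ (n + m + 4) * (n + m + 4) * (n + m + 4) :=
        Nat.mul_le_mul (Nat.mul_le_mul (by omega) (by omega)) (by omega)
    _ = (n + m + 4) ^ 3 := by ring

theorem fits_normalize (hM : (X.length + Y.length + 4) ^ 3 < M)
    (hW : (X.length + Y.length + 4) ^ 3 < W) :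
    Fits M W (normalize X Y X) (normalize X Y Y) (X.length + Y.length + 2) := by
  have hX : ∀ c ∈ X, c ∈ X ++ Y := fun c hc => List.mem_append_left _ hc
  have hY : ∀ c ∈ Y, c ∈ X ++ Y := fun c hc => List.mem_append_right _ hc
  have hk := numKeys_le X.length Y.length
  have hcube : ∀ k ≤ X.length + Y.length + 3, (X.length + Y.length + 2 + 1) * k < M := by
    intro k h
    refine lt_of_le_of_lt ?_ hM
    calc (X.length + Y.length + 2 + 1) * k
        ≤ (X.length + Y.length + 4) * (X.length + Y.length + 4) * 1 := by
          rw [mul_one]; exact Nat.mul_le_mul (by omega) (by omega)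
      _ ≤ (X.length + Y.length + 4) * (X.length + Y.length + 4) * (X.length + Y.length + 4) :=
          Nat.mul_le_mul_left _ (by omega)
      _ = (X.length + Y.length + 4) ^ 3 := by ring
  have hmem : ∀ Z : List ℕ, (∀ c ∈ Z, c ∈ X ++ Y) → ∀ i, 1 ≤ i → i ≤ (normalize X Y Z).length →
      1 ≤ charAt (normalize X Y Z) i ∧ charAt (normalize X Y Z) i ≤ X.length + Y.length + 2 := by
    intro Z hZ i h1 h2
    rw [charAt_eq_getElem h1 h2]
    exact mem_normalize_le hZ _ (List.getElem_mem _)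
  refine ⟨by simp [length_normalize], by simp [length_normalize], hmem X hX, hmem Y hY, ?_, ?_, ?_,
    ?_, ?_⟩
  · rintro u ⟨h1, h2, h3, h4, h5⟩ h
    rw [h] at h5
    simp only [normalize_eq] at h4 h5 ⊢
    rw [charAt_framed_last] at h5
    exact eq_length_of_charAt_framed (by omega) (rename_ne hY) h3 h4 h5.symm
  · rw [length_normalize]; exact (hcube _ (by omega)).le
  · rw [length_normalize]; exact (hcube _ (by omega)).le
  · rw [length_normalize, length_normalize]; omega
  · rw [length_normalize, length_normalize]; omega

theorem preprocessing_spec {s : State Var Arr} (hnx : s.reg nx = X.length)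
    (hny : s.reg ny = Y.length) (hX : ∀ i, s.mem inX i = X.getD i 0)
    (hY : ∀ i, s.mem inY i = Y.getD i 0) (hXW : ∀ c ∈ X, c ≤ W) (hYW : ∀ c ∈ Y, c ≤ W)
    (hM : (X.length + Y.length + 4) ^ 3 < M) (hW : (X.length + Y.length + 4) ^ 3 < W) :
    WP M W preprocessing (fun s' =>
      s'.clock ≤ s.clock + 7000 * (X.length + Y.length + 4) ^ 3 ∧
      ∃ es, Ready (normalize X Y X) (normalize X Y Y) (X ++ Y) es s') s := by
  have hf := fits_normalize hM hW
  have hself : X.length + Y.length + 4 ≤ (X.length + Y.length + 4) ^ 3 :=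
    Nat.le_self_pow (by norm_num) _
  have hsq : (X.length + Y.length + 4) ^ 2 ≤ (X.length + Y.length + 4) ^ 3 :=
    Nat.pow_le_pow_right (by omega) (by norm_num)
  have hk := numKeys_le X.length Y.length
  have hlX := length_normalize X Y X
  have hlY := length_normalize X Y Y
  rw [← hlX, ← hlY] at hk
  have htab : ∀ k ≤ X.length + Y.length + 3, (X.length + Y.length + 2 + 1) * k ≤
      (X.length + Y.length + 4) ^ 2 := by
    intro k h
    rw [sq]
    exact Nat.mul_le_mul (by omega) (by omega)
  have tA := htab ((normalize X Y X).length + 1) (by omega)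
  have tB := htab ((normalize X Y Y).length + 1) (by omega)
  generalize hNN : (X.length + Y.length + 4) ^ 3 = N3 at *
  -- By definition `constructGraphs` is the tail of the preprocessing.
  change WP M W (normalizeInput ;; buildTable Arr.X lx nextX prevX ;;
    buildTable Arr.Y ly nextY prevY ;; initIndices ;; constructGraphs) _ s
  refine WP.seq_mono (normalizeInput_spec X Y hnx hny hX hY hXW hYW (by omega) (by omega)) ?_
  rintro s1 hF1 ⟨hc1, hz1, hcat1, hX1, hY1⟩
  generalize (X.length + Y.length + 4) ^ 2 = N2 at *
  rw [← hlX] at hX1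
  rw [← hlY] at hY1
  refine WP.seq_mono (buildTable_spec Arr.X lx nextX prevX (normalize X Y X) _
    (X.length + Y.length + 2) rfl (by simp) (by simp) (by simp) (by simp)
    (by rw [hz1.lx, hlX]) hz1.sg hX1 hf.tableA (by omega) (by omega)) ?_
  rintro s2 hF2 ⟨hc2, hp2, hn2⟩
  have hz2 := hz1.frame hF2 (by simp [buildTable])
  have hY2 : ∀ i, 1 ≤ i → i ≤ (normalize X Y Y).length → s2.mem Arr.Y i =
      charAt (normalize X Y Y) i := by
    rw [hF2.mem Arr.Y (by simp [buildTable])]; exact hY1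
  refine WP.seq_mono (buildTable_spec Arr.Y ly nextY prevY (normalize X Y Y) _
    (X.length + Y.length + 2) rfl (by simp) (by simp) (by simp) (by simp)
    (by rw [hz2.ly, hlY]) hz2.sg hY2 hf.tableB (by omega) (by omega)) ?_
  rintro s3 hF3 ⟨hc3, hp3, hn3⟩
  have hz3 := hz2.frame hF3 (by simp [buildTable])
  have hkl := hf.keys_lt
  have hkW := hf.keys_le
  refine WP.seq_mono (initIndices_spec (normalize X Y X).length (normalize X Y Y).length
    (by rw [hz3.lx, hlX]) (by rw [hz3.ly, hlY]) hkl.le hkW.le hf.lenA hf.lenB) ?_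
  rintro s4 hF4 ⟨hc4, hK4, hrow4⟩
  have hT4 : HasTables (normalize X Y X) (normalize X Y Y) (X.length + Y.length + 2) s4 := by
    have hz4 := hz3.frame hF4 (by simp [initIndices])
    refine ⟨by rw [hz4.lx, hlX], by rw [hz4.ly, hlY], ?_, ?_, ?_, ?_, ?_, ?_⟩
    · rw [hF4.mem _ (by simp [initIndices]), hF3.mem _ (by simp [buildTable]),
        hF2.mem _ (by simp [buildTable])]
      exact hX1
    · rw [hF4.mem _ (by simp [initIndices]), hF3.mem _ (by simp [buildTable])]
      exact hY2
    · rw [hF4.mem _ (by simp [initIndices]), hF3.mem _ (by simp [buildTable])]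
      exact hp2
    · rw [hF4.mem _ (by simp [initIndices])]
      exact hp3
    · rw [hF4.mem _ (by simp [initIndices]), hF3.mem _ (by simp [buildTable])]
      exact hn2
    · rw [hF4.mem _ (by simp [initIndices])]
      exact hn3
  refine (constructGraphs_spec hf hT4 hK4).mono_frame ?_
  rintro s5 hF5 ⟨hc5, es, hG⟩
  have hreg : ∀ x ∈ [Var.lx, Var.ly], s5.reg x = s4.reg x := fun x hx => hF5.reg x (by
    revert x
    simp [constructGraphs, listEdges, findEdges, listEdge, buildSeqs, bfs, filterEdges])
  have hmem : ∀ a ∈ [Arr.X, Arr.row, Arr.cat], s5.mem a = s4.mem a := fun a ha => hF5.mem a (by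
    revert a
    simp [constructGraphs, listEdges, findEdges, listEdge, buildSeqs, bfs, filterEdges])
  refine ⟨?_, es, ?_, ?_, ?_, ?_, ?_, hG⟩
  · have e1 : X.length + Y.length + 2 + 1 ≤ N3 := by omega
    linarith
  · rw [hreg _ (by simp)]; exact hT4.lx
  · rw [hreg _ (by simp)]; exact hT4.ly
  · rw [hmem _ (by simp)]; exact hT4.X
  · rw [hmem _ (by simp)]; exact hrow4
  · rw [hmem _ (by simp), hF4.mem _ (by simp [initIndices]), hF3.mem _ (by simp [buildTable]),
      hF2.mem _ (by simp [buildTable]), List.length_append]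
    exact hcat1

theorem onPath_source (X Y : List ℕ) : OnPath (normalize X Y X) (normalize X Y Y) source := by
  obtain ⟨Z, hZ⟩ := exists_isMCS X Y
  obtain ⟨P, hP, -⟩ := exists_path_of_isMCS hZ
  exact ⟨isNode_source (by simp [length_normalize]) (by simp [length_normalize]), .refl,
    reflTransGen_of_isSourceSinkPath hP⟩

/-- What is known about a run of the algorithm that takes `X` and `Y` to the state `s` after the
preprocessing and to the state `s'` in the end. -/
structure RunSpec (X Y : List ℕ) (es : List (Vertex × Vertex)) (s s' : State Var Arr) : Prop where
  clock_le : s.clock ≤ 7000 * (X.length + Y.length + 4) ^ 3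
  out_preprocessing : s.out = []
  buf_preprocessing : s.buf = []
  buf : s'.buf = []
  graph : StoresGraph (normalize X Y X) (normalize X Y Y) es s
  paths : (pathsToSink (normalize X Y X) (normalize X Y Y) es source).map
    (pathString (normalize X Y X)) = s'.out.map (fun o => normalize X Y o.1)
  isMCS : ∀ o ∈ s'.out, (∀ c ∈ o.1, c ∈ X ++ Y) ∧ IsMCS X Y o.1
  delay : (s.clock :: s'.out.map Prod.snd ++ [s'.clock]).IsChain
    (fun t t' => t' ≤ t + delayBound (normalize X Y X))

/-- The bound `c` enters the word size because the original characters are copied to `cat` and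
finally emitted; it affects neither the number of cells nor the time. -/
theorem exists_run {c : ℕ} (hX : ∀ x ∈ X, x ≤ c) (hY : ∀ y ∈ Y, y ≤ c) :
    ∃ s s' es, enum331.Runs ((X.length + Y.length + 4) ^ 3 + 1)
      ((X.length + Y.length + 4) ^ 3 + c + 1) X Y s s' ∧ RunSpec X Y es s s' := by
  have hlX := length_normalize X Y X
  have hlY := length_normalize X Y Y
  have hk := numKeys_le X.length Y.length
  obtain ⟨s, hs, hc, es, hR⟩ := preprocessing_spec (M := (X.length + Y.length + 4) ^ 3 + 1)
    (W := (X.length + Y.length + 4) ^ 3 + c + 1) (s := enum331.init X Y) (X := X) (Y := Y)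
    rfl rfl (fun i => rfl) (fun i => rfl) (fun x hx => by have := hX x hx; omega)
    (fun y hy => by have := hY y hy; omega) (by omega) (by omega)
  obtain ⟨ho, hb⟩ := hs.frame.out (by
    simp [preprocessing, normalizeInput, addSentinels, buildTable, initIndices, listEdges,
      findEdges, listEdge, buildSeqs, bfs, filterEdges])
  obtain ⟨s', hs', h1, h2, h3, h4⟩ := enumeration_spec
    (M := (X.length + Y.length + 4) ^ 3 + 1) (W := (X.length + Y.length + 4) ^ 3 + c + 1)
    (onPath_source X Y) (by rw [hlX, hlY]; omega) (by rw [hlX, hlY]; omega)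
    (fun x hx => by
      rcases List.mem_append.1 hx with hx | hx
      · have := hX x hx; omega
      · have := hY x hx; omega) hR hb ho
  refine ⟨s, s', es, ⟨hs, hs'⟩, ?_, ho, hb, h1, hR.graph, h2, h3, h4⟩
  rw [show (enum331.init X Y).clock = 0 from rfl, zero_add] at hc
  exact hc

namespace RunSpec

variable {es : List (Vertex × Vertex)} {s s' : State Var Arr}

/-- The represented strings are pairwise distinct, and a list has no repetition if its image under
`normalize X Y` has none. -/
theorem nodup_out (h : RunSpec X Y es s s') : (s'.out.map Prod.fst).Nodup := by
  have h1 : ((pathsToSink (normalize X Y X) (normalize X Y Y) es source).map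
      (pathString (normalize X Y X))).Nodup :=
    (h.graph.nodup_pathsToSink source).map_on fun P hP Q hQ hPQ =>
      pathString_injOn (h.graph.mem_pathsToSink.1 hP) (h.graph.mem_pathsToSink.1 hQ) hPQ
  rw [h.paths] at h1
  refine List.Nodup.of_map (normalize X Y) ?_
  rwa [List.map_map]

theorem mem_out_iff (h : RunSpec X Y es s s') (Z : List ℕ) :
    Z ∈ s'.out.map Prod.fst ↔ IsMCS X Y Z := by
  constructor
  · intro hZ
    obtain ⟨o, ho, rfl⟩ := List.mem_map.1 hZ
    exact (h.isMCS o ho).2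
  · intro hZ
    obtain ⟨P, hP, hPZ⟩ := exists_path_of_isMCS hZ
    have h1 : normalize X Y Z ∈ s'.out.map (fun o => normalize X Y o.1) := by
      rw [← h.paths, ← hPZ]
      exact List.mem_map_of_mem (h.graph.mem_pathsToSink.2 hP)
    obtain ⟨o, ho, hoZ⟩ := List.mem_map.1 h1
    have h2 : ∀ c ∈ Z, c ∈ X ++ Y := fun c hc => List.mem_append_left _ (hZ.1.1.subset hc)
    -- On strings of characters that occur in `X` or `Y`, normalization can be undone, so equal
    -- normalized strings come from equal strings.
    rw [← restore_normalize h2, ← hoZ, restore_normalize (h.isMCS o ho).1]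
    exact List.mem_map_of_mem ho

theorem arraySize_le (h : RunSpec X Y es s s') :
    arraySize (normalize X Y X) (normalize X Y Y) s ≤ 2 * (X.length + Y.length + 4) ^ 3 + 1 := by
  have h1 := h.graph.arraySize_le
  have h2 := numKeys_le X.length Y.length
  rw [length_normalize, length_normalize] at h1
  omega

end RunSpec

end Enum331

theorem cube_length_le {L n : ℕ} {X Y : List ℕ} (hn : 1 ≤ n) (hX : X.length ≤ L * n)
    (hY : Y.length ≤ L * n) :
    X.length + Y.length + 4 ≤ (2 * L + 4) * n ∧
      (X.length + Y.length + 4) ^ 3 ≤ (2 * L + 4) ^ 3 * n ^ 3 := by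
  have h : X.length + Y.length + 4 ≤ (2 * L + 4) * n := by
    have : (2 * L + 4) * n = L * n + L * n + 4 * n := by ring
    omega
  exact ⟨h, by rw [← mul_pow]; exact Nat.pow_le_pow_left h 3⟩

theorem enum331_solves :
    SolvesMCSEnumeration enum331 (fun n _ => n ^ 3) (fun n _ => n ^ 3) (fun n _ => n) := by
  intro L
  obtain ⟨D, hD⟩ : ∃ D, D = (2 * L + 4) ^ 3 := ⟨_, rfl⟩
  have hD1 : 1 ≤ D := hD ▸ Nat.one_le_pow _ _ (by omega)
  have hLD : 2 * L + 4 ≤ D := hD ▸ Nat.le_self_pow (by norm_num) _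
  -- One constant serves all bounds: `7000 * D` for the preprocessing, the cardinalities for the
  -- cells, and `300 * (2 * L + 4) ≤ 7000 * D` for the delay.
  refine ⟨7000 * D + Fintype.card enum331.V + Fintype.card enum331.A * (2 * D),
    fun n c X Y hn hX hY hcX hcY => ?_⟩
  obtain ⟨hN, hN3⟩ := cube_length_le hn hX hY
  rw [← hD] at hN3
  have hn3 : 1 ≤ n ^ 3 := Nat.one_le_pow _ _ hn
  obtain ⟨s, s', es, hrun, h⟩ := Enum331.exists_run (fun x hx => (hcX x hx).2)
    (fun y hy => (hcY y hy).2)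
  refine ⟨_, _, s, s', hrun, ?_, ?_, ?_, h.out_preprocessing, h.buf_preprocessing, h.buf,
    h.nodup_out, h.mem_out_iff, ?_⟩
  -- For the word size only `C ≥ 3` and `C ≥ D + 2` matter: then `n ^ 3`, `c` and 1 are each at most
  -- `(n + c) ^ C`.
  · generalize hC : 7000 * D + _ + _ = C
    have hC3 : 3 ≤ C := by omega
    have hDC : D + 2 ≤ C := by omega
    have h1 : 1 ≤ (n + c) ^ C := Nat.one_le_pow _ _ (by omega)
    have h2 : c ≤ (n + c) ^ C := (Nat.le_add_left c n).trans (Nat.le_self_pow (by omega) _)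
    have h3 : n ^ 3 ≤ (n + c) ^ C :=
      (Nat.pow_le_pow_left (Nat.le_add_right n c) 3).trans (Nat.pow_le_pow_right (by omega) hC3)
    calc (X.length + Y.length + 4) ^ 3 + c + 1
        ≤ D * (n + c) ^ C + (n + c) ^ C + (n + c) ^ C := by
          have := hN3.trans (Nat.mul_le_mul_left D h3)
          omega
      _ = (D + 2) * (n + c) ^ C := by ring
      _ ≤ C * (n + c) ^ C := Nat.mul_le_mul_right _ hDC
  · calc s.clock ≤ 7000 * (D * n ^ 3) := h.clock_le.trans (Nat.mul_le_mul_left _ hN3)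
      _ = (7000 * D) * n ^ 3 := by ring
      _ ≤ _ := Nat.mul_le_mul_right _ (by omega)
  · have h1 : (X.length + Y.length + 4) ^ 3 + 1 ≤ 2 * D * n ^ 3 := by
      have := Nat.mul_le_mul hD1 hn3
      calc _ ≤ D * n ^ 3 + D * n ^ 3 := by omega
        _ = _ := by ring
    calc Fintype.card enum331.V + Fintype.card enum331.A * ((X.length + Y.length + 4) ^ 3 + 1)
        ≤ Fintype.card enum331.V * n ^ 3 + Fintype.card enum331.A * (2 * D * n ^ 3) :=
          Nat.add_le_add (Nat.le_mul_of_pos_right _ hn3) (Nat.mul_le_mul_left _ h1)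
      _ = (Fintype.card enum331.V + Fintype.card enum331.A * (2 * D)) * n ^ 3 := by ring
      _ ≤ _ := Nat.mul_le_mul_right _ (by omega)
  · refine h.delay.imp fun t t' ht => ht.trans (Nat.add_le_add_left ?_ t)
    calc Enum331.delayBound (normalize X Y X) ≤ 300 * ((2 * L + 4) * n) := by
          rw [Enum331.delayBound, length_normalize]; omega
      _ = (300 * (2 * L + 4)) * n := by ring
      _ ≤ _ := Nat.mul_le_mul_right _ (by omega)

end MCS

theorem theorem1 :
    MCS.SolvesMCSEnumeration MCS.enum331 (fun n _ => n ^ 3) (fun n _ => n ^ 3) (fun n _ => n) ∧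
    ∀ L : ℕ, ∃ C : ℕ, ∀ (n : ℕ) (X Y : List ℕ), 1 ≤ n → X.length ≤ L * n → Y.length ≤ L * n →
      ∀ (M W : ℕ) (s s' : MCS.State MCS.Enum331.Var MCS.Enum331.Arr),
        MCS.enum331.Runs M W X Y s s' →
        MCS.Enum331.StoresAllMCSGraph (MCS.normalize X Y X) (MCS.normalize X Y Y) s ∧
        MCS.Enum331.arraySize (MCS.normalize X Y X) (MCS.normalize X Y Y) s ≤ C * n ^ 3 ∧
        ∃ paths : List (List MCS.Vertex),
          paths.Nodup ∧
          (∀ P : List MCS.Vertex, P ∈ paths ↔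
            MCS.IsSourceSinkPath (MCS.normalize X Y X) (MCS.normalize X Y Y) P) ∧
          paths.map (MCS.pathString (MCS.normalize X Y X)) =
            s'.out.map (fun o => MCS.normalize X Y o.1) := by
  -- The factor 3 absorbs the summand 1 in the size bound `2 * (|X| + |Y| + 4) ^ 3 + 1`.
  refine ⟨MCS.enum331_solves, fun L => ⟨3 * (2 * L + 4) ^ 3, fun n X Y hn hX hY M W s s' hrun => ?_⟩⟩
  -- No alphabet is given here, so the sum of all characters serves as a bound for each of them.
  obtain ⟨t, t', es, hrun', h⟩ := MCS.Enum331.exists_run (X := X) (Y := Y) (c := X.sum + Y.sum)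
    (fun x hx => (List.le_sum_of_mem hx).trans (Nat.le_add_right _ _))
    (fun y hy => (List.le_sum_of_mem hy).trans (Nat.le_add_left _ _))
  -- The given run may have other memory limits than the constructed one, but it must end in the
  -- same states.
  obtain rfl := hrun.1.deterministic hrun'.1
  obtain rfl := hrun.2.deterministic hrun'.2
  refine ⟨h.graph.storesAllMCSGraph, ?_, MCS.Enum331.pathsToSink _ _ es MCS.source,
    h.graph.nodup_pathsToSink _, fun P => h.graph.mem_pathsToSink, h.paths⟩
  have h1 := (MCS.cube_length_le hn hX hY).2
  have h2 : 1 ≤ (2 * L + 4) ^ 3 * n ^ 3 :=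
    Nat.mul_pos (Nat.pow_pos (by omega)) (Nat.pow_pos hn)
  have h3 := h.arraySize_le
  rw [mul_assoc]
  omega
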